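/- We work in second order arithmetic. A predilator $D$ is an endofunctor on the category of linear orders with embeddings (strictly increasing maps), together with a natural transformation $\mathsf{supp}^D\colon D\Rightarrow[\cdot]^{<\omega}$ to the finite subset functor such that every $\sigma\in D(X)$ lies in the range of $D(\iota)$ for the inclusion $\iota\colon\mathsf{supp}^D_X(\sigma)\hookrightarrow X$. (In second order arithmetic, $D$ is coded by its restriction to the finite orders $n=\{0,\dots,n-1\}$; the elements of $D(X)$ for an arbitrary linear order $X$ are then represented by pairs of a finite subset $a\subseteq X$ and an element of $D(|a|)$ with full support.) For the purpose of this statement, a *1-fixed point* of $D$ is a linear order $X$ together with an embedding $\pi\colon X\to D(X)$ such that 1. the relation $s\triangleleft t:\Leftrightarrow s\in\mathsf{supp}_X(\pi(t))$ on $X$ is well founded, i.e. there is no infinite sequence $x_0,x_1,\dots$ in $X$ with $x_{n+1}\triangleleft x_n$ for all $n$ (this replaces the usual requirement of a height function $h\colon X\to\mathbb N$ with $h(s)<h(t)$ whenever $s\triangleleft t$); 2. $\mathrm{rng}(\pi)=\{\tau\in D(X)\mid \pi(s)<\tau\text{ for all }s\in\mathsf{supp}_X(\tau)\}$. An isomorphism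 between 1-fixed points $(X,\pi)$ and $(Y,\kappa)$ of $D$ is an isomorphism $f\colon X\to Y$ of linear orders with $\kappa\circ f=D(f)\circ\pi$. **Lemma.** $\mathsf{RCA}_0$ proves that the following are equivalent: (a) for every predilator $D$, any two 1-fixed points of $D$ (in the above sense) are isomorphic; (b) weak König's lemma: every infinite binary tree has an infinite path. Equivalently, in every model $(M,S)$ of $\mathsf{RCA}_0$ (with a possibly nonstandard first order part $M$), (a) holds if and only if (b) holds. -/

import Mathlib

/-
Second order arithmetic is treated through its (not necessarily standard) models: a structure for
the language consists of a first order part `M` with `0, 1, +, *, <` and a collection `S` of subsets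
of `M` over which set variables range.  By soundness and completeness of first order logic,
`RCA₀` proves a sentence if and only if it holds in every such structure that satisfies the axioms
of `RCA₀`.  In everything below, number quantifiers range over `M` and set quantifiers over `S`;
relations and functions are identified with the sets of their coded tuples.
-/

namespace SOA

universe u

/-- Numerical terms of the language of second order arithmetic. -/
inductive NumTerm : Type
  | var (i : ℕ)
  | zero
  | one
  | add (s t : NumTerm)
  | mul (s t : NumTerm)

/-- Formulas all of whose quantifiers are bounded number quantifiers (free set variables are
allowed); `ball x t φ` is `∀ x < t, φ`. -/
inductive BddFormula : Type
  | eq (s t : NumTerm)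
  | lt (s t : NumTerm)
  | mem (t : NumTerm) (i : ℕ)
  | neg (φ : BddFormula)
  | and (φ ψ : BddFormula)
  | ball (x : ℕ) (t : NumTerm) (φ : BddFormula)

section Defs

variable {M : Type u} [Zero M] [One M] [Add M] [Mul M] [LT M]

/-- Value of a term under an assignment of the number variables. -/
def NumTerm.eval (v : ℕ → M) : NumTerm → M
  | .var i => v i
  | .zero => 0
  | .one => 1
  | .add s t => s.eval v + t.eval v
  | .mul s t => s.eval v * t.eval v

/-- Satisfaction of a bounded formula under assignments of number and set variables. -/
def BddFormula.sat (V : ℕ → Set M) : BddFormula → (ℕ → M) → Prop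
  | .eq s t, v => s.eval v = t.eval v
  | .lt s t, v => s.eval v < t.eval v
  | .mem t i, v => t.eval v ∈ V i
  | .neg φ, v => ¬ φ.sat V v
  | .and φ ψ, v => φ.sat V v ∧ ψ.sat V v
  | .ball x t φ, v => ∀ a : M, a < t.eval v → φ.sat V (Function.update v x a)

/-- `P` is given by a `Σ⁰₁` formula `∃ m, θ(n, m)` with number parameters from `M` and set
parameters from `S`; the variables `0` and `1` stand for `n` and `m`. -/
def IsSigma01 (S : Set (Set M)) (P : M → Prop) : Prop :=
  ∃ (θ : BddFormula) (v : ℕ → M) (V : ℕ → Set M), (∀ i, V i ∈ S) ∧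
    ∀ n, P n ↔ ∃ m, θ.sat V (Function.update (Function.update v 0 n) 1 m)

/-- `P` is given by a `Π⁰₁` formula `∀ m, θ(n, m)` with parameters. -/
def IsPi01 (S : Set (Set M)) (P : M → Prop) : Prop :=
  ∃ (θ : BddFormula) (v : ℕ → M) (V : ℕ → Set M), (∀ i, V i ∈ S) ∧
    ∀ n, P n ↔ ∀ m, θ.sat V (Function.update (Function.update v 0 n) 1 m)

/-- `(M, S)` is a model of `RCA₀`: the basic axioms, `Σ⁰₁` induction and `Δ⁰₁` comprehension. -/
structure IsRCA0 (S : Set (Set M)) : Prop where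
  sets_nonempty : S.Nonempty
  succ_ne_zero : ∀ n : M, n + 1 ≠ 0
  succ_inj : ∀ m n : M, m + 1 = n + 1 → m = n
  add_zero : ∀ m : M, m + 0 = m
  add_succ : ∀ m n : M, m + (n + 1) = (m + n) + 1
  mul_zero : ∀ m : M, m * 0 = 0
  mul_succ : ∀ m n : M, m * (n + 1) = m * n + m
  not_lt_zero : ∀ m : M, ¬ m < 0
  lt_succ_iff : ∀ m n : M, m < n + 1 ↔ (m < n ∨ m = n)
  sigma_induction : ∀ P : M → Prop, IsSigma01 S P →
    P 0 → (∀ n, P n → P (n + 1)) → ∀ n, P n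
  delta_comprehension : ∀ P : M → Prop, IsSigma01 S P → IsPi01 S P → {n | P n} ∈ S

/-! ### Coding of tuples and finite sequences -/

/-- The usual pairing of numbers in second order arithmetic. -/
def pair (i j : M) : M := (i + j) * (i + j) + i

/-- The binary relation `R` belongs to the model. -/
def InS2 (S : Set (Set M)) (R : M → M → Prop) : Prop :=
  {z | ∃ a b, z = pair a b ∧ R a b} ∈ S

/-- The ternary relation `R` belongs to the model. -/
def InS3 (S : Set (Set M)) (R : M → M → M → Prop) : Prop :=
  {z | ∃ a b c, z = pair a (pair b c) ∧ R a b c} ∈ S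

/-- The quaternary relation `R` belongs to the model. -/
def InS4 (S : Set (Set M)) (R : M → M → M → M → Prop) : Prop :=
  {z | ∃ a b c d, z = pair a (pair b (pair c d)) ∧ R a b c d} ∈ S

/-- `F` is the graph of a function from `A` to `B`, and this graph belongs to the model. -/
def IsFun (S : Set (Set M)) (A B : Set M) (F : M → M → Prop) : Prop :=
  InS2 S F ∧ (∀ x y, F x y → x ∈ A ∧ y ∈ B) ∧ ∀ x ∈ A, ∃! y, F x y

/-- `c = (k, (m, n))` for some `m, n`.  Such a `c` describes a sequence of length `k` by means of
Gödel's beta function. -/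
def HasLen (c k : M) : Prop := ∃ m n, c = pair k (pair m n)

/-- The `i`-th entry of the sequence described by `c = (k, (m, n))` is `x`: here `i < k`, and `x` is
the remainder of `n` modulo `m * (i + 1) + 1`. -/
def Entry (c i x : M) : Prop :=
  ∃ k m n q, c = pair k (pair m n) ∧ i < k ∧
    n = q * (m * (i + 1) + 1) + x ∧ x < m * (i + 1) + 1

/-- `c` is the code of a finite sequence of length `k`, i.e. the least number describing it. -/
def IsSeq (k c : M) : Prop :=
  HasLen c k ∧ ∀ c', c' < c → HasLen c' k → ¬ ∀ i x, Entry c' i x ↔ Entry c i x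

/-- For sequences viewed as functions, `h = g ∘ f`. -/
def IsComp (f g h : M) : Prop :=
  ∀ i y, Entry h i y ↔ ∃ x, Entry f i x ∧ Entry g x y

/-! ### Weak König's lemma -/

/-- `T` is a binary tree: a set of finite 0-1-sequences closed under initial segments. -/
def IsBinaryTree (T : Set M) : Prop :=
  (∀ c ∈ T, (∃ k, IsSeq k c) ∧ ∀ i x, Entry c i x → x = 0 ∨ x = 1) ∧
  ∀ c ∈ T, ∀ k, IsSeq k c → ∀ j, j < k → ∀ c', IsSeq j c' →
    (∀ i x, Entry c' i x → Entry c i x) → c' ∈ T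

/-- Weak König's lemma in the model: every infinite binary tree has an infinite path. -/
def WKL (S : Set (Set M)) : Prop :=
  ∀ T ∈ S, IsBinaryTree T → (∀ n : M, ∃ c ∈ T, n < c) →
    ∃ G : M → M → Prop, IsFun S Set.univ {x | x = 0 ∨ x = 1} G ∧
      ∀ k, ∃ c ∈ T, IsSeq k c ∧ ∀ i x, i < k → G i x → Entry c i x

/-! ### Linear orders and coded predilators -/

/-- A (strict) linear order in the model. -/
structure LinOrd (S : Set (Set M)) where
  dom : Set M
  lt : M → M → Prop
  dom_mem : dom ∈ S
  lt_mem : InS2 S lt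
  lt_dom : ∀ x y, lt x y → x ∈ dom ∧ y ∈ dom
  irrefl : ∀ x, ¬ lt x x
  trans : ∀ x y z, lt x y → lt y z → lt x z
  total : ∀ x ∈ dom, ∀ y ∈ dom, lt x y ∨ x = y ∨ lt y x

/-- `f` is (the code of) a morphism from `n = {0, …, n-1}` to `m = {0, …, m-1}` in the category of
finite linear orders: a strictly increasing sequence of length `n` with entries below `m`. -/
def Mor (n m f : M) : Prop :=
  IsSeq n f ∧ (∀ i x, Entry f i x → x < m) ∧
    ∀ i j x y, i < j → Entry f i x → Entry f j y → x < y

/-- A predilator in the model.  As usual in second order arithmetic, it is represented by its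
restriction to the finite orders `n = {0, …, n-1}`: a functor `n ↦ D(n)` into linear orders together
with a natural transformation `supp` from `D` to the finite subset functor that satisfies the
support condition. -/
structure Predilator (S : Set (Set M)) where
  /-- `el n σ` means `σ ∈ D(n)`. -/
  el : M → M → Prop
  /-- `lt n σ τ` means `σ < τ` in `D(n)`. -/
  lt : M → M → M → Prop
  /-- `map m f σ τ` means `D(f)(σ) = τ`, where `f` is a morphism with codomain `m`. -/
  map : M → M → M → M → Prop
  /-- `supp n σ i` means that `i` is in the support of `σ ∈ D(n)`. -/
  supp : M → M → M → Prop
  el_mem : InS2 S el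
  lt_mem : InS3 S lt
  map_mem : InS4 S map
  supp_mem : InS3 S supp
  -- each `D(n)` is a linear order
  lt_el : ∀ n σ τ, lt n σ τ → el n σ ∧ el n τ
  lt_irrefl : ∀ n σ, ¬ lt n σ σ
  lt_trans : ∀ n σ τ ρ, lt n σ τ → lt n τ ρ → lt n σ ρ
  lt_total : ∀ n σ τ, el n σ → el n τ → lt n σ τ ∨ σ = τ ∨ lt n τ σ
  -- each `D(f)` with `f : n → m` is an embedding from `D(n)` into `D(m)`
  map_el : ∀ m f σ τ, map m f σ τ → ∃ n, Mor n m f ∧ el n σ ∧ el m τ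
  map_exists_unique : ∀ n m f σ, Mor n m f → el n σ → ∃! τ, map m f σ τ
  map_lt : ∀ n m f σ σ' τ τ', Mor n m f → lt n σ σ' → map m f σ τ → map m f σ' τ' → lt m τ τ'
  -- functoriality
  map_id : ∀ n f σ, Mor n n f → (∀ i, i < n → Entry f i i) → el n σ → map n f σ σ
  map_comp : ∀ n m k f g h σ τ ρ, Mor n m f → Mor m k g → Mor n k h → IsComp f g h →
    map m f σ τ → map k g τ ρ → map k h σ ρ
  -- supports are subsets of `n`, natural, and satisfy the support condition
  supp_el : ∀ n σ i, supp n σ i → el n σ ∧ i < n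
  supp_natural : ∀ n m f σ τ, Mor n m f → map m f σ τ →
    ∀ j, supp m τ j ↔ ∃ i, supp n σ i ∧ Entry f i j
  supp_condition : ∀ m τ, el m τ → ∃ n f σ, Mor n m f ∧
    (∀ j, (∃ i, Entry f i j) ↔ supp m τ j) ∧ map m f σ τ

/-- `e` is (the code of) a strictly increasing sequence of length `n` in the order `X`, i.e. the
increasing enumeration of a finite subset of `X` with `n` elements. -/
def IncSeq {S : Set (Set M)} (X : LinOrd S) (n e : M) : Prop :=
  IsSeq n e ∧ (∀ i x, Entry e i x → x ∈ X.dom) ∧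
    ∀ i j x y, i < j → Entry e i x → Entry e j y → X.lt x y

/-- Elements of `D(X)` for an arbitrary linear order `X`: pairs `(e, σ)` where `e` enumerates a finite
subset of `X`, say with `n` elements, and `σ ∈ D(n)` has full support `{0, …, n-1}`.  Such a pair
stands for `D(e)(σ)`. -/
def DMem {S : Set (Set M)} (D : Predilator S) (X : LinOrd S) (τ : M) : Prop :=
  ∃ n e σ, τ = pair e σ ∧ IncSeq X n e ∧ D.el n σ ∧ ∀ i, i < n → D.supp n σ i

/-- The order of `D(X)`: elements `(e, σ)` and `(e', σ')` are compared by factoring `e` and `e'`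
through a common finite suborder of `X`, enumerated by `d`, with `k` elements, and comparing the
corresponding elements of `D(k)`. -/
def DLt {S : Set (Set M)} (D : Predilator S) (X : LinOrd S) (τ τ' : M) : Prop :=
  DMem D X τ ∧ DMem D X τ' ∧
    ∃ e σ e' σ' k d n f n' f' ρ ρ', τ = pair e σ ∧ τ' = pair e' σ' ∧
      IncSeq X k d ∧ Mor n k f ∧ IsComp f d e ∧ Mor n' k f' ∧ IsComp f' d e' ∧
      D.map k f σ ρ ∧ D.map k f' σ' ρ' ∧ D.lt k ρ ρ'

/-- `x` is in the support of the element `τ` of `D(X)`: the support of `(e, σ)` is the set enumerated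
by `e`. -/
def DSupp (τ x : M) : Prop := ∃ e σ i, τ = pair e σ ∧ Entry e i x

/-- `D(F)(τ) = τ'` for `τ ∈ D(X)`, `τ' ∈ D(Y)` and an embedding `F` from `X` to `Y` (given by its
graph): `D(F)(e, σ) = (F ∘ e, σ)`. -/
def DMap (F : M → M → Prop) (τ τ' : M) : Prop :=
  ∃ e σ e', τ = pair e σ ∧ τ' = pair e' σ ∧
    ∀ i y, Entry e' i y ↔ ∃ x, Entry e i x ∧ F x y

/-! ### 1-fixed points -/

/-- A 1-fixed point of `D` in the modified sense: a linear order `X` with an embedding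
`π : X → D(X)` such that the relation `s ◁ t :↔ s ∈ supp (π t)` is well founded and such that the
range of `π` consists of those `τ ∈ D(X)` with `π s < τ` for all `s ∈ supp τ`. -/
structure WfOneFixedPoint {S : Set (Set M)} (D : Predilator S) where
  X : LinOrd S
  /-- The graph of `π`. -/
  π : M → M → Prop
  π_fun : IsFun S X.dom {τ | DMem D X τ} π
  π_lt : ∀ x y σ τ, X.lt x y → π x σ → π y τ → DLt D X σ τ
  /-- There is no infinite sequence in `X` that descends with respect to `◁`. -/
  wf : ¬ ∃ G : M → M → Prop, IsFun S Set.univ X.dom G ∧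
    ∀ n s t τ, G (n + 1) s → G n t → π t τ → DSupp τ s
  range : ∀ τ, DMem D X τ →
    ((∃ x, π x τ) ↔ ∀ s, DSupp τ s → ∀ ρ, π s ρ → DLt D X ρ τ)

/-- `F` is (the graph of) an isomorphism between the fixed points `(X, π)` and `(Y, κ)`: an
isomorphism of linear orders with `κ ∘ F = D(F) ∘ π`. -/
def IsFixedPointIso {S : Set (Set M)} {D : Predilator S} (P Q : WfOneFixedPoint D)
    (F : M → M → Prop) : Prop :=
  IsFun S P.X.dom Q.X.dom F ∧
  (∀ y ∈ Q.X.dom, ∃ x, F x y) ∧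
  (∀ x x' y y', F x y → F x' y' → (P.X.lt x x' ↔ Q.X.lt y y')) ∧
  ∀ x y τ τ', F x y → P.π x τ → Q.π y τ' → DMap F τ τ'

/-- For every predilator, any two 1-fixed points in the modified sense are isomorphic. -/
def OneFixedPointsUnique (S : Set (Set M)) : Prop :=
  ∀ (D : Predilator S) (P Q : WfOneFixedPoint D), ∃ F, IsFixedPointIso P Q F

end Defs

end SOA

/-! The proof takes place inside an arbitrary model of `RCA₀`, whose first order part may be
nonstandard. The only induction available is over Σ⁰₁ predicates of the model, and every set,
function or tree that is used must be shown to belong to the model.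

Weak König's lemma gives uniqueness. Call a finite subset of a fixed point closed if it contains the
support of π x for each of its elements x. Supports lie below x (`lt_of_rng`), so a closed set can
be mapped into any other fixed point by going through it in increasing order: the value π x is
transported along the part of the map already built, and the range condition says that the result
has a preimage, which becomes the image of x (`PartialIso.extend`). Such partial isomorphisms are
unique, so their union is an isomorphism as soon as every element lies in a finite closed set.
Suppose x does not. Collecting supports repeatedly then never stabilises, so there are ◁-descending
chains from x of every finite length (`closed_or_chain`). As supports are finite, the attempts to
build an infinite chain form a finitely branching search. It is made binary by approximating the
characteristic function of the graph of the chain. A path is an infinite ◁-descending sequence,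
against well-foundedness (`exists_closed`).

Conversely, let T be an infinite binary tree without path. Order T by a linear order L in which
longer sequences are smaller, and let D(X) = L × (1 + X) × (1 + X) with the lexicographic order. One
fixed point consists of finite terms built from labels in L and at most two arguments. A second one
has, in addition, an atomic term for each t in T, which behaves like the term with label t whose
arguments are the atoms of the children of t. Proper terms have subterms with smaller codes, so a
◁-descending sequence eventually reaches an atom and then traces an infinite branch of T; as T has
no path, both fixed points are well founded. An isomorphism from the second to the first turns the
atoms along a branch into terms with strictly decreasing codes (`Branching.iso_child_lt`). The code
of the image of the root therefore bounds the length of every sequence in T, and T would be finite.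

What remains is infrastructure: arithmetic, a calculus of decidable and Σ⁰₁ predicates and of
computable functions that is driven by instance search, sequence coding with the beta function, and
course of values recursion. -/

namespace SOA

set_option linter.unusedSectionVars false
set_option synthInstance.maxSize 2000
set_option synthInstance.maxHeartbeats 200000

universe u

/-! ### The ordered semiring structure of the first order part -/

section RawAxioms

variable {M : Type u} [Zero M] [One M] [Add M] [Mul M] [LT M] {S : Set (Set M)}

/-- Induction for bounded formulas without set parameters. -/
theorem IsRCA0.ind (hS : IsRCA0 S) (θ : BddFormula) (v : ℕ → M) (P : M → Prop)
    (h : ∀ (V : ℕ → Set M) n, P n ↔ ∃ m, θ.sat V (Function.update (Function.update v 0 n) 1 m))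
    (h0 : P 0) (hs : ∀ n, P n → P (n + 1)) (n : M) : P n := by
  obtain ⟨A, hA⟩ := hS.sets_nonempty
  exact hS.sigma_induction P ⟨θ, v, fun _ => A, fun _ => hA, h _⟩ h0 hs n

/-- Assignment of at most two parameters to the variables `2` and `3`. -/
def params (a b : M) : ℕ → M := fun i => if i = 2 then a else b

@[simp] theorem params_two (a b : M) : params a b 2 = a := rfl
@[simp] theorem params_three (a b : M) : params a b 3 = b := rfl

namespace IsRCA0

variable (hS : IsRCA0 S)
include hS

protected theorem add_assoc (a b n : M) : a + b + n = a + (b + n) := by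
  refine hS.ind (.eq (.add (.add (.var 2) (.var 3)) (.var 0)) (.add (.var 2) (.add (.var 3) (.var 0))))
    (params a b) (fun n => a + b + n = a + (b + n)) ?_ ?_ ?_ n
  · intro V n; simp [BddFormula.sat, NumTerm.eval]
  · simp [hS.add_zero]
  · intro n ih; rw [hS.add_succ, ih, hS.add_succ, hS.add_succ]

protected theorem zero_add (n : M) : 0 + n = n := by
  refine hS.ind (.eq (.add .zero (.var 0)) (.var 0)) (params 0 0) (fun n => 0 + n = n) ?_ ?_ ?_ n
  · intro V n; simp [BddFormula.sat, NumTerm.eval]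
  · exact hS.add_zero 0
  · intro n ih; rw [hS.add_succ, ih]

protected theorem succ_add (a n : M) : a + 1 + n = a + n + 1 := by
  refine hS.ind (.eq (.add (.add (.var 2) .one) (.var 0)) (.add (.add (.var 2) (.var 0)) .one))
    (params a 0) (fun n => a + 1 + n = a + n + 1) ?_ ?_ ?_ n
  · intro V n; simp [BddFormula.sat, NumTerm.eval]
  · simp [hS.add_zero]
  · intro n ih; rw [hS.add_succ, ih, hS.add_succ]

protected theorem add_comm (a n : M) : a + n = n + a := by
  refine hS.ind (.eq (.add (.var 2) (.var 0)) (.add (.var 0) (.var 2)))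
    (params a 0) (fun n => a + n = n + a) ?_ ?_ ?_ n
  · intro V n; simp [BddFormula.sat, NumTerm.eval]
  · simp [hS.add_zero, hS.zero_add]
  · intro n ih; rw [hS.add_succ, ih, hS.succ_add]

protected theorem zero_mul (n : M) : 0 * n = 0 := by
  refine hS.ind (.eq (.mul .zero (.var 0)) .zero) (params 0 0) (fun n => 0 * n = 0) ?_ ?_ ?_ n
  · intro V n; simp [BddFormula.sat, NumTerm.eval]
  · exact hS.mul_zero 0
  · intro n ih; rw [hS.mul_succ, ih, hS.add_zero]

protected theorem succ_mul (a n : M) : (a + 1) * n = a * n + n := by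
  refine hS.ind (.eq (.mul (.add (.var 2) .one) (.var 0)) (.add (.mul (.var 2) (.var 0)) (.var 0)))
    (params a 0) (fun n => (a + 1) * n = a * n + n) ?_ ?_ ?_ n
  · intro V n; simp [BddFormula.sat, NumTerm.eval]
  · simp [hS.mul_zero, hS.add_zero]
  · intro n ih
    rw [hS.mul_succ, ih, hS.mul_succ, hS.add_assoc, hS.add_assoc, hS.add_succ n a, hS.add_succ a n,
      hS.add_comm n a]

protected theorem mul_comm (a n : M) : a * n = n * a := by
  refine hS.ind (.eq (.mul (.var 2) (.var 0)) (.mul (.var 0) (.var 2)))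
    (params a 0) (fun n => a * n = n * a) ?_ ?_ ?_ n
  · intro V n; simp [BddFormula.sat, NumTerm.eval]
  · simp [hS.mul_zero, hS.zero_mul]
  · intro n ih; rw [hS.mul_succ, ih, hS.succ_mul]

protected theorem mul_add (a b n : M) : a * (b + n) = a * b + a * n := by
  refine hS.ind (.eq (.mul (.var 2) (.add (.var 3) (.var 0)))
      (.add (.mul (.var 2) (.var 3)) (.mul (.var 2) (.var 0))))
    (params a b) (fun n => a * (b + n) = a * b + a * n) ?_ ?_ ?_ n
  · intro V n; simp [BddFormula.sat, NumTerm.eval]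
  · simp [hS.mul_zero, hS.add_zero]
  · intro n ih; rw [hS.add_succ, hS.mul_succ, ih, hS.mul_succ, hS.add_assoc]

protected theorem mul_assoc (a b n : M) : a * b * n = a * (b * n) := by
  refine hS.ind (.eq (.mul (.mul (.var 2) (.var 3)) (.var 0)) (.mul (.var 2) (.mul (.var 3) (.var 0))))
    (params a b) (fun n => a * b * n = a * (b * n)) ?_ ?_ ?_ n
  · intro V n; simp [BddFormula.sat, NumTerm.eval]
  · simp [hS.mul_zero]
  · intro n ih; rw [hS.mul_succ, ih, hS.mul_succ, hS.mul_add]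

protected theorem mul_one (a : M) : a * 1 = a := by
  rw [← hS.zero_add 1, hS.mul_succ, hS.mul_zero, hS.zero_add]

/-- The semiring structure of the first order part of a model of `RCA₀`. -/
abbrev commSemiring : CommSemiring M where
  zero := 0
  one := 1
  add := (· + ·)
  mul := (· * ·)
  add_assoc := hS.add_assoc
  zero_add := hS.zero_add
  add_zero := hS.add_zero
  add_comm := hS.add_comm
  left_distrib := hS.mul_add
  right_distrib a b c := by
    change (a + b) * c = a * c + b * c
    rw [hS.mul_comm, hS.mul_add, hS.mul_comm c a, hS.mul_comm c b]
  zero_mul := hS.zero_mul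
  mul_zero := hS.mul_zero
  mul_assoc := hS.mul_assoc
  one_mul a := (hS.mul_comm 1 a).trans (hS.mul_one a)
  mul_one := hS.mul_one
  mul_comm := hS.mul_comm
  nsmul := nsmulRec
  npow := @npowRec M ⟨1⟩ ⟨(· * ·)⟩

protected theorem add_right_cancel (a b n : M) (h : a + n = b + n) : a = b := by
  revert h
  -- Bounded formulas provide only negation, conjunction and bounded quantifiers, so the implication
  -- A → B is written as ¬(A ∧ ¬B).
  refine hS.ind (.neg (.and (.eq (.add (.var 2) (.var 0)) (.add (.var 3) (.var 0)))
      (.neg (.eq (.var 2) (.var 3)))))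
    (params a b) (fun n => a + n = b + n → a = b) ?_ ?_ ?_ n
  · intro V n; simp [BddFormula.sat, NumTerm.eval]
  · simp [hS.add_zero]
  · intro n ih; rw [hS.add_succ, hS.add_succ]; exact fun h => ih (hS.succ_inj _ _ h)

theorem lt_add_succ (a n : M) : a < a + n + 1 := by
  refine hS.ind (.lt (.var 2) (.add (.add (.var 2) (.var 0)) .one))
    (params a 0) (fun n => a < a + n + 1) ?_ ?_ ?_ n
  · intro V n; simp [BddFormula.sat, NumTerm.eval]
  · rw [hS.add_zero]; exact (hS.lt_succ_iff _ _).2 (Or.inr rfl)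
  · intro n ih; rw [hS.add_succ]; exact (hS.lt_succ_iff _ _).2 (Or.inl ih)

theorem exists_of_lt (a n : M) (h : a < n) : ∃ k, n = a + k + 1 := by
  -- The existential quantifier is moved in front of the implication, so that the induction formula
  -- has the shape ∃ m, θ with θ bounded.
  suffices h' : ∃ k, a < n → n = a + k + 1 by
    obtain ⟨k, hk⟩ := h'; exact ⟨k, hk h⟩
  refine hS.ind (.neg (.and (.lt (.var 2) (.var 0))
      (.neg (.eq (.var 0) (.add (.add (.var 2) (.var 1)) .one)))))
    (params a 0) (fun n => ∃ k, a < n → n = a + k + 1) ?_ ?_ ?_ n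
  · intro V n; simp [BddFormula.sat, NumTerm.eval]
  · exact ⟨0, fun h => (hS.not_lt_zero _ h).elim⟩
  · rintro n ⟨k, ih⟩
    by_cases h : a < n
    · refine ⟨k + 1, fun _ => ?_⟩
      rw [hS.add_succ, ← ih h]
    · refine ⟨0, fun h' => ?_⟩
      rcases (hS.lt_succ_iff _ _).1 h' with h' | h'
      · exact (h h').elim
      · rw [hS.add_zero, h']

theorem lt_iff_exists (a n : M) : a < n ↔ ∃ k, n = a + k + 1 :=
  ⟨hS.exists_of_lt a n, fun ⟨k, hk⟩ => hk ▸ hS.lt_add_succ a k⟩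

protected theorem lt_irrefl (a : M) : ¬ a < a := by
  intro h
  obtain ⟨k, hk⟩ := hS.exists_of_lt _ _ h
  rw [hS.add_assoc] at hk
  have : 0 + a = (k + 1) + a := by rw [hS.zero_add, hS.add_comm (k + 1) a]; exact hk
  exact hS.succ_ne_zero k (hS.add_right_cancel _ _ _ this).symm

protected theorem lt_trans {a b c : M} (h : a < b) (h' : b < c) : a < c := by
  obtain ⟨k, rfl⟩ := hS.exists_of_lt _ _ h
  obtain ⟨l, rfl⟩ := hS.exists_of_lt _ _ h'
  rw [hS.add_assoc a k 1, hS.add_assoc a]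
  exact hS.lt_add_succ _ _

protected theorem zero_le (a : M) : 0 < a ∨ 0 = a := by
  refine hS.ind (.neg (.and (.neg (.lt .zero (.var 0))) (.neg (.eq .zero (.var 0)))))
    (params 0 0) (fun a => 0 < a ∨ 0 = a) ?_ ?_ ?_ a
  · intro V n; simp [BddFormula.sat, NumTerm.eval, or_iff_not_imp_left]
  · exact Or.inr rfl
  · intro n ih
    exact Or.inl ((hS.lt_succ_iff _ _).2 ih)

protected theorem lt_total (a b : M) : a < b ∨ a = b ∨ b < a := by
  refine hS.ind (.neg (.and (.neg (.lt (.var 0) (.var 2))) (.and (.neg (.eq (.var 0) (.var 2)))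
      (.neg (.lt (.var 2) (.var 0))))))
    (params b 0) (fun a => a < b ∨ a = b ∨ b < a) ?_ ?_ ?_ a
  · intro V n; simp [BddFormula.sat, NumTerm.eval, or_iff_not_imp_left]
  · rcases hS.zero_le b with h | h
    · exact Or.inl h
    · exact Or.inr (Or.inl h)
  · rintro n (h | rfl | h)
    · obtain ⟨k, rfl⟩ := hS.exists_of_lt _ _ h
      rcases hS.zero_le k with hk | rfl
      · obtain ⟨l, rfl⟩ := hS.exists_of_lt _ _ hk
        left
        rw [hS.zero_add, ← hS.succ_add]
        exact (hS.lt_iff_exists _ _).2 ⟨l, by rw [hS.add_succ]⟩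
      · right; left; rw [hS.add_zero]
    · exact Or.inr (Or.inr ((hS.lt_succ_iff _ _).2 (Or.inr rfl)))
    · exact Or.inr (Or.inr ((hS.lt_succ_iff _ _).2 (Or.inl h)))

/-- The linear order of the first order part of a model of `RCA₀`. -/
noncomputable abbrev linearOrder : LinearOrder M where
  le a b := a < b ∨ a = b
  lt a b := a < b
  le_refl _ := Or.inr rfl
  le_trans := by
    rintro a b c (h | rfl) (h' | rfl)
    · exact Or.inl (hS.lt_trans h h')
    · exact Or.inl h
    · exact Or.inl h'
    · exact Or.inr rfl
  lt_iff_le_not_ge a b := by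
    constructor
    · refine fun h => ⟨Or.inl h, ?_⟩
      rintro (h' | rfl)
      · exact hS.lt_irrefl _ (hS.lt_trans h h')
      · exact hS.lt_irrefl _ h
    · rintro ⟨h | rfl, h'⟩
      · exact h
      · exact (h' (Or.inr rfl)).elim
  le_antisymm := by
    rintro a b (h | rfl) (h' | h')
    · exact (hS.lt_irrefl _ (hS.lt_trans h h')).elim
    · exact h'.symm
    · rfl
    · rfl
  le_total a b := by
    rcases hS.lt_total a b with h | h | h
    · exact Or.inl (Or.inl h)
    · exact Or.inl (Or.inr h)
    · exact Or.inr (Or.inl h)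
  toDecidableLE := Classical.decRel _

theorem isStrictOrderedRing :
    let := hS.commSemiring; let := hS.linearOrder; IsStrictOrderedRing M := by
  let := hS.commSemiring; let := hS.linearOrder
  have key : ∀ a n : M, a < n ↔ ∃ k, n = a + k + 1 := hS.lt_iff_exists
  have hadd : ∀ a b : M, a < b → ∀ c, c + a < c + b := by
    intro a b h c
    obtain ⟨k, rfl⟩ := (key _ _).1 h
    exact (key _ _).2 ⟨k, by ring⟩
  have hmul : ∀ a b : M, a < b → ∀ c, 0 < c → c * a < c * b := by
    intro a b h c hc
    obtain ⟨k, rfl⟩ := (key _ _).1 h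
    obtain ⟨l, rfl⟩ := (key _ _).1 hc
    exact (key _ _).2 ⟨l * k + k + l, by ring⟩
  exact
    { add_le_add_left := fun a b h c => by
        rcases h with h | rfl
        · rw [add_comm a, add_comm b]; exact Or.inl (hadd _ _ h c)
        · exact le_rfl
      le_of_add_le_add_left := fun a b c h => by
        by_contra h'
        exact absurd h (not_le.2 (hadd _ _ (not_le.1 h') a))
      zero_le_one := Or.inl ((key _ _).2 ⟨0, by ring⟩)
      exists_pair_ne := ⟨1, 0, by
        intro h
        exact hS.succ_ne_zero 0 ((hS.zero_add 1).trans h)⟩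
      mul_lt_mul_of_pos_left := fun c hc a b h => hmul a b h c hc
      mul_lt_mul_of_pos_right := fun c hc a b h => by
        simpa only [mul_comm] using hmul a b h c hc }

end IsRCA0

end RawAxioms

/-- Ordered semirings that behave like the natural numbers as far as the order is concerned. -/
class NatLike (M : Type u) [CommSemiring M] [LinearOrder M] : Prop extends
    IsStrictOrderedRing M, CanonicallyOrderedAdd M where
  le_of_lt_succ : ∀ a b : M, a < b + 1 → a ≤ b

/-! ### Discreteness of the order and injectivity of pairing -/

section Arithmetic

variable {M : Type u} [CommSemiring M] [LinearOrder M] [NatLike M]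

theorem lt_succ {a b : M} : a < b + 1 ↔ a ≤ b :=
  ⟨NatLike.le_of_lt_succ a b, fun h => h.trans_lt (lt_add_one b)⟩

theorem succ_le {a b : M} : a + 1 ≤ b ↔ a < b := by
  rw [← lt_succ, add_lt_add_iff_right]

theorem pos_or_zero (a : M) : a = 0 ∨ ∃ b, a = b + 1 := by
  rcases eq_or_ne a 0 with h | h
  · exact Or.inl h
  · have h1 : 0 + 1 ≤ a := succ_le.2 (pos_iff_ne_zero.2 h)
    obtain ⟨c, rfl⟩ := exists_add_of_le h1
    exact Or.inr ⟨c, by ring⟩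

theorem exists_add_succ {a b : M} (h : a < b) : ∃ c, b = a + c + 1 := by
  obtain ⟨c, rfl⟩ := exists_add_of_le (succ_le.2 h)
  exact ⟨c, by ring⟩

theorem le_mul_self (a : M) : a ≤ a * a := by
  rcases pos_or_zero a with rfl | ⟨b, rfl⟩
  · simp
  · exact le_mul_of_one_le_right (zero_le) (by simp)

theorem le_pair_left (i j : M) : i ≤ pair i j := le_add_self

theorem le_pair_right (i j : M) : j ≤ pair i j :=
  le_add_self.trans ((le_mul_self (i + j)).trans le_self_add)

/-- The code of (i, j) lies between the squares of i + j and i + j + 1, hence it determines the sum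
i + j. -/
theorem pair_sum_le {i j k l : M} (h : pair i j = pair k l) : k + l ≤ i + j := by
  by_contra h'
  have h1 : i + j + 1 ≤ k + l := succ_le.2 (not_le.1 h')
  have h2 : (i + j + 1) * (i + j + 1) ≤ pair i j :=
    (mul_le_mul' h1 h1).trans (le_self_add.trans h.ge)
  have h3 : pair i j < (i + j + 1) * (i + j + 1) := by
    have h4 : (i + j + 1) * (i + j + 1) = pair i j + (i + j + j + 1) := by unfold pair; ring
    rw [h4]
    exact lt_add_of_pos_right _ (lt_of_lt_of_le zero_lt_one le_add_self)
  exact absurd h2 (not_le.2 h3)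

theorem pair_inj {i j k l : M} : pair i j = pair k l ↔ i = k ∧ j = l := by
  refine ⟨fun h => ?_, fun ⟨h, h'⟩ => by rw [h, h']⟩
  have hs : i + j = k + l := le_antisymm (pair_sum_le h.symm) (pair_sum_le h)
  have hi : i = k := by
    have h' := h
    unfold pair at h'
    rw [hs] at h'
    exact add_left_cancel h'
  subst hi
  exact ⟨rfl, add_left_cancel hs⟩

theorem pair_mono {i j k l : M} (h : i ≤ k) (h' : j ≤ l) : pair i j ≤ pair k l := by
  unfold pair
  gcongr

end Arithmetic

/-! ### Basic sets obtained from bounded formulas -/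

section Formulas

variable {M : Type u} [CommSemiring M] [LinearOrder M] [NatLike M]

/-- The term for the pairing function. -/
def pairT (s t : NumTerm) : NumTerm := .add (.mul (.add s t) (.add s t)) s

@[simp] theorem eval_pairT (v : ℕ → M) (s t : NumTerm) :
    (pairT s t).eval v = pair (s.eval v) (t.eval v) := rfl

/-- The bounded formula saying that variable `n` is a pair whose components, called `x` and `y`,
satisfy `φ`. -/
def unpairF (n x y : ℕ) (φ : BddFormula) : BddFormula :=
  .neg (.ball x (.add (.var n) .one) (.ball y (.add (.var n) .one)
    (.neg (.and (.eq (.var n) (pairT (.var x) (.var y))) φ))))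

/-- Components do not exceed the code of their pair, so the quantifiers over them can be bounded.
The variables must be distinct lest one assignment overwrite another. -/
theorem sat_unpairF (V : ℕ → Set M) (v : ℕ → M) {n x y : ℕ} (hx : n ≠ x) (hy : n ≠ y) (hxy : x ≠ y)
    (φ : BddFormula) : (unpairF n x y φ).sat V v ↔
      ∃ a b, v n = pair a b ∧ φ.sat V (Function.update (Function.update v x a) y b) := by
  simp only [unpairF, BddFormula.sat, NumTerm.eval, eval_pairT, Function.update_of_ne hx,
    Function.update_of_ne hy, Function.update_of_ne hxy, Function.update_self]
  push Not
  constructor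
  · rintro ⟨a, -, b, -, h⟩
    exact ⟨a, b, h⟩
  · rintro ⟨a, b, h⟩
    exact ⟨a, lt_succ.2 (h.1 ▸ le_pair_left _ _), b, lt_succ.2 (h.1 ▸ le_pair_right _ _), h⟩

/-- Assignment of at most two set parameters. -/
def setParams (A B : Set M) : ℕ → Set M := fun i => if i = 0 then A else B

@[simp] theorem setParams_zero (A B : Set M) : setParams A B 0 = A := rfl
@[simp] theorem setParams_one (A B : Set M) : setParams A B 1 = B := rfl

variable {S : Set (Set M)} (hS : IsRCA0 S) {A B : Set M}
include hS

/-- A bounded formula becomes Σ⁰₁ and Π⁰₁ at once by a dummy quantifier over variable `1`, so Δ⁰₁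
comprehension applies. This produces all the basic sets below, after which formulas are needed only
to state comprehension and induction for projections of sets. -/
theorem IsRCA0.setOf_mem (θ : BddFormula) (v : ℕ → M) (hA : A ∈ S) (hB : B ∈ S) (P : M → Prop)
    (h : ∀ n m, P n ↔ θ.sat (setParams A B) (Function.update (Function.update v 0 n) 1 m)) :
    {n | P n} ∈ S := by
  have hV : ∀ i, setParams A B i ∈ S := by
    intro i; unfold setParams; split_ifs <;> assumption
  exact hS.delta_comprehension P
    ⟨θ, v, _, hV, fun n => ⟨fun hn => ⟨0, (h n 0).1 hn⟩, fun ⟨m, hm⟩ => (h n m).2 hm⟩⟩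
    ⟨θ, v, _, hV, fun n => ⟨fun hn m => (h n m).1 hn, fun hm => (h n 0).2 (hm 0)⟩⟩

theorem IsRCA0.inter (hA : A ∈ S) (hB : B ∈ S) : A ∩ B ∈ S :=
  hS.setOf_mem (.and (.mem (.var 0) 0) (.mem (.var 0) 1)) (params 0 0) hA hB (· ∈ A ∩ B)
    fun n m => by simp [BddFormula.sat, NumTerm.eval]

theorem IsRCA0.compl (hA : A ∈ S) : Aᶜ ∈ S :=
  hS.setOf_mem (.neg (.mem (.var 0) 0)) (params 0 0) hA hA (· ∈ Aᶜ)
    fun n m => by simp [BddFormula.sat, NumTerm.eval]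

theorem IsRCA0.univ : (Set.univ : Set M) ∈ S := by
  obtain ⟨A, hA⟩ := hS.sets_nonempty
  exact hS.setOf_mem (.eq (.var 0) (.var 0)) (params 0 0) hA hA (fun _ => True)
    fun n m => by simp [BddFormula.sat]

theorem IsRCA0.singleton (c : M) : {n | n = c} ∈ S :=
  hS.setOf_mem (.eq (.var 0) (.var 2)) (params c 0) hS.univ hS.univ _
    fun n m => by simp [BddFormula.sat, NumTerm.eval]

theorem IsRCA0.prod (hA : A ∈ S) (hB : B ∈ S) : {w | ∃ x y, w = pair x y ∧ x ∈ A ∧ y ∈ B} ∈ S :=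
  hS.setOf_mem (unpairF 0 2 3 (.and (.mem (.var 2) 0) (.mem (.var 3) 1))) (params 0 0) hA hB _
    fun n m => by simp [sat_unpairF, BddFormula.sat, NumTerm.eval]

theorem IsRCA0.compGraph (hA : A ∈ S) (hB : B ∈ S) :
    {w | ∃ x z m, w = pair (pair x z) m ∧ pair x m ∈ A ∧ pair m z ∈ B} ∈ S :=
  hS.setOf_mem (unpairF 0 2 3 (unpairF 2 4 5 (.and (.mem (pairT (.var 4) (.var 3)) 0)
      (.mem (pairT (.var 3) (.var 5)) 1)))) (params 0 0) hA hB _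
    fun n m => by
      simp [sat_unpairF, BddFormula.sat, NumTerm.eval]
      exact ⟨fun ⟨_, _, _, h⟩ => ⟨_, _, _, h⟩, fun ⟨_, _, _, h⟩ => ⟨_, _, _, h⟩⟩

theorem IsRCA0.diag (hA : A ∈ S) : {w | ∃ x, w = pair x x ∧ x ∈ A} ∈ S :=
  hS.setOf_mem (unpairF 0 2 3 (.and (.eq (.var 2) (.var 3)) (.mem (.var 2) 0))) (params 0 0) hA hA _
    fun n m => by simp [sat_unpairF, BddFormula.sat, NumTerm.eval]

theorem IsRCA0.fstGraph (hA : A ∈ S) (hB : B ∈ S) :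
    {w | ∃ x y, w = pair (pair x y) x ∧ x ∈ A ∧ y ∈ B} ∈ S :=
  hS.setOf_mem (unpairF 0 2 3 (unpairF 2 4 5 (.and (.eq (.var 3) (.var 4))
      (.and (.mem (.var 4) 0) (.mem (.var 5) 1))))) (params 0 0) hA hB _
    fun n m => by
      simp [sat_unpairF, BddFormula.sat, NumTerm.eval]

theorem IsRCA0.sndGraph (hA : A ∈ S) (hB : B ∈ S) :
    {w | ∃ x y, w = pair (pair x y) y ∧ x ∈ A ∧ y ∈ B} ∈ S :=
  hS.setOf_mem (unpairF 0 2 3 (unpairF 2 4 5 (.and (.eq (.var 3) (.var 5))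
      (.and (.mem (.var 4) 0) (.mem (.var 5) 1))))) (params 0 0) hA hB _
    fun n m => by
      simp [sat_unpairF, BddFormula.sat, NumTerm.eval]
      exact exists_comm

theorem IsRCA0.prodMkGraph (hA : A ∈ S) (hB : B ∈ S) :
    {w | ∃ x y z, w = pair x (pair y z) ∧ pair x y ∈ A ∧ pair x z ∈ B} ∈ S :=
  hS.setOf_mem (unpairF 0 2 3 (unpairF 3 4 5 (.and (.mem (pairT (.var 2) (.var 4)) 0)
      (.mem (pairT (.var 2) (.var 5)) 1)))) (params 0 0) hA hB _
    fun n m => by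
      simp [sat_unpairF, BddFormula.sat, NumTerm.eval]

theorem IsRCA0.addGraph : {w : M | ∃ x y, w = pair (pair x y) (x + y)} ∈ S :=
  hS.setOf_mem (unpairF 0 2 3 (unpairF 2 4 5 (.eq (.var 3) (.add (.var 4) (.var 5))))) (params 0 0)
    hS.univ hS.univ _
    fun n m => by
      simp [sat_unpairF, BddFormula.sat, NumTerm.eval]

theorem IsRCA0.mulGraph : {w : M | ∃ x y, w = pair (pair x y) (x * y)} ∈ S :=
  hS.setOf_mem (unpairF 0 2 3 (unpairF 2 4 5 (.eq (.var 3) (.mul (.var 4) (.var 5))))) (params 0 0)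
    hS.univ hS.univ _
    fun n m => by
      simp [sat_unpairF, BddFormula.sat, NumTerm.eval]

theorem IsRCA0.ltSet : {w : M | ∃ x y, w = pair x y ∧ x < y} ∈ S :=
  hS.setOf_mem (unpairF 0 2 3 (.lt (.var 2) (.var 3))) (params 0 0) hS.univ hS.univ _
    fun n m => by simp [sat_unpairF, BddFormula.sat, NumTerm.eval]

theorem IsRCA0.ballSet (hA : A ∈ S) (hB : B ∈ S) :
    {w | ∃ x k, w = pair x k ∧ x ∈ B ∧ ∀ i, i < k → pair x i ∈ A} ∈ S :=
  hS.setOf_mem (unpairF 0 2 3 (.and (.mem (.var 2) 1)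
      (.ball 4 (.var 3) (.mem (pairT (.var 2) (.var 4)) 0)))) (params 0 0) hA hB _
    fun n m => by simp [sat_unpairF, BddFormula.sat, NumTerm.eval]

/-- The set used to contract two existential quantifiers into one. -/
theorem IsRCA0.contractSet (hA : A ∈ S) (hB : B ∈ S) :
    {w | ∃ x m m', w = pair x (pair m m') ∧ m ∈ B ∧ pair (pair x m) m' ∈ A} ∈ S :=
  hS.setOf_mem (unpairF 0 2 3 (unpairF 3 4 5 (.and (.mem (.var 4) 1)
      (.mem (pairT (pairT (.var 2) (.var 4)) (.var 5)) 0)))) (params 0 0) hA hB _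
    fun n m => by
      simp [sat_unpairF, BddFormula.sat, NumTerm.eval]

theorem IsRCA0.delta (hA : A ∈ S) (hB : B ∈ S) (P : M → Prop) (h : ∀ n, P n ↔ ∃ m, pair n m ∈ A)
    (h' : ∀ n, P n ↔ ∀ m, pair n m ∈ B) : {n | P n} ∈ S :=
  hS.delta_comprehension P
    ⟨.mem (pairT (.var 0) (.var 1)) 0, params 0 0, fun _ => A, fun _ => hA, fun n => by
      simp [h, BddFormula.sat, NumTerm.eval]⟩
    ⟨.mem (pairT (.var 0) (.var 1)) 0, params 0 0, fun _ => B, fun _ => hB, fun n => by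
      simp [h', BddFormula.sat, NumTerm.eval]⟩

theorem IsRCA0.induction (hA : A ∈ S) (P : M → Prop) (h : ∀ n, P n ↔ ∃ m, pair n m ∈ A)
    (h0 : P 0) (hs : ∀ n, P n → P (n + 1)) (n : M) : P n :=
  hS.sigma_induction P
    ⟨.mem (pairT (.var 0) (.var 1)) 0, params 0 0, fun _ => A, fun _ => hA, fun n => by
      simp [h, BddFormula.sat, NumTerm.eval]⟩ h0 hs n

end Formulas

/-- A model of `RCA₀`, as a class. -/
class Model {M : Type u} [CommSemiring M] [LinearOrder M] (S : Set (Set M)) : Prop where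
  rca : IsRCA0 S

/-- Types whose elements are coded by numbers, with a range that belongs to every model. -/
class Code (M : Type u) [CommSemiring M] [LinearOrder M] (α : Type u) where
  code : α → M
  inj : Function.Injective code
  ran : ∀ S : Set (Set M), IsRCA0 S → {z | ∃ x, z = code x} ∈ S

/-! ### Closure properties of decidable, Σ⁰₁ and computable -/

section

variable {M : Type u} [CommSemiring M] [LinearOrder M] [NatLike M]

instance Code.self : Code M M where
  code := id
  inj := Function.injective_id
  ran S hS := by simpa using hS.univ

instance Code.prod {α β : Type u} [Code M α] [Code M β] : Code M (α × β) where
  code p := pair (Code.code p.1) (Code.code p.2)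
  inj := by
    rintro ⟨a, b⟩ ⟨c, d⟩ h
    obtain ⟨h1, h2⟩ := pair_inj.1 h
    exact Prod.ext (Code.inj h1) (Code.inj h2)
  ran S hS := by
    convert hS.prod (Code.ran (α := α) S hS) (Code.ran (α := β) S hS) using 1
    ext w
    constructor
    · rintro ⟨⟨a, b⟩, rfl⟩
      exact ⟨_, _, rfl, ⟨a, rfl⟩, ⟨b, rfl⟩⟩
    · rintro ⟨_, _, rfl, ⟨a, rfl⟩, ⟨b, rfl⟩⟩
      exact ⟨⟨a, b⟩, rfl⟩

theorem code_inj {α : Type u} [Code M α] {a b : α} : (Code.code a : M) = Code.code b ↔ a = b :=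
  Code.inj.eq_iff

variable (S : Set (Set M)) {α β γ δ : Type u} [Code M α] [Code M β] [Code M γ] [Code M δ]

/-- `P` belongs to the model (as a set of codes). -/
def Dec (P : α → Prop) : Prop := {z : M | ∃ x : α, z = Code.code x ∧ P x} ∈ S

/-- `P` is `Σ⁰₁` in the model. -/
def Sig (P : α → Prop) : Prop := ∃ A ∈ S, ∀ x, P x ↔ ∃ m, pair (Code.code x) m ∈ A

/-- The graph of `f` belongs to the model. -/
def Comp (f : α → β) : Prop := Dec S fun q : α × β => f q.1 = q.2

variable {S} {P Q : α → Prop}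

theorem mem_codes {P : α → Prop} {x : α} :
    (Code.code x : M) ∈ {z : M | ∃ x : α, z = Code.code x ∧ P x} ↔ P x := by
  simp [code_inj]

theorem Dec.congr (h : Dec S P) (h' : ∀ x, Q x ↔ P x) : Dec S Q := by
  rwa [show Q = P from funext fun x => propext (h' x)]

theorem Sig.congr (h : Sig S P) (h' : ∀ x, Q x ↔ P x) : Sig S Q := by
  rwa [show Q = P from funext fun x => propext (h' x)]

variable [hM : Model S]

theorem Dec.of_mem {A : Set M} (hA : A ∈ S) (h : ∀ x, P x ↔ Code.code x ∈ A) : Dec S P := by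
  have := hM.rca.inter (Code.ran (α := α) S hM.rca) hA
  unfold Dec
  convert this using 1
  ext z
  constructor
  · rintro ⟨x, rfl, hx⟩; exact ⟨⟨x, rfl⟩, (h x).1 hx⟩
  · rintro ⟨⟨x, rfl⟩, hx⟩; exact ⟨x, rfl, (h x).2 hx⟩

theorem Dec.and (hP : Dec S P) (hQ : Dec S Q) : Dec S fun x => P x ∧ Q x :=
  .of_mem (hM.rca.inter hP hQ) fun _ => (and_congr mem_codes mem_codes).symm

theorem Dec.not (hP : Dec S P) : Dec S fun x => ¬ P x :=
  .of_mem (hM.rca.compl hP) fun _ => (not_congr mem_codes).symm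

theorem Dec.or (hP : Dec S P) (hQ : Dec S Q) : Dec S fun x => P x ∨ Q x :=
  (hP.not.and hQ.not).not.congr fun x => by tauto

theorem Dec.imp (hP : Dec S P) (hQ : Dec S Q) : Dec S fun x => P x → Q x :=
  (hP.not.or hQ).congr fun x => by tauto

theorem Dec.const (p : Prop) : Dec S fun _ : α => p := by
  by_cases h : p
  · exact .of_mem hM.rca.univ fun _ => by simp [h]
  · exact .of_mem (hM.rca.compl hM.rca.univ) fun _ => by simp [h]

theorem Dec.sig (hP : Dec S P) : Sig S P :=
  ⟨_, hM.rca.prod hP hM.rca.univ, fun x => by simp [pair_inj, code_inj]⟩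

/-- This is Δ⁰₁ comprehension for coded types: the negation being Σ⁰₁ supplies the Π⁰₁ description.
-/
theorem Dec.of_sig (hP : Sig S P) (hQ : Sig S fun x => ¬ P x) : Dec S P := by
  obtain ⟨A, hA, hP⟩ := hP
  obtain ⟨B, hB, hQ⟩ := hQ
  -- Numbers that code no element of `α` have to be excluded from both descriptions. This uses that
  -- the range of the coding is in the model.
  have hR := hM.rca.prod (Code.ran (α := α) S hM.rca) hM.rca.univ
  refine hM.rca.delta (hM.rca.inter hR hA) (hM.rca.inter hR (hM.rca.compl hB)) _ ?_ ?_
  · intro n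
    constructor
    · rintro ⟨x, rfl, hx⟩
      obtain ⟨m, hm⟩ := (hP x).1 hx
      exact ⟨m, ⟨_, _, rfl, ⟨x, rfl⟩, trivial⟩, hm⟩
    · rintro ⟨m, ⟨_, _, h, ⟨x, rfl⟩, -⟩, hm⟩
      obtain ⟨rfl, rfl⟩ := pair_inj.1 h
      exact ⟨x, rfl, (hP x).2 ⟨_, hm⟩⟩
  · intro n
    constructor
    · rintro ⟨x, rfl, hx⟩ m
      exact ⟨⟨_, _, rfl, ⟨x, rfl⟩, trivial⟩, fun h => (hQ x).2 ⟨m, h⟩ hx⟩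
    · intro h
      obtain ⟨⟨_, _, h', ⟨x, rfl⟩, -⟩, -⟩ := h 0
      obtain ⟨rfl, rfl⟩ := pair_inj.1 h'
      refine ⟨x, rfl, ?_⟩
      by_contra hx
      obtain ⟨m, hm⟩ := (hQ x).1 hx
      exact (h m).2 hm

/-- P (f x) is equivalent to ∃ y, f x = y ∧ P y, hence Σ⁰₁. The same argument for ¬P yields
decidability. -/
theorem Dec.comp_of {P : β → Prop} {f : α → β} (hP : Dec S P) (hf : Comp S f) :
    Dec S fun x => P (f x) := by
  have key : ∀ {P : β → Prop}, Dec S P → Sig S fun x => P (f x) := by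
    intro P hP
    refine ⟨_, hM.rca.inter hf (hM.rca.prod hM.rca.univ hP), fun x => ?_⟩
    constructor
    · intro h
      exact ⟨Code.code (f x), ⟨(x, f x), rfl, rfl⟩, ⟨_, _, rfl, trivial, _, rfl, h⟩⟩
    · rintro ⟨m, ⟨⟨x', y⟩, h, h'⟩, ⟨_, _, h2, -, ⟨z, rfl, h3⟩⟩⟩
      obtain ⟨h4, rfl⟩ := pair_inj.1 h2
      obtain ⟨h5, h6⟩ := pair_inj.1 h
      rw [code_inj] at h5 h6
      subst h5 h6
      simp only at h'
      rwa [h']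
  exact .of_sig (key hP) (key hP.not)

theorem Comp.of_set {f : α → β} {A : Set M} (hA : A ∈ S)
    (h : ∀ x y, f x = y ↔ pair (Code.code x) (Code.code y) ∈ A) : Comp S f :=
  .of_mem hA fun q => h q.1 q.2

theorem Comp.id : Comp S fun x : α => x :=
  .of_set (hM.rca.diag hM.rca.univ) fun x y => by
    constructor
    · rintro rfl; exact ⟨_, rfl, trivial⟩
    · rintro ⟨_, h, -⟩
      obtain ⟨h1, h2⟩ := pair_inj.1 h
      exact code_inj.1 (h1.trans h2.symm)

theorem Comp.const (c : β) : Comp S fun _ : α => c :=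
  .of_set (hM.rca.prod hM.rca.univ (hM.rca.singleton (Code.code c))) fun x y => by
    constructor
    · rintro rfl; exact ⟨_, _, rfl, trivial, rfl⟩
    · rintro ⟨_, _, h, -, rfl⟩
      exact (code_inj.1 (pair_inj.1 h).2).symm

theorem Comp.fst' : Comp S fun x : α × β => x.1 :=
  .of_set (hM.rca.fstGraph hM.rca.univ hM.rca.univ) fun x y => by
    constructor
    · rintro rfl; exact ⟨_, _, rfl, trivial, trivial⟩
    · rintro ⟨_, _, h, -, -⟩
      obtain ⟨h1, rfl⟩ := pair_inj.1 h
      exact (code_inj.1 (pair_inj.1 h1).1)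

theorem Comp.snd' : Comp S fun x : α × β => x.2 :=
  .of_set (hM.rca.sndGraph hM.rca.univ hM.rca.univ) fun x y => by
    constructor
    · rintro rfl; exact ⟨_, _, rfl, trivial, trivial⟩
    · rintro ⟨_, _, h, -, -⟩
      obtain ⟨h1, rfl⟩ := pair_inj.1 h
      exact (code_inj.1 (pair_inj.1 h1).2)

theorem Comp.prodMk {f : α → β} {g : α → γ} (hf : Comp S f) (hg : Comp S g) :
    Comp S fun x => (f x, g x) :=
  .of_set (hM.rca.prodMkGraph hf hg) fun x y => by
    constructor
    · rintro rfl; exact ⟨_, _, _, rfl, ⟨(x, f x), rfl, rfl⟩, ⟨(x, g x), rfl, rfl⟩⟩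
    · rintro ⟨_, _, _, h, ⟨⟨x', y'⟩, h1, h2⟩, ⟨⟨x'', y''⟩, h3, h4⟩⟩
      obtain ⟨rfl, h'⟩ := pair_inj.1 h
      obtain ⟨rfl, rfl⟩ := pair_inj.1 h'
      obtain ⟨h5, h6⟩ := pair_inj.1 h1
      obtain ⟨h7, h8⟩ := pair_inj.1 h3
      rw [code_inj] at h5 h6 h7 h8
      subst h5 h7
      exact Prod.ext (h2.trans h6.symm) (h4.trans h8.symm)

theorem Comp.comp_of {g : β → γ} {f : α → β} (hg : Comp S g) (hf : Comp S f) :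
    Comp S fun x => g (f x) := by
  have key : ∀ {R : β × γ → Prop}, Dec S R → Sig S fun q : α × γ => R (f q.1, q.2) := by
    intro R hR
    refine ⟨_, hM.rca.compGraph hf hR, fun ⟨x, y⟩ => ?_⟩
    constructor
    · intro h
      exact ⟨_, _, _, _, rfl, ⟨(x, f x), rfl, rfl⟩, ⟨(f x, y), rfl, h⟩⟩
    · rintro ⟨m, _, _, _, h, ⟨⟨x', y'⟩, h1, h2⟩, ⟨⟨x'', y''⟩, h3, h4⟩⟩
      obtain ⟨h', rfl⟩ := pair_inj.1 h
      obtain ⟨rfl, rfl⟩ := pair_inj.1 h'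
      obtain ⟨h5, rfl⟩ := pair_inj.1 h1
      obtain ⟨h7, h8⟩ := pair_inj.1 h3
      rw [code_inj] at h5 h7 h8
      dsimp only at *
      subst h5 h7 h8 h2
      exact h4
  exact .of_sig (key hg) (key hg.not)

theorem Comp.fst {f : α → β × γ} (hf : Comp S f) : Comp S fun x => (f x).1 := Comp.fst'.comp_of hf

theorem Comp.snd {f : α → β × γ} (hf : Comp S f) : Comp S fun x => (f x).2 := Comp.snd'.comp_of hf

theorem Dec.eq {f g : α → β} (hf : Comp S f) (hg : Comp S g) : Dec S fun x => f x = g x := by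
  have h : Dec S fun q : β × β => q.1 = q.2 := Comp.id
  exact h.comp_of (hf.prodMk hg)

theorem Comp.add {f g : α → M} (hf : Comp S f) (hg : Comp S g) : Comp S fun x => f x + g x := by
  have h : Comp S fun q : M × M => q.1 + q.2 := .of_set hM.rca.addGraph fun x y => by
    constructor
    · rintro rfl; exact ⟨_, _, rfl⟩
    · rintro ⟨_, _, h⟩
      obtain ⟨h1, rfl⟩ := pair_inj.1 h
      obtain ⟨rfl, rfl⟩ := pair_inj.1 h1
      rfl
  exact h.comp_of (hf.prodMk hg)

theorem Comp.mul {f g : α → M} (hf : Comp S f) (hg : Comp S g) : Comp S fun x => f x * g x := by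
  have h : Comp S fun q : M × M => q.1 * q.2 := .of_set hM.rca.mulGraph fun x y => by
    constructor
    · rintro rfl; exact ⟨_, _, rfl⟩
    · rintro ⟨_, _, h⟩
      obtain ⟨h1, rfl⟩ := pair_inj.1 h
      obtain ⟨rfl, rfl⟩ := pair_inj.1 h1
      rfl
  exact h.comp_of (hf.prodMk hg)

theorem Comp.pair {f g : α → M} (hf : Comp S f) (hg : Comp S g) : Comp S fun x => pair (f x) (g x) :=
  ((hf.add hg).mul (hf.add hg)).add hf

theorem Dec.lt {f g : α → M} (hf : Comp S f) (hg : Comp S g) : Dec S fun x => f x < g x := by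
  have h : Dec S fun q : M × M => q.1 < q.2 := .of_mem hM.rca.ltSet fun q => by
    constructor
    · intro h; exact ⟨_, _, rfl, h⟩
    · rintro ⟨_, _, h, h'⟩
      obtain ⟨rfl, rfl⟩ := pair_inj.1 h
      exact h'
  exact h.comp_of (hf.prodMk hg)

theorem Dec.le {f g : α → M} (hf : Comp S f) (hg : Comp S g) : Dec S fun x => f x ≤ g x :=
  (Dec.lt hg hf).not.congr fun _ => not_lt.symm

theorem Dec.mem {A : Set M} (hA : A ∈ S) {f : α → M} (hf : Comp S f) : Dec S fun x => f x ∈ A := by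
  have h : Dec S fun x : M => x ∈ A := .of_mem hA fun q => Iff.rfl
  exact h.comp_of hf

theorem Dec.rel₂ {R : β → γ → Prop} (hR : Dec S fun q : β × γ => R q.1 q.2) {f : α → β} {g : α → γ}
    (hf : Comp S f) (hg : Comp S g) : Dec S fun x => R (f x) (g x) :=
  hR.comp_of (hf.prodMk hg)

theorem Dec.rel₃ {R : β → γ → δ → Prop} (hR : Dec S fun q : β × γ × δ => R q.1 q.2.1 q.2.2)
    {f : α → β} {g : α → γ} {h : α → δ} (hf : Comp S f) (hg : Comp S g) (hh : Comp S h) :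
    Dec S fun x => R (f x) (g x) (h x) :=
  hR.comp_of (hf.prodMk (hg.prodMk hh))

theorem Dec.rel₄ {R : β → γ → δ → M → Prop}
    (hR : Dec S fun q : β × γ × δ × M => R q.1 q.2.1 q.2.2.1 q.2.2.2)
    {f : α → β} {g : α → γ} {h : α → δ} {k : α → M} (hf : Comp S f) (hg : Comp S g) (hh : Comp S h)
    (hk : Comp S k) : Dec S fun x => R (f x) (g x) (h x) (k x) :=
  hR.comp_of (hf.prodMk (hg.prodMk (hh.prodMk hk)))

theorem Comp.fun₂ {F : β → γ → δ} (hF : Comp S fun q : β × γ => F q.1 q.2) {f : α → β} {g : α → γ}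
    (hf : Comp S f) (hg : Comp S g) : Comp S fun x => F (f x) (g x) :=
  hF.comp_of (hf.prodMk hg)

theorem Dec.ball {P : α → M → Prop} {f : α → M} (hf : Comp S f)
    (hP : Dec S fun q : α × M => P q.1 q.2) : Dec S fun x => ∀ i, i < f x → P x i := by
  have h : Dec S fun q : α × M => ∀ i, i < q.2 → P q.1 i :=
    .of_mem (hM.rca.ballSet hP hM.rca.univ) fun q => by
      constructor
      · intro h; exact ⟨_, _, rfl, trivial, fun i hi => ⟨(q.1, i), rfl, h i hi⟩⟩
      · rintro ⟨_, _, h, -, h'⟩ i hi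
        obtain ⟨rfl, rfl⟩ := pair_inj.1 h
        obtain ⟨⟨x, j⟩, h1, h2⟩ := h' i hi
        obtain ⟨h3, h4⟩ := pair_inj.1 h1
        have h3 := code_inj.1 h3
        have h4 : i = j := h4
        subst h3 h4
        exact h2
  exact h.comp_of (Comp.id.prodMk hf)

theorem Dec.bex {P : α → M → Prop} {f : α → M} (hf : Comp S f)
    (hP : Dec S fun q : α × M => P q.1 q.2) : Dec S fun x => ∃ i, i < f x ∧ P x i :=
  (Dec.ball (P := fun x i => ¬ P x i) hf hP.not).not.congr fun x => by push Not; rfl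

theorem Sig.exists {P : α → β → Prop} (hP : Sig S fun q : α × β => P q.1 q.2) :
    Sig S fun x => ∃ y, P x y := by
  obtain ⟨A, hA, h⟩ := hP
  refine ⟨_, hM.rca.contractSet hA (Code.ran (α := β) S hM.rca), fun x => ?_⟩
  constructor
  · rintro ⟨y, hy⟩
    obtain ⟨m, hm⟩ := (h (x, y)).1 hy
    exact ⟨_, _, _, _, rfl, ⟨y, rfl⟩, hm⟩
  · rintro ⟨_, _, _, _, h1, ⟨y, rfl⟩, hm⟩
    obtain ⟨rfl, rfl⟩ := pair_inj.1 h1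
    exact ⟨y, (h (x, y)).2 ⟨_, hm⟩⟩

theorem Sig.dec_exists (hP : Sig S P) : ∃ R : α → M → Prop,
    (Dec S fun q : α × M => R q.1 q.2) ∧ ∀ x, P x ↔ ∃ m, R x m := by
  obtain ⟨A, hA, h⟩ := hP
  exact ⟨fun x m => SOA.pair (Code.code x) m ∈ A, .of_mem hA fun q => Iff.rfl, h⟩

theorem Sig.comp_of {P : β → Prop} {f : α → β} (hP : Sig S P) (hf : Comp S f) :
    Sig S fun x => P (f x) := by
  obtain ⟨R, hR, h⟩ := hP.dec_exists
  refine (Sig.exists (P := fun x m => R (f x) m) ?_).congr fun x => h _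
  exact (Dec.rel₂ hR (hf.comp_of .fst') .snd').sig

theorem Sig.and (hP : Sig S P) (hQ : Sig S Q) : Sig S fun x => P x ∧ Q x := by
  obtain ⟨R, hR, h⟩ := hP.dec_exists
  obtain ⟨R', hR', h'⟩ := hQ.dec_exists
  refine (Sig.exists (P := fun x (p : M × M) => R x p.1 ∧ R' x p.2) ?_).congr fun x => ?_
  · exact ((Dec.rel₂ hR .fst' (.fst .snd')).and (Dec.rel₂ hR' .fst' (.snd .snd'))).sig
  · rw [h, h']
    exact ⟨fun ⟨⟨a, ha⟩, b, hb⟩ => ⟨(a, b), ha, hb⟩, fun ⟨p, ha, hb⟩ => ⟨⟨_, ha⟩, _, hb⟩⟩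

theorem Sig.or (hP : Sig S P) (hQ : Sig S Q) : Sig S fun x => P x ∨ Q x := by
  obtain ⟨R, hR, h⟩ := hP.dec_exists
  obtain ⟨R', hR', h'⟩ := hQ.dec_exists
  refine (Sig.exists (P := fun x m => R x m ∨ R' x m) (hR.or hR').sig).congr fun x => ?_
  rw [h, h', exists_or]

/-- For a total function, f x ≠ y means that f x = y' for some y' ≠ y. Hence a Σ⁰₁ graph is already
Δ⁰₁. -/
theorem Comp.of_sig {f : α → β} (h : Sig S fun q : α × β => f q.1 = q.2) : Comp S f := by
  refine Dec.of_sig h ?_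
  refine (Sig.exists (P := fun (q : α × β) (y : β) => f q.1 = y ∧ ¬ y = q.2) ?_).congr fun q => ?_
  · have h1 : Sig S fun q : (α × β) × β => f q.1.1 = q.2 :=
      h.comp_of (f := fun q : (α × β) × β => (q.1.1, q.2)) ((Comp.fst .fst').prodMk .snd')
    exact h1.and (Dec.eq .snd' (.snd .fst')).not.sig
  · exact ⟨fun h => ⟨_, rfl, h⟩, fun ⟨_, h, h'⟩ => h ▸ h'⟩

/-! ### Induction -/

theorem sig_induction (S : Set (Set M)) [hM : Model S] {P : M → Prop} (hP : Sig S P) (h0 : P 0)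
    (hs : ∀ n, P n → P (n + 1)) (n : M) : P n := by
  obtain ⟨A, hA, h⟩ := hP
  exact hM.rca.induction hA P h h0 hs n

/-- Collection for formulas `∃ m, R i m` with `R` in the model. -/
theorem collection {R : M → M → Prop} (hR : Dec S fun q : M × M => R q.1 q.2) (k : M)
    (h : ∀ i, i < k → ∃ m, R i m) : ∃ b, ∀ i, i < k → ∃ m, m < b ∧ R i m := by
  have key : ∀ j, ∃ b, j ≤ k → ∀ i, i < j → ∃ m, m < b ∧ R i m := by
    refine sig_induction S (Sig.exists (Dec.sig ?_)) ?_ ?_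
    · exact (Dec.le .fst' (.const _)).imp (.ball .fst' (.bex (.snd .fst')
        (hR.rel₂ (.snd .fst') .snd')))
    · exact ⟨0, fun _ i hi => absurd hi (not_lt.2 zero_le)⟩
    · rintro j ⟨b, hb⟩
      by_cases hj : j + 1 ≤ k
      · obtain ⟨m, hm⟩ := h j (succ_le.1 hj)
        refine ⟨b + (m + 1), fun _ i hi => ?_⟩
        rcases (lt_succ.1 hi).lt_or_eq with hi | rfl
        · obtain ⟨m', hm', hR'⟩ := hb (le_self_add.trans hj) i hi
          exact ⟨m', hm'.trans_le le_self_add, hR'⟩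
        · exact ⟨m, (lt_add_one m).trans_le le_add_self, hm⟩
      · exact ⟨0, fun h => absurd h hj⟩
  obtain ⟨b, hb⟩ := key k
  exact ⟨b, hb le_rfl⟩

/-- Collection bounds the witnesses for all i < f x simultaneously, and the unbounded quantifier
moves to the front as the choice of that bound. -/
theorem Sig.ball {P : α → M → Prop} {f : α → M} (hf : Comp S f)
    (hP : Sig S fun q : α × M => P q.1 q.2) : Sig S fun x => ∀ i, i < f x → P x i := by
  obtain ⟨R, hR, h⟩ := hP.dec_exists
  refine (Sig.exists (P := fun x b => ∀ i, i < f x → ∃ m, m < b ∧ R (x, i) m) (Dec.sig ?_)).congr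
    fun x => ?_
  · exact .ball (hf.comp_of .fst') (.bex (.snd .fst')
      (hR.rel₂ (.prodMk (.fst (.fst .fst')) (.snd .fst')) .snd'))
  · constructor
    · intro hx
      exact collection (hR.rel₂ (.prodMk (.const x) .fst') .snd') (f x)
        fun i hi => (h (x, i)).1 (hx i hi)
    · rintro ⟨b, hb⟩ i hi
      obtain ⟨m, -, hm⟩ := hb i hi
      exact (h (x, i)).2 ⟨m, hm⟩

/-- Course of values induction for complements of `Σ⁰₁` predicates. -/
theorem pi_induction (S : Set (Set M)) [hM : Model S] {P : M → Prop} (hP : Sig S fun n => ¬ P n)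
    (hs : ∀ n, (∀ m, m < n → P m) → P n) (n : M) : P n := by
  by_contra hn
  -- A counterexample can always be replaced by a smaller one. Counting the replacements by j gives
  -- a Σ⁰₁ statement, which fails for j = n + 1.
  have key : ∀ j, ∃ m, m + j ≤ n ∧ ¬ P m := by
    refine sig_induction S ?_ ⟨n, by simp, hn⟩ ?_
    · refine Sig.exists (P := fun j m => m + j ≤ n ∧ ¬ P m) (Sig.and (Dec.sig ?_) ?_)
      · exact Dec.le (.add .snd' .fst') (.const _)
      · exact hP.comp_of .snd'
    · rintro j ⟨m, hm, hPm⟩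
      by_contra h
      refine hPm (hs m fun l hl => ?_)
      by_contra hl'
      refine h ⟨l, ?_, hl'⟩
      calc l + (j + 1) = (l + 1) + j := by ring
        _ ≤ m + j := by gcongr; exact succ_le.2 hl
        _ ≤ n := hm
  obtain ⟨m, hm, -⟩ := key (n + 1)
  exact absurd (le_add_self.trans hm) (not_le.2 (lt_add_one n))

theorem dec_induction (S : Set (Set M)) [hM : Model S] {P : M → Prop} (hP : Dec S P) (h0 : P 0)
    (hs : ∀ n, P n → P (n + 1)) (n : M) : P n :=
  sig_induction S hP.sig h0 hs n

theorem dec_strong_induction (S : Set (Set M)) [hM : Model S] {P : M → Prop} (hP : Dec S P)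
    (hs : ∀ n, (∀ m, m < n → P m) → P n) (n : M) : P n :=
  pi_induction S hP.not.sig hs n

theorem exists_least (S : Set (Set M)) [hM : Model S] {P : M → Prop} (hP : Sig S P)
    (h : ∃ n, P n) : ∃ n, P n ∧ ∀ m, m < n → ¬ P m := by
  by_contra h'
  obtain ⟨n, hn⟩ := h
  refine pi_induction S (P := fun n => ¬ P n) (hP.congr fun _ => not_not) (fun n ih => ?_) n hn
  by_contra hPn
  exact h' ⟨n, hPn, ih⟩

end

/-! ### Instance search for the closure properties -/

section

variable {M : Type u} [CommSemiring M] [LinearOrder M] [NatLike M]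

variable (S : Set (Set M)) {α β γ δ : Type u} [Code M α] [Code M β] [Code M γ] [Code M δ]

/-- `Dec`, to be found by instance search. -/
class IDec (P : α → Prop) : Prop where
  out : Dec S P

/-- `Sig`, to be found by instance search. -/
class ISig (P : α → Prop) : Prop where
  out : Sig S P

/-- `Comp`, to be found by instance search. -/
class IComp (f : α → β) : Prop where
  out : Comp S f

variable {S} [hM : Model S] {P Q : α → Prop}

theorem dec [h : IDec S P] : Dec S P := h.out
theorem sig [h : ISig S P] : Sig S P := h.out
theorem comp {f : α → β} [h : IComp S f] : Comp S f := h.out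

instance IDec.and [hP : IDec S P] [hQ : IDec S Q] : IDec S fun x => P x ∧ Q x := ⟨hP.out.and hQ.out⟩
instance IDec.or [hP : IDec S P] [hQ : IDec S Q] : IDec S fun x => P x ∨ Q x := ⟨hP.out.or hQ.out⟩
instance IDec.imp [hP : IDec S P] [hQ : IDec S Q] : IDec S fun x => P x → Q x := ⟨hP.out.imp hQ.out⟩
instance (priority := high) IDec.const (p : Prop) : IDec S fun _ : α => p := ⟨.const p⟩
instance (priority := high) IComp.id : IComp S fun x : α => x := ⟨.id⟩
instance (priority := high) IComp.const (c : β) : IComp S fun _ : α => c := ⟨.const c⟩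
instance IComp.fst {f : α → β × γ} [hf : IComp S f] : IComp S fun x => (f x).1 := ⟨hf.out.fst⟩
instance IComp.snd {f : α → β × γ} [hf : IComp S f] : IComp S fun x => (f x).2 := ⟨hf.out.snd⟩
instance IDec.eq {f g : α → β} [hf : IComp S f] [hg : IComp S g] : IDec S fun x => f x = g x :=
  ⟨.eq hf.out hg.out⟩
instance IDec.ne {f g : α → β} [hf : IComp S f] [hg : IComp S g] : IDec S fun x => f x ≠ g x :=
  ⟨(Dec.eq hf.out hg.out).not⟩
instance IComp.add {f g : α → M} [hf : IComp S f] [hg : IComp S g] : IComp S fun x => f x + g x :=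
  ⟨hf.out.add hg.out⟩
instance IComp.mul {f g : α → M} [hf : IComp S f] [hg : IComp S g] : IComp S fun x => f x * g x :=
  ⟨hf.out.mul hg.out⟩
instance IComp.pair {f g : α → M} [hf : IComp S f] [hg : IComp S g] :
    IComp S fun x => pair (f x) (g x) := ⟨hf.out.pair hg.out⟩
instance IDec.lt {f g : α → M} [hf : IComp S f] [hg : IComp S g] : IDec S fun x => f x < g x :=
  ⟨.lt hf.out hg.out⟩
instance IDec.le {f g : α → M} [hf : IComp S f] [hg : IComp S g] : IDec S fun x => f x ≤ g x :=
  ⟨.le hf.out hg.out⟩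
instance IDec.ball {P : α → M → Prop} {f : α → M} [hf : IComp S f]
    [hP : IDec S fun q : α × M => P q.1 q.2] : IDec S fun x => ∀ i, i < f x → P x i :=
  ⟨.ball hf.out hP.out⟩
instance IDec.bex {P : α → M → Prop} {f : α → M} [hf : IComp S f]
    [hP : IDec S fun q : α × M => P q.1 q.2] : IDec S fun x => ∃ i, i < f x ∧ P x i :=
  ⟨.bex hf.out hP.out⟩
instance IDec.ball_le {P : α → M → Prop} {f : α → M} [hf : IComp S f]
    [hP : IDec S fun q : α × M => P q.1 q.2] : IDec S fun x => ∀ i, i ≤ f x → P x i :=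
  ⟨(Dec.ball (hf.out.add (.const 1)) hP.out).congr fun x => by simp only [lt_succ]⟩
instance IDec.bex_le {P : α → M → Prop} {f : α → M} [hf : IComp S f]
    [hP : IDec S fun q : α × M => P q.1 q.2] : IDec S fun x => ∃ i, i ≤ f x ∧ P x i :=
  ⟨(Dec.bex (hf.out.add (.const 1)) hP.out).congr fun x => by simp only [lt_succ]⟩

instance (priority := high) ISig.of_dec [h : IDec S P] : ISig S P := ⟨h.out.sig⟩
instance ISig.and [hP : ISig S P] [hQ : ISig S Q] : ISig S fun x => P x ∧ Q x := ⟨hP.out.and hQ.out⟩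
instance ISig.or [hP : ISig S P] [hQ : ISig S Q] : ISig S fun x => P x ∨ Q x := ⟨hP.out.or hQ.out⟩
instance ISig.imp [hP : IDec S P] [hQ : ISig S Q] : ISig S fun x => P x → Q x :=
  ⟨(hP.out.not.sig.or hQ.out).congr fun x => by tauto⟩
instance ISig.exists {P : α → β → Prop} [hP : ISig S fun q : α × β => P q.1 q.2] :
    ISig S fun x => ∃ y, P x y := ⟨Sig.exists hP.out⟩
instance ISig.ball {P : α → M → Prop} {f : α → M} [hf : IComp S f]
    [hP : ISig S fun q : α × M => P q.1 q.2] : ISig S fun x => ∀ i, i < f x → P x i :=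
  ⟨.ball hf.out hP.out⟩

/-- This and the next two statements are quantified over all substitutions, so that a local
hypothesis about a given set, relation or function is turned into a local instance. -/
theorem IDec.mem {A : Set M} (hA : A ∈ S) : ∀ ⦃α : Type u⦄ [Code M α] ⦃f : α → M⦄ [IComp S f],
    IDec S fun x => f x ∈ A := fun _ _ _ hf => ⟨.mem hA hf.out⟩
theorem ISig.rel₂ {R : M → M → Prop} (hR : Sig S fun q : M × M => R q.1 q.2) :
    ∀ ⦃α : Type u⦄ [Code M α] ⦃f g : α → M⦄ [IComp S f] [IComp S g],
      ISig S fun x => R (f x) (g x) := fun _ _ _ _ hf hg => ⟨hR.comp_of (hf.out.prodMk hg.out)⟩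
theorem IComp.fun₁ {F : M → M} (hF : Comp S F) :
    ∀ ⦃α : Type u⦄ [Code M α] ⦃f : α → M⦄ [IComp S f], IComp S fun x => F (f x) :=
  fun _ _ _ hf => ⟨hF.comp_of hf.out⟩

theorem inS2_iff {R : M → M → Prop} : InS2 S R ↔ Dec S fun q : M × M => R q.1 q.2 := by
  refine iff_of_eq (congrArg (· ∈ S) (Set.ext fun z => ?_))
  exact ⟨fun ⟨a, b, h⟩ => ⟨(a, b), h⟩, fun ⟨(a, b), h⟩ => ⟨a, b, h⟩⟩

theorem inS3_iff {R : M → M → M → Prop} :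
    InS3 S R ↔ Dec S fun q : M × M × M => R q.1 q.2.1 q.2.2 := by
  refine iff_of_eq (congrArg (· ∈ S) (Set.ext fun z => ?_))
  exact ⟨fun ⟨a, b, c, h⟩ => ⟨(a, b, c), h⟩, fun ⟨(a, b, c), h⟩ => ⟨a, b, c, h⟩⟩

theorem inS4_iff {R : M → M → M → M → Prop} :
    InS4 S R ↔ Dec S fun q : M × M × M × M => R q.1 q.2.1 q.2.2.1 q.2.2.2 := by
  refine iff_of_eq (congrArg (· ∈ S) (Set.ext fun z => ?_))
  exact ⟨fun ⟨a, b, c, d, h⟩ => ⟨(a, b, c, d), h⟩, fun ⟨(a, b, c, d), h⟩ => ⟨a, b, c, d, h⟩⟩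

theorem dec_set_iff {P : M → Prop} : Dec S P ↔ {x | P x} ∈ S := by
  refine iff_of_eq (congrArg (· ∈ S) (Set.ext fun z => ?_))
  exact ⟨fun ⟨a, h, h'⟩ => by rw [h]; exact h', fun h => ⟨z, rfl, h⟩⟩

end

/-! ### Coding of finite sequences and recursion -/

section

variable {M : Type u} [CommSemiring M] [LinearOrder M] [NatLike M]

/-! ### Division -/

theorem exists_div (S : Set (Set M)) [hM : Model S] (n : M) {d : M} (hd : 0 < d) :
    ∃ q x, n = q * d + x ∧ x < d := by
  refine sig_induction S (P := fun n => ∃ q x, n = q * d + x ∧ x < d) sig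
    ⟨0, 0, by simp, hd⟩ ?_ n
  rintro n ⟨q, x, rfl, hx⟩
  rcases (succ_le.2 hx).lt_or_eq with h | h
  · exact ⟨q, x + 1, by ring, h⟩
  · exact ⟨q + 1, 0, by rw [← h]; ring, hd⟩

theorem div_unique {d q x q' x' : M} (h : q * d + x = q' * d + x') (hx : x < d) (hx' : x' < d) :
    x = x' := by
  have key : ∀ {q x q' x' : M}, q * d + x = q' * d + x' → x < d → x' < d → ¬ q < q' := by
    intro q x q' x' h hx hx' hq
    obtain ⟨r, rfl⟩ := exists_add_succ hq
    have : x = d + (r * d + x') := by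
      apply add_left_cancel (a := q * d)
      rw [h]; ring
    rw [this] at hx
    exact absurd hx (not_lt.2 le_self_add)
  rcases lt_trichotomy q q' with hq | rfl | hq
  · exact (key h hx hx' hq).elim
  · exact add_left_cancel h
  · exact (key h.symm hx' hx hq).elim

/-! ### Gödel's beta function -/

/-- A substitute for the factorial, which is not available as a function before sequences are coded.
-/
theorem exists_common_multiple (S : Set (Set M)) [hM : Model S] (N : M) :
    ∃ m, 0 < m ∧ ∀ j, j < N → ∃ q, m = (j + 1) * q := by
  refine sig_induction S (P := fun N => ∃ m, 0 < m ∧ ∀ j, j < N → ∃ q, m = (j + 1) * q) (by exact sig)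
    ⟨1, zero_lt_one, fun j hj => absurd hj (not_lt.2 zero_le)⟩ ?_ N
  rintro N ⟨m, hm, h⟩
  refine ⟨m * (N + 1), mul_pos hm (zero_lt_one.trans_le le_add_self), fun j hj => ?_⟩
  rcases (lt_succ.1 hj).lt_or_eq with hj | rfl
  · obtain ⟨q, rfl⟩ := h j hj
    exact ⟨q * (N + 1), by ring⟩
  · exact ⟨m, by ring⟩

/-- `a` is invertible modulo `c`. -/
def InvMod (a c : M) : Prop := ∃ u v, u * a = v * c + 1

theorem InvMod.mul {a b c : M} (ha : InvMod a c) (hb : InvMod b c) : InvMod (a * b) c := by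
  obtain ⟨u, v, h⟩ := ha
  obtain ⟨u', v', h'⟩ := hb
  refine ⟨u * u', v * v' * c + v + v', ?_⟩
  calc u * u' * (a * b) = (u * a) * (u' * b) := by ring
    _ = (v * c + 1) * (v' * c + 1) := by rw [h, h']
    _ = _ := by ring

/-- The combination (j+1)·(m(i+1)+1) − (i+1)·(m(j+1)+1) equals j − i. A common divisor of the two
moduli thus divides j − i, hence m, hence 1. The proof turns this into an explicit inverse without
subtraction. -/
theorem invMod_beta {m i j : M} (hm : 0 < m) (hij : i < j) (h : ∀ d, d < j → ∃ q, m = (d + 1) * q) :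
    InvMod (m * (i + 1) + 1) (m * (j + 1) + 1) := by
  obtain ⟨d, rfl⟩ := exists_add_succ hij
  obtain ⟨q, rfl⟩ := h d (lt_succ.2 le_add_self)
  rcases pos_or_zero q with rfl | ⟨q, rfl⟩
  · simp at hm
  -- Here m = (d+1)(q+1) and j = i+d+1. The first factor is (q+1)(i+1)(j+1) − 1, and its product s+1
  -- with m(i+1)+1 is −1 modulo m(j+1)+1, which is `hs'`. Squaring, by (s+1)² = s(s+2) + 1, replaces
  -- −1 by 1.
  obtain ⟨s, hs⟩ : ∃ s, (q * (i + 1) * (i + d + 1 + 1) + (i * (i + d + 1 + 1) + (i + d + 1))) *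
      ((d + 1) * (q + 1) * (i + 1) + 1) = s + 1 := by
    refine ⟨(q * (i + 1) * (i + d + 1 + 1) + (i * (i + d + 1 + 1) + (i + d + 1))) *
      ((d + 1) * (q + 1) * (i + 1)) +
      (q * (i + 1) * (i + d + 1 + 1) + (i * (i + d + 1 + 1) + (i + d))), by ring⟩
  have hs' : s + 1 + 1 = (q + 1) * (i + 1) * (i + 1) * ((d + 1) * (q + 1) * (i + d + 1 + 1) + 1) := by
    rw [← hs]; ring
  refine ⟨(s + 1) *
    (q * (i + 1) * (i + d + 1 + 1) + (i * (i + d + 1 + 1) + (i + d + 1))),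
    s * ((q + 1) * (i + 1) * (i + 1)), ?_⟩
  rw [mul_assoc, hs, mul_assoc s, ← hs']
  ring

/-- The number p plays the role of the product of the first j moduli. It is what the Chinese
remainder argument needs in order to change the j-th remainder while keeping the earlier ones. -/
theorem exists_beta_modulus (S : Set (Set M)) [hM : Model S] {m K : M} (hm : 0 < m)
    (h : ∀ d, d < K → ∃ q, m = (d + 1) * q) (j : M) :
    ∃ p, 0 < p ∧ (∀ i, i < j → ∃ q, p = q * (m * (i + 1) + 1)) ∧
      ∀ i, i < K → j ≤ i → InvMod p (m * (i + 1) + 1) := by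
  unfold InvMod
  refine sig_induction S (P := fun j => ∃ p, 0 < p ∧ (∀ i, i < j → ∃ q, p = q * (m * (i + 1) + 1)) ∧
      ∀ i, i < K → j ≤ i → ∃ u v, u * p = v * (m * (i + 1) + 1) + 1) (by exact sig)
    ⟨1, zero_lt_one, fun j hj => absurd hj (not_lt.2 zero_le), fun i _ _ => ⟨1, 0, by ring⟩⟩ ?_ j
  rintro j ⟨p, hp, h1, h2⟩
  refine ⟨p * (m * (j + 1) + 1), mul_pos hp (zero_lt_one.trans_le le_add_self), fun i hi => ?_,
    fun i hi hji => ?_⟩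
  · rcases (lt_succ.1 hi).lt_or_eq with hi | rfl
    · obtain ⟨q, hq⟩ := h1 i hi
      exact ⟨q * (m * (j + 1) + 1), by rw [hq]; ring⟩
    · exact ⟨p, rfl⟩
  · exact InvMod.mul (h2 i hi (le_self_add.trans hji))
      (invMod_beta hm (succ_le.1 hji) fun d hd => h d (hd.trans hi))

theorem entry_of_eq {k m n i q x : M} (hi : i < k) (h : n = q * (m * (i + 1) + 1) + x)
    (hx : x < m * (i + 1) + 1) : Entry (pair k (pair m n)) i x :=
  ⟨k, m, n, q, rfl, hi, h, hx⟩

theorem Entry.unique {c i x y : M} (h : Entry c i x) (h' : Entry c i y) : x = y := by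
  obtain ⟨k, m, n, q, rfl, -, h1, h2⟩ := h
  obtain ⟨k', m', n', q', h, -, h1', h2'⟩ := h'
  obtain ⟨rfl, h'⟩ := pair_inj.1 h
  obtain ⟨rfl, rfl⟩ := pair_inj.1 h'
  exact div_unique (h1.symm.trans h1') h2 h2'

/-- Sequences of bounded length with bounded entries have codes below a common bound. -/
theorem exists_code (S : Set (Set M)) [hM : Model S] (K B : M) : ∃ b, ∀ k, k ≤ K →
    ∀ F : M → M, Comp S F → (∀ i, i < k → F i < B) →
      ∃ c, c < b ∧ HasLen c k ∧ ∀ i, i < k → Entry c i (F i) := by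
  -- The multiple serves two purposes: divisibility by all numbers up to K makes the moduli coprime,
  -- and m ≥ B makes every modulus exceed the entries.
  obtain ⟨m, hm, hdvd⟩ := exists_common_multiple S (K + B)
  have hBm : B ≤ m := by
    rcases pos_or_zero (K + B) with h | ⟨N, hN⟩
    · rw [add_eq_zero] at h; rw [h.2]; exact zero_le
    · obtain ⟨q, hq⟩ := hdvd N (hN ▸ lt_add_one N)
      rcases pos_or_zero q with rfl | ⟨q, rfl⟩
      · rw [hq] at hm; simp at hm
      · rw [hq, ← hN]
        exact le_add_self.trans (le_mul_of_one_le_right zero_le le_add_self)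
  have hK : ∀ d, d < K → ∃ q, m = (d + 1) * q := fun d hd => hdvd d (hd.trans_le le_self_add)
  obtain ⟨p, hp, hpK, -⟩ := exists_beta_modulus S hm hK K
  refine ⟨pair K (pair m p) + 1, fun k hk F hF hFB => ?_⟩
  have iF := IComp.fun₁ hF
  have key : ∀ j, j ≤ k → ∃ n, ∀ i, i < j → ∃ q, n = q * (m * (i + 1) + 1) + F i := by
    refine sig_induction S sig ?_ ?_
    · exact fun _ => ⟨0, fun i hi => absurd hi (not_lt.2 zero_le)⟩
    · intro j ih hj
      obtain ⟨n, hn⟩ := ih (le_self_add.trans hj)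
      obtain ⟨p, hp, hpj, hpi⟩ := exists_beta_modulus S hm hK j
      obtain ⟨u, v, huv⟩ := hpi j ((succ_le.1 hj).trans_le hk) le_rfl
      -- Modulo the earlier moduli p vanishes. Modulo the j-th one, p * u is 1 and m(j+1) is −1, so
      -- that the sum becomes n + F j − n = F j.
      refine ⟨n + p * (u * (F j + m * (j + 1) * n)), fun i hi => ?_⟩
      rcases (lt_succ.1 hi).lt_or_eq with hi | rfl
      · obtain ⟨q, hq⟩ := hn i hi
        obtain ⟨r, hr⟩ := hpj i hi
        refine ⟨q + r * (u * (F j + m * (j + 1) * n)), ?_⟩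
        generalize u * (F j + m * (j + 1) * n) = z
        rw [hr, hq]; ring
      · refine ⟨v * (F i + m * (i + 1) * n) + n, ?_⟩
        calc n + p * (u * (F i + m * (i + 1) * n)) = n + (u * p) * (F i + m * (i + 1) * n) := by ring
          _ = _ := by rw [huv]; ring
  obtain ⟨n, hn⟩ := key k le_rfl
  -- Reduction modulo the fixed p, a multiple of all K moduli, keeps the remainders and makes the
  -- bound independent of the sequence.
  obtain ⟨r, n', hn', hlt⟩ := exists_div S n hp
  refine ⟨pair k (pair m n'), lt_succ.2 (pair_mono hk (pair_mono le_rfl hlt.le)), ⟨m, n', rfl⟩,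
    fun i hi => ?_⟩
  have hd : 0 < m * (i + 1) + 1 := zero_lt_one.trans_le le_add_self
  have hFi : F i < m * (i + 1) + 1 := by
    refine lt_succ.2 ((hFB i hi).le.trans (hBm.trans ?_))
    exact le_mul_of_one_le_right zero_le le_add_self
  obtain ⟨q, hq⟩ := hn i hi
  obtain ⟨s, hs⟩ := hpK i (hi.trans_le hk)
  obtain ⟨t, x, htx, hx⟩ := exists_div S n' hd
  have : x = F i := by
    refine div_unique (q := r * s + t) (q' := q) ?_ hx hFi
    rw [← hq, hn', htx, hs]; ring
  exact entry_of_eq hi (this ▸ htx) hFi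

/-! ### Sequences -/

open Classical in
/-- The `i`-th entry of the sequence described by `c`. -/
noncomputable def ent (c i : M) : M := if h : ∃ x, Entry c i x then h.choose else 0

theorem Entry.ent_eq {c i x : M} (h : Entry c i x) : ent c i = x := by
  have : ∃ x, Entry c i x := ⟨x, h⟩
  rw [ent, dif_pos this]
  exact this.choose_spec.unique h

theorem HasLen.unique {c k k' : M} (h : HasLen c k) (h' : HasLen c k') : k = k' := by
  obtain ⟨m, n, rfl⟩ := h
  obtain ⟨m', n', h⟩ := h'
  exact (pair_inj.1 h).1

theorem Entry.lt_of_hasLen {c i x k : M} (h : Entry c i x) (hk : HasLen c k) : i < k := by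
  obtain ⟨k', m, n, q, rfl, h, -⟩ := h
  rwa [hk.unique ⟨m, n, rfl⟩]

theorem IsSeq.len_unique {c k k' : M} (h : IsSeq k c) (h' : IsSeq k' c) : k = k' := h.1.unique h'.1

theorem IsSeq.len_le {c k : M} (h : IsSeq k c) : k ≤ c := by
  obtain ⟨⟨m, n, rfl⟩, -⟩ := h
  exact le_pair_left _ _

theorem entry_iff_bounded {c i x : M} : Entry c i x ↔ ∃ k, k ≤ c ∧ ∃ m, m ≤ c ∧ ∃ n, n ≤ c ∧
    ∃ q, q ≤ c ∧ c = pair k (pair m n) ∧ i < k ∧ n = q * (m * (i + 1) + 1) + x ∧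
      x < m * (i + 1) + 1 := by
  constructor
  · rintro ⟨k, m, n, q, rfl, hi, h, h'⟩
    refine ⟨k, le_pair_left _ _, m, (le_pair_left _ _).trans (le_pair_right _ _), n,
      (le_pair_right _ _).trans (le_pair_right _ _), q,
      le_trans ?_ ((le_pair_right m n).trans (le_pair_right _ _)), rfl, hi, h, h'⟩
    rw [h]
    exact (le_mul_of_one_le_right zero_le le_add_self).trans le_self_add
  · rintro ⟨k, -, m, -, n, -, q, -, h⟩
    exact ⟨k, m, n, q, h⟩

theorem Entry.le {c i x : M} (h : Entry c i x) : x ≤ c := by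
  obtain ⟨k, -, m, -, n, hn, q, -, -, -, h, -⟩ := entry_iff_bounded.1 h
  exact le_trans (by rw [h]; exact le_add_self) hn

theorem HasLen.entry {S : Set (Set M)} [hM : Model S] {c k i : M} (hc : HasLen c k) (hi : i < k) :
    Entry c i (ent c i) := by
  obtain ⟨m, n, rfl⟩ := hc
  obtain ⟨q, x, h, hx⟩ := exists_div S n (d := m * (i + 1) + 1) (zero_lt_one.trans_le le_add_self)
  have := entry_of_eq hi h hx
  rwa [this.ent_eq]

variable {S : Set (Set M)} [hM : Model S] {α : Type u} [Code M α]

theorem HasLen.entry_iff (S : Set (Set M)) [hM : Model S] {c k i x : M} (hc : HasLen c k) :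
    Entry c i x ↔ i < k ∧ ent c i = x :=
  ⟨fun h => ⟨h.lt_of_hasLen hc, h.ent_eq⟩, fun ⟨h, h'⟩ => h' ▸ HasLen.entry (S := S) hc h⟩

theorem IsSeq.entry_iff (S : Set (Set M)) [hM : Model S] {c k i x : M} (hc : IsSeq k c) :
    Entry c i x ↔ i < k ∧ ent c i = x := HasLen.entry_iff S hc.1

theorem dec_hasLen : Dec S fun p : M × M => HasLen p.1 p.2 :=
  (dec (P := fun p : M × M => ∃ m, m ≤ p.1 ∧ ∃ n, n ≤ p.1 ∧ p.1 = pair p.2 (pair m n))).congr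
    fun _ => ⟨fun ⟨m, n, h⟩ => ⟨m, h ▸ (le_pair_left _ _).trans (le_pair_right _ _), n,
      h ▸ (le_pair_right _ _).trans (le_pair_right _ _), h⟩, fun ⟨m, _, n, _, h⟩ => ⟨m, n, h⟩⟩

instance IDec.hasLen {f g : α → M} [IComp S f] [IComp S g] : IDec S fun x => HasLen (f x) (g x) :=
  ⟨dec_hasLen.rel₂ comp comp⟩

theorem dec_entry : Dec S fun p : M × M × M => Entry p.1 p.2.1 p.2.2 :=
  Dec.congr (by exact dec) fun _ => entry_iff_bounded

instance IDec.entry {f g h : α → M} [IComp S f] [IComp S g] [IComp S h] :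
    IDec S fun x => Entry (f x) (g x) (h x) := ⟨dec_entry.rel₃ comp comp comp⟩

theorem comp_ent : Comp S fun q : M × M => ent q.1 q.2 := by
  refine Comp.of_sig ((sig (P := fun p : (M × M) × M => Entry p.1.1 p.1.2 p.2 ∨
    p.2 = 0 ∧ ¬ ∃ x, x ≤ p.1.1 ∧ Entry p.1.1 p.1.2 x)).congr ?_)
  rintro ⟨⟨c, i⟩, y⟩
  dsimp only
  by_cases h : ∃ x, Entry c i x
  · obtain ⟨x, hx⟩ := h
    rw [hx.ent_eq]
    constructor
    · rintro rfl; exact Or.inl hx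
    · rintro (h | ⟨-, h⟩)
      · exact hx.unique h
      · exact (h ⟨x, hx.le, hx⟩).elim
  · rw [ent, dif_neg h]
    constructor
    · rintro rfl; exact Or.inr ⟨rfl, fun ⟨x, _, hx⟩ => h ⟨x, hx⟩⟩
    · rintro (h' | ⟨rfl, -⟩)
      · exact (h ⟨_, h'⟩).elim
      · rfl

instance IComp.ent {f g : α → M} [IComp S f] [IComp S g] : IComp S fun x => ent (f x) (g x) :=
  ⟨comp_ent.fun₂ comp comp⟩

instance IComp.ent_left (c : M) : IComp S (SOA.ent c) := ⟨comp_ent.fun₂ (.const c) .id⟩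

theorem isSeq_iff (S : Set (Set M)) [hM : Model S] {k c : M} : IsSeq k c ↔ HasLen c k ∧
    ∀ c', c' < c → HasLen c' k → ∃ i, i < k ∧ ent c' i ≠ ent c i := by
  refine and_congr_right fun hc => forall_congr' fun c' => imp_congr_right fun _ =>
    imp_congr_right fun hc' => ?_
  constructor
  · intro h
    by_contra h'
    push Not at h'
    refine h fun i x => ?_
    rw [hc.entry_iff S, hc'.entry_iff S]
    exact and_congr_right fun hi => by rw [h' i hi]
  · rintro ⟨i, hi, h⟩ h'
    exact h (((h' i (SOA.ent c i)).2 (HasLen.entry (S := S) hc hi)).ent_eq)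

theorem dec_isSeq : Dec S fun p : M × M => IsSeq p.1 p.2 :=
  Dec.congr (by exact dec) fun _ => isSeq_iff S

instance IDec.isSeq {f g : α → M} [IComp S f] [IComp S g] : IDec S fun x => IsSeq (f x) (g x) :=
  ⟨dec_isSeq.rel₂ comp comp⟩

theorem IsSeq.ext (S : Set (Set M)) [hM : Model S] {k c c' : M} (h : IsSeq k c) (h' : IsSeq k c')
    (he : ∀ i, i < k → SOA.ent c i = SOA.ent c' i) : c = c' := by
  rw [isSeq_iff S] at h h'
  rcases lt_trichotomy c c' with hlt | rfl | hlt
  · obtain ⟨i, hi, hne⟩ := h'.2 c hlt h.1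
    exact (hne (he i hi)).elim
  · rfl
  · obtain ⟨i, hi, hne⟩ := h.2 c' hlt h'.1
    exact (hne (he i hi).symm).elim

theorem exists_seq {F : M → M} (hF : Comp S F) (k : M) :
    ∃ c, IsSeq k c ∧ ∀ i, i < k → SOA.ent c i = F i := by
  have iF := IComp.fun₁ hF
  obtain ⟨B, hB⟩ := collection (S := S) (R := fun i m => m = F i) dec k fun i _ => ⟨_, rfl⟩
  obtain ⟨b, hb⟩ := exists_code S k B
  obtain ⟨c, -, hc, hce⟩ := hb k le_rfl F hF fun i hi => by
    obtain ⟨m, hm, rfl⟩ := hB i hi; exact hm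
  obtain ⟨c, ⟨hc, hce⟩, hmin⟩ := exists_least S
    (P := fun c => HasLen c k ∧ ∀ i, i < k → SOA.ent c i = F i) sig
    ⟨c, hc, fun i hi => (hce i hi).ent_eq⟩
  refine ⟨c, (isSeq_iff S).2 ⟨hc, fun c' hc' hl => ?_⟩, hce⟩
  by_contra h
  push Not at h
  exact hmin c' hc' ⟨hl, fun i hi => (h i hi).trans (hce i hi)⟩

/-- A sequence code is the least number describing the sequence, so the bound for some description
from `exists_code` also bounds the code. This later shows that a binary tree of bounded height has
bounded codes. -/
theorem exists_seq_bound (S : Set (Set M)) [hM : Model S] (K B : M) : ∃ b, ∀ k c, k ≤ K → IsSeq k c →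
    (∀ i, i < k → SOA.ent c i < B) → c < b := by
  obtain ⟨b, hb⟩ := exists_code S K B
  refine ⟨b, fun k c hk hc hB => ?_⟩
  obtain ⟨c', hc'b, hl, he⟩ := hb k hk (SOA.ent c) comp hB
  refine lt_of_le_of_lt ?_ hc'b
  by_contra h
  obtain ⟨i, hi, hne⟩ := ((isSeq_iff S).1 hc).2 c' (not_le.1 h) hl
  exact hne (he i hi).ent_eq

open Classical in
/-- The code of the sequence of length `k` with entries `F i`. -/
noncomputable def mkSeq (F : M → M) (k : M) : M :=
  if h : ∃ c, IsSeq k c ∧ ∀ i, i < k → SOA.ent c i = F i then h.choose else 0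

theorem isSeq_mkSeq {F : M → M} (hF : Comp S F) (k : M) : IsSeq k (mkSeq F k) := by
  have h := exists_seq hF k
  rw [mkSeq, dif_pos h]
  exact h.choose_spec.1

theorem ent_mkSeq {F : M → M} (hF : Comp S F) {k i : M} (hi : i < k) :
    SOA.ent (mkSeq F k) i = F i := by
  have h := exists_seq hF k
  rw [mkSeq, dif_pos h]
  exact h.choose_spec.2 i hi

theorem mkSeq_eq_iff {F : M → M} (hF : Comp S F) {k c : M} :
    mkSeq F k = c ↔ IsSeq k c ∧ ∀ i, i < k → SOA.ent c i = F i := by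
  constructor
  · rintro rfl; exact ⟨isSeq_mkSeq hF k, fun i hi => ent_mkSeq hF hi⟩
  · rintro ⟨h, h'⟩
    exact IsSeq.ext S (isSeq_mkSeq hF k) h fun i hi => (ent_mkSeq hF hi).trans (h' i hi).symm

instance IComp.mkSeq {G : α → M → M} {f : α → M} [hG : IComp S fun q : α × M => G q.1 q.2]
    [hf : IComp S f] : IComp S fun x => mkSeq (G x) (f x) := by
  have hGx : ∀ x, Comp S (G x) := fun x =>
    hG.out.comp_of (f := fun i => (x, i)) (Comp.prodMk (.const x) .id)
  have iG : ∀ ⦃β : Type u⦄ [Code M β] ⦃f : β → α⦄ ⦃g : β → M⦄ [IComp S f] [IComp S g],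
      IComp S fun x => G (f x) (g x) := fun β _ f g hf hg => ⟨Comp.fun₂ hG.out hf.out hg.out⟩
  have if' : ∀ ⦃β : Type u⦄ [Code M β] ⦃g : β → α⦄ [IComp S g], IComp S fun x => f (g x) :=
    fun β _ g hg => ⟨hf.out.comp_of hg.out⟩
  refine ⟨Comp.of_sig ((sig (P := fun p : α × M => IsSeq (f p.1) p.2 ∧
    ∀ i, i < f p.1 → SOA.ent p.2 i = G p.1 i)).congr fun p => mkSeq_eq_iff (hGx p.1))⟩

theorem mkSeq_congr {F G : M → M} (hF : Comp S F) (hG : Comp S G) {k : M}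
    (h : ∀ i, i < k → F i = G i) : mkSeq F k = mkSeq G k :=
  (mkSeq_eq_iff hF).2 ⟨isSeq_mkSeq hG k, fun i hi => (ent_mkSeq hG hi).trans (h i hi).symm⟩

theorem IsSeq.mkSeq_ent (S : Set (Set M)) [hM : Model S] {k c : M} (h : IsSeq k c) :
    SOA.mkSeq (SOA.ent c) k = c :=
  (mkSeq_eq_iff (S := S) comp).2 ⟨h, fun _ _ => rfl⟩

/-- Course of values recursion. -/
theorem exists_recursion (H : α → M → M → M) (hH : Comp S fun q : α × M × M => H q.1 q.2.1 q.2.2) :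
    ∃ f : α → M → M, (Comp S fun q : α × M => f q.1 q.2) ∧
      ∀ x v, f x v = H x v (SOA.mkSeq (f x) v) := by
  have iH : ∀ ⦃β : Type u⦄ [Code M β] ⦃f : β → α⦄ ⦃g h : β → M⦄ [IComp S f] [IComp S g] [IComp S h],
      IComp S fun x => H (f x) (g x) (h x) :=
    fun β _ f g h hf hg hh => ⟨hH.comp_of (hf.out.prodMk (hg.out.prodMk hh.out))⟩
  -- R x v c says that c records the first v values. Records exist by Σ⁰₁ induction and agree where
  -- both are defined (`hU`). By uniqueness the chosen record C x v has a Σ⁰₁ graph, hence is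
  -- computable.
  let R : α → M → M → Prop := fun x v c => IsSeq v c ∧
    ∀ i, i < v → SOA.ent c i = H x i (SOA.mkSeq (SOA.ent c) i)
  have hR : ∀ x v, ∃ c, R x v c := by
    intro x
    refine sig_induction S sig ?_ ?_
    · refine ⟨SOA.mkSeq (fun _ => 0) 0, isSeq_mkSeq (S := S) comp 0,
        fun i hi => absurd hi (not_lt.2 zero_le)⟩
    · rintro v ⟨c, hc, hce⟩
      classical
      let F : M → M := fun i => if i < v then SOA.ent c i else H x v c
      have hF : Comp S F := by
        refine Comp.of_sig ((sig (P := fun p : M × M => (p.1 < v ∧ SOA.ent c p.1 = p.2) ∨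
          (¬ p.1 < v ∧ H x v c = p.2))).congr fun p => ?_)
        simp only [F]
        split_ifs with h <;> simp [h]
      refine ⟨SOA.mkSeq F (v + 1), isSeq_mkSeq hF _, fun i hi => ?_⟩
      have hres : ∀ j, j ≤ v → SOA.mkSeq (SOA.ent (SOA.mkSeq F (v + 1))) j = SOA.mkSeq (SOA.ent c) j :=
        fun j hj => mkSeq_congr (S := S) comp comp fun l hl => by
          rw [ent_mkSeq hF ((hl.trans_le hj).trans (lt_add_one v))]
          exact if_pos (hl.trans_le hj)
      rw [ent_mkSeq hF hi, hres i (lt_succ.1 hi)]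
      rcases (lt_succ.1 hi).lt_or_eq with h | rfl
      · simp only [F, if_pos h]; exact hce i h
      · simp only [F, lt_irrefl, if_false]; rw [hc.mkSeq_ent S]
  have hU : ∀ x v c v' c', R x v c → R x v' c' → ∀ i, i < v → i < v' →
      SOA.ent c i = SOA.ent c' i := by
    intro x v c v' c' h h'
    refine dec_strong_induction S (by exact dec) fun i ih hi hi' => ?_
    rw [h.2 i hi, h'.2 i hi']
    refine congrArg (H x i) (mkSeq_congr (S := S) comp comp ?_)
    exact fun j hj => ih j hj (hj.trans hi) (hj.trans hi')
  choose C hC using hR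
  have hcomp : Comp S fun q : α × M => H q.1 q.2 (C q.1 q.2) := by
    have : Comp S fun q : α × M => C q.1 q.2 :=
      Comp.of_sig ((sig (P := fun p : (α × M) × M => R p.1.1 p.1.2 p.2)).congr fun p =>
        ⟨fun h => h ▸ hC _ _, fun h => (hC p.1.1 p.1.2).1.ext S h.1
          fun i hi => hU _ _ _ _ _ (hC _ _) h i hi hi⟩)
    exact hH.comp_of (Comp.prodMk .fst' (Comp.prodMk .snd' this))
  refine ⟨fun x v => H x v (C x v), hcomp, fun x v => ?_⟩
  have h1 : Comp S fun v => H x v (C x v) := hcomp.comp_of (f := fun v => (x, v))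
    (Comp.prodMk (.const x) .id)
  dsimp only
  congr 1
  refine ((mkSeq_eq_iff h1).2 ⟨(hC x v).1, fun i hi => ?_⟩).symm
  rw [(hC x v).2 i hi]
  congr 1
  refine (mkSeq_eq_iff (S := S) (by exact comp)).2 ⟨(hC x i).1, fun j hj => ?_⟩
  exact hU _ _ _ _ _ (hC x i) (hC x v) j hj (hj.trans hi)

end

/-! ### Predecessors, ranges and increasing sequences -/

section

variable {M : Type u} [CommSemiring M] [LinearOrder M] [NatLike M]
variable {S : Set (Set M)} [hM : Model S] {α : Type u} [Code M α]

instance IComp.ite {P : α → Prop} {_ : ∀ x, Decidable (P x)} {f g : α → M} [hP : IDec S P]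
    [hf : IComp S f] [hg : IComp S g] : IComp S fun x => if P x then f x else g x := by
  refine ⟨Comp.of_sig (Dec.sig (Dec.congr (P := fun q : α × M => (P q.1 ∧ f q.1 = q.2) ∨
    (¬ P q.1 ∧ g q.1 = q.2)) ?_ fun q => ?_))⟩
  · have h1 := hP.out.comp_of (f := fun q : α × M => q.1) .fst'
    exact (h1.and (.eq (hf.out.comp_of .fst') .snd')).or
      (h1.not.and (.eq (hg.out.comp_of .fst') .snd'))
  · split_ifs with h <;> simp [h]

open Classical in
/-- The predecessor function. -/
noncomputable def pred (a : M) : M := if h : ∃ b, a = b + 1 then h.choose else 0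

@[simp] theorem pred_succ (b : M) : pred (b + 1) = b := by
  have h : ∃ b', b + 1 = b' + 1 := ⟨b, rfl⟩
  rw [pred, dif_pos h]
  exact (add_right_cancel h.choose_spec).symm

@[simp] theorem pred_zero : pred (0 : M) = 0 := by
  rw [pred, dif_neg]
  rintro ⟨b, h⟩
  exact absurd (zero_lt_one.trans_le (le_add_self : 1 ≤ b + 1)) (by rw [← h]; exact lt_irrefl _)

theorem succ_pred {a : M} (h : a ≠ 0) : pred a + 1 = a := by
  rcases pos_or_zero a with rfl | ⟨b, rfl⟩
  · exact (h rfl).elim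
  · rw [pred_succ]

theorem comp_pred : Comp S fun a : M => pred a := by
  refine Comp.of_sig (Sig.congr (P := fun p : M × M => (p.1 = 0 ∧ p.2 = 0) ∨ p.1 = p.2 + 1)
    (by exact sig) ?_)
  rintro ⟨a, b⟩
  dsimp only
  rcases pos_or_zero a with rfl | ⟨c, rfl⟩
  · constructor
    · rintro rfl; left; simp
    · rintro (h | h)
      · simp [h.2]
      · rw [h, pred_succ]
  · constructor
    · rintro rfl; right; simp
    · rintro (h | h)
      · rw [h.1, h.2, pred_zero]
      · rw [h, pred_succ]

instance IComp.pred {f : α → M} [hf : IComp S f] : IComp S fun x => pred (f x) :=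
  ⟨comp_pred.comp_of hf.out⟩

instance IComp.pred_self : IComp S (SOA.pred : M → M) := ⟨comp_pred⟩

/-- `y` occurs in the sequence `e`. -/
def Rng (e y : M) : Prop := ∃ i, Entry e i y

theorem Entry.lt_code {e i y : M} (h : Entry e i y) : i < e + 1 := by
  obtain ⟨k, m, n, q, rfl, h, -⟩ := h
  exact (h.trans_le (le_pair_left _ _)).trans (lt_add_one _)

theorem dec_rng : Dec S fun p : M × M => Rng p.1 p.2 :=
  (dec (P := fun p : M × M => ∃ i, i < p.1 + 1 ∧ Entry p.1 i p.2)).congr fun _ =>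
    ⟨fun ⟨i, h⟩ => ⟨i, h.lt_code, h⟩, fun ⟨i, _, h⟩ => ⟨i, h⟩⟩

instance IDec.rng {f g : α → M} [IComp S f] [IComp S g] : IDec S fun x => Rng (f x) (g x) :=
  ⟨dec_rng.rel₂ comp comp⟩

theorem IsSeq.rng_iff (S : Set (Set M)) [hM : Model S] {n e y : M} (h : IsSeq n e) :
    Rng e y ↔ ∃ i, i < n ∧ ent e i = y := by
  simp only [Rng, h.entry_iff S]

/-! ### Increasing sequences -/

instance IDec.linOrd_lt (X : LinOrd S) {f g : α → M} [IComp S f] [IComp S g] :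
    IDec S fun x => X.lt (f x) (g x) := ⟨(inS2_iff.1 X.lt_mem).rel₂ comp comp⟩

instance IDec.linOrd_dom (X : LinOrd S) {f : α → M} [IComp S f] :
    IDec S fun x => f x ∈ X.dom := ⟨.mem X.dom_mem comp⟩

theorem LinOrd.asymm (X : LinOrd S) {x y : M} (h : X.lt x y) : ¬ X.lt y x :=
  fun h' => X.irrefl x (X.trans _ _ _ h h')

/-- The linear order `{0, …, m-1}`. -/
def natOrd (S : Set (Set M)) [Model S] (m : M) : LinOrd S where
  dom := {x | x < m}
  lt x y := x < y ∧ y < m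
  dom_mem := dec_set_iff.1 dec
  lt_mem := inS2_iff.2 dec
  lt_dom _ _ h := ⟨h.1.trans h.2, h.2⟩
  irrefl _ h := lt_irrefl _ h.1
  trans _ _ _ h h' := ⟨h.1.trans h'.1, h'.2⟩
  total x hx y hy := by
    rcases lt_trichotomy x y with h | h | h
    · exact Or.inl ⟨h, hy⟩
    · exact Or.inr (Or.inl h)
    · exact Or.inr (Or.inr ⟨h, hx⟩)

theorem incSeq_iff {X : LinOrd S} {n e : M} : IncSeq X n e ↔ IsSeq n e ∧
    (∀ i, i < n → ent e i ∈ X.dom) ∧ ∀ j, j < n → ∀ i, i < j → X.lt (ent e i) (ent e j) := by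
  refine and_congr_right fun h => and_congr ?_ ?_
  · simp only [h.entry_iff S]
    exact ⟨fun H i hi => H i _ ⟨hi, rfl⟩, fun H i x hx => hx.2 ▸ H i hx.1⟩
  · simp only [h.entry_iff S]
    exact ⟨fun H j hj i hij => H i j _ _ hij ⟨hij.trans hj, rfl⟩ ⟨hj, rfl⟩,
      fun H i j x y hij hx hy => hx.2 ▸ hy.2 ▸ H j hy.1 i hij⟩

/-- This makes morphisms a special case of increasing sequences, so that results on the latter apply
to both. -/
theorem mor_iff_incSeq (S : Set (Set M)) [Model S] {n m f : M} :
    Mor n m f ↔ IncSeq (natOrd S m) n f := by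
  refine and_congr_right fun _ => and_congr_right fun h => ?_
  exact ⟨fun H i j x y hij hx hy => ⟨H i j x y hij hx hy, h _ _ hy⟩,
    fun H i j x y hij hx hy => (H i j x y hij hx hy).1⟩

instance IDec.incSeq (X : LinOrd S) {f g : α → M} [IComp S f] [IComp S g] :
    IDec S fun x => IncSeq X (f x) (g x) := by
  have : Dec S fun p : M × M => IncSeq X p.1 p.2 := Dec.congr (by exact dec) fun _ => incSeq_iff
  exact ⟨this.rel₂ comp comp⟩

theorem mor_iff (S : Set (Set M)) [Model S] {n m f : M} : Mor n m f ↔ IsSeq n f ∧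
    (∀ i, i < n → ent f i < m) ∧ ∀ j, j < n → ∀ i, i < j → ent f i < ent f j := by
  rw [mor_iff_incSeq S, incSeq_iff]
  exact and_congr_right fun _ => and_congr_right fun h =>
    ⟨fun H j hj i hij => (H j hj i hij).1, fun H j hj i hij => ⟨H j hj i hij, h j hj⟩⟩

instance IDec.mor {f g h : α → M} [IComp S f] [IComp S g] [IComp S h] :
    IDec S fun x => Mor (f x) (g x) (h x) := by
  have : Dec S fun p : M × M × M => Mor p.1 p.2.1 p.2.2 :=
    Dec.congr (by exact dec) fun _ => mor_iff S
  exact ⟨this.rel₃ comp comp comp⟩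

theorem Mor.lt (S : Set (Set M)) [Model S] {n m f i : M} (h : Mor n m f) (hi : i < n) :
    ent f i < m := ((mor_iff S).1 h).2.1 i hi

theorem Mor.mono (S : Set (Set M)) [Model S] {n m f i j : M} (h : Mor n m f) (hj : j < n)
    (hi : i < j) : ent f i < ent f j := ((mor_iff S).1 h).2.2 j hj i hi

theorem IncSeq.mem_dom {X : LinOrd S} {n e i : M} (h : IncSeq X n e) (hi : i < n) :
    ent e i ∈ X.dom := (incSeq_iff.1 h).2.1 i hi

theorem IncSeq.mono {X : LinOrd S} {n e i j : M} (h : IncSeq X n e) (hj : j < n) (hi : i < j) :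
    X.lt (ent e i) (ent e j) := (incSeq_iff.1 h).2.2 j hj i hi

theorem IncSeq.lt_iff {X : LinOrd S} {n e i j : M} (h : IncSeq X n e) (hi : i < n) (hj : j < n) :
    X.lt (ent e i) (ent e j) ↔ i < j := by
  refine ⟨fun hlt => ?_, h.mono hj⟩
  rcases lt_trichotomy i j with h1 | rfl | h1
  · exact h1
  · exact (X.irrefl _ hlt).elim
  · exact (X.asymm hlt (h.mono hi h1)).elim

theorem IncSeq.inj {X : LinOrd S} {n e i j : M} (h : IncSeq X n e) (hi : i < n) (hj : j < n)
    (heq : ent e i = ent e j) : i = j := by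
  rcases lt_trichotomy i j with h1 | rfl | h1
  · have := h.mono hj h1; rw [heq] at this; exact (X.irrefl _ this).elim
  · rfl
  · have := h.mono hi h1; rw [heq] at this; exact (X.irrefl _ this).elim

/-- The composition `d ∘ f` of sequences, where `f` has length `n`. -/
noncomputable def compSeq (d f n : M) : M := mkSeq (fun i => ent d (ent f i)) n

theorem isSeq_compSeq (S : Set (Set M)) [Model S] (d f n : M) : IsSeq n (compSeq d f n) :=
  isSeq_mkSeq (S := S) comp n

theorem ent_compSeq (S : Set (Set M)) [Model S] {d f n i : M} (hi : i < n) :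
    ent (compSeq d f n) i = ent d (ent f i) := ent_mkSeq (S := S) (by exact comp) hi

theorem IncSeq.comp {X : LinOrd S} {k d n f : M} (hd : IncSeq X k d) (hf : Mor n k f) :
    IncSeq X n (SOA.compSeq d f n) := by
  refine incSeq_iff.2 ⟨isSeq_compSeq S d f n, fun i hi => ?_, fun j hj i hi => ?_⟩
  · rw [ent_compSeq S hi]; exact hd.mem_dom (hf.lt S hi)
  · rw [ent_compSeq S hj, ent_compSeq S (hi.trans hj)]
    exact hd.mono (hf.lt S hj) (hf.mono S hj hi)

theorem Mor.comp (S : Set (Set M)) [Model S] {k m n g f : M} (hg : Mor m k g) (hf : Mor n m f) :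
    Mor n k (SOA.compSeq g f n) :=
  (mor_iff_incSeq S).2 (((mor_iff_incSeq S).1 hg).comp hf)

theorem isComp_iff (S : Set (Set M)) [Model S] {n k n' f d e : M} (hf : Mor n k f) (hd : IsSeq k d)
    (he : IsSeq n' e) : IsComp f d e ↔ n' = n ∧ ∀ i, i < n → ent d (ent f i) = ent e i := by
  unfold IsComp
  simp only [hd.entry_iff S, he.entry_iff S, hf.1.entry_iff S]
  constructor
  · intro h
    have h1 : ∀ i, i < n' ↔ i < n := fun i => by
      constructor
      · intro hi
        obtain ⟨x, ⟨h, -⟩, -⟩ := (h i _).1 ⟨hi, rfl⟩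
        exact h
      · intro hi
        exact ((h i _).2 ⟨_, ⟨hi, rfl⟩, hf.lt S hi, rfl⟩).1
    refine ⟨?_, fun i hi => ?_⟩
    · rcases lt_trichotomy n' n with h2 | h2 | h2
      · exact (lt_irrefl _ ((h1 _).2 h2)).elim
      · exact h2
      · exact (lt_irrefl _ ((h1 _).1 h2)).elim
    · obtain ⟨x, ⟨-, rfl⟩, -, h3⟩ := (h i _).1 ⟨(h1 i).2 hi, rfl⟩
      exact h3
  · rintro ⟨rfl, h⟩ i y
    constructor
    · rintro ⟨hi, rfl⟩
      exact ⟨_, ⟨hi, rfl⟩, hf.lt S hi, h i hi⟩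
    · rintro ⟨x, ⟨hi, rfl⟩, -, rfl⟩
      exact ⟨hi, (h i hi).symm⟩

theorem isComp_compSeq (S : Set (Set M)) [Model S] {n k f d : M} (hf : Mor n k f) (hd : IsSeq k d) :
    IsComp f d (compSeq d f n) :=
  (isComp_iff S hf hd (isSeq_compSeq S d f n)).2 ⟨rfl, fun _ hi => (ent_compSeq S hi).symm⟩

theorem IsComp.eq_compSeq (S : Set (Set M)) [Model S] {n k n' f d e : M} (h : IsComp f d e)
    (hf : Mor n k f) (hd : IsSeq k d) (he : IsSeq n' e) : n' = n ∧ e = compSeq d f n := by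
  obtain ⟨rfl, h⟩ := (isComp_iff S hf hd he).1 h
  exact ⟨rfl, he.ext S (isSeq_compSeq S d f n') fun i hi => by rw [ent_compSeq S hi, h i hi]⟩

/-- An increasing sequence factors through every increasing sequence with larger range. -/
theorem IncSeq.factor {X : LinOrd S} {k d n e : M} (hd : IncSeq X k d) (he : IncSeq X n e)
    (h : ∀ y, Rng e y → Rng d y) : ∃ f, Mor n k f ∧ ∀ i, i < n → ent d (ent f i) = ent e i := by
  classical
  have h1 : ∀ i, i < n → ∃ j, j < k ∧ ent d j = ent e i := fun i hi =>
    (hd.1.rng_iff S).1 (h _ ((he.1.rng_iff S).2 ⟨i, hi, rfl⟩))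
  choose! F hF using h1
  -- The choice function is arbitrary from n onwards; cutting it off there gives a graph that is Σ⁰₁
  -- everywhere.
  let G : M → M := fun i => if i < n then F i else 0
  have hG : Comp S G := by
    refine Comp.of_sig (Sig.congr (P := fun p : M × M =>
      (p.1 < n ∧ p.2 < k ∧ ent d p.2 = ent e p.1) ∨ (¬ p.1 < n ∧ p.2 = 0)) (by exact sig) ?_)
    rintro ⟨i, j⟩
    by_cases hi : i < n
    · simp only [G, if_pos hi, hi, true_and, not_true, false_and, or_false]
      constructor
      · rintro rfl; exact hF i hi
      · rintro ⟨hj, he⟩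
        exact hd.inj (hF i hi).1 hj ((hF i hi).2.trans he.symm)
    · simp only [G, if_neg hi, hi, not_false_eq_true, true_and, false_and, false_or]
      exact eq_comm
  have hGF : ∀ i, i < n → ent (mkSeq G n) i = F i := fun i hi => by
    rw [ent_mkSeq hG hi]; exact if_pos hi
  refine ⟨mkSeq G n, (mor_iff S).2 ⟨isSeq_mkSeq hG n, fun i hi => ?_, fun j hj i hij => ?_⟩,
    fun i hi => ?_⟩
  · rw [hGF i hi]; exact (hF i hi).1
  · have hi := hij.trans hj
    rw [hGF i hi, hGF j hj, ← hd.lt_iff (hF i hi).1 (hF j hj).1, (hF i hi).2, (hF j hj).2]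
    exact he.mono hj hij
  · rw [hGF i hi]; exact (hF i hi).2

theorem Mor.le_ent (S : Set (Set M)) [Model S] {n m f i : M} (h : Mor n m f) (hi : i < n) :
    i ≤ ent f i := by
  revert hi
  refine dec_induction S (P := fun i => i < n → i ≤ ent f i) (by exact dec) (fun _ => zero_le)
    (fun i ih hi => ?_) i
  have h1 := h.mono S hi (lt_add_one i)
  exact succ_le.2 ((ih ((lt_add_one i).trans hi)).trans_lt h1)

/-- Each sequence factors through the other by a strictly increasing map. Such maps satisfy i ≤ f i,
and two that are inverse to each other must be identities. -/
theorem IncSeq.ext_rng {X : LinOrd S} {n e n' e' : M} (he : IncSeq X n e) (he' : IncSeq X n' e')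
    (h : ∀ y, Rng e y ↔ Rng e' y) : n = n' ∧ e = e' := by
  obtain ⟨f, hf, hfe⟩ := he'.factor he fun y => (h y).1
  obtain ⟨g, hg, hge⟩ := he.factor he' fun y => (h y).2
  have hid : ∀ i, i < n → ent f i = i := fun i hi => by
    have h1 : ent f i < n' := hf.lt S hi
    have h2 : ent g (ent f i) = i := he.inj (hg.lt S h1) hi (by rw [hge _ h1, hfe i hi])
    refine le_antisymm ?_ (hf.le_ent S hi)
    exact (hg.le_ent S h1).trans h2.le
  have hid' : ∀ i, i < n' → ent g i = i := fun i hi => by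
    have h1 : ent g i < n := hg.lt S hi
    have h2 : ent f (ent g i) = i := he'.inj (hf.lt S h1) hi (by rw [hfe _ h1, hge i hi])
    refine le_antisymm ?_ (hg.le_ent S hi)
    exact (hf.le_ent S h1).trans h2.le
  have hn : n = n' := by
    rcases lt_trichotomy n n' with h1 | h1 | h1
    · have := hg.lt S h1; rw [hid' _ h1] at this; exact (lt_irrefl _ this).elim
    · exact h1
    · have := hf.lt S h1; rw [hid _ h1] at this; exact (lt_irrefl _ this).elim
  subst hn
  refine ⟨rfl, he.1.ext S he'.1 fun i hi => ?_⟩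
  rw [← hfe i hi, hid i hi]

/-- The sequence `e` of length `n`, extended by `x`. -/
noncomputable def snoc (e n x : M) : M := mkSeq (fun i => if i < n then ent e i else x) (n + 1)

instance IComp.snoc {f g h : α → M} [hf : IComp S f] [hg : IComp S g] [hh : IComp S h] :
    IComp S fun x => snoc (f x) (g x) (h x) := by
  have h1 : Comp S fun p : M × M × M => SOA.snoc p.1 p.2.1 p.2.2 :=
    comp (f := fun p : M × M × M => SOA.mkSeq (fun i => if i < p.2.1 then SOA.ent p.1 i else p.2.2)
      (p.2.1 + 1))
  exact ⟨h1.comp_of (hf.out.prodMk (hg.out.prodMk hh.out))⟩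

theorem isSeq_snoc (S : Set (Set M)) [Model S] (e n x : M) : IsSeq (n + 1) (snoc e n x) :=
  isSeq_mkSeq (S := S) (by exact comp) _

theorem ent_snoc_of_lt (S : Set (Set M)) [Model S] {e n x i : M} (hi : i < n) :
    ent (snoc e n x) i = ent e i :=
  (ent_mkSeq (S := S) (by exact comp) (hi.trans (lt_add_one n))).trans (if_pos hi)

theorem ent_snoc_last (S : Set (Set M)) [Model S] (e n x : M) : ent (snoc e n x) n = x :=
  (ent_mkSeq (S := S) (by exact comp) (lt_add_one n)).trans (if_neg (lt_irrefl n))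

theorem IncSeq.snoc {X : LinOrd S} {n e x : M} (he : IncSeq X n e) (hx : x ∈ X.dom)
    (h : ∀ i, i < n → X.lt (SOA.ent e i) x) : IncSeq X (n + 1) (SOA.snoc e n x) := by
  refine incSeq_iff.2 ⟨isSeq_snoc S e n x, fun i hi => ?_, fun j hj i hij => ?_⟩
  · rcases (lt_succ.1 hi).lt_or_eq with hi | rfl
    · rw [ent_snoc_of_lt S hi]; exact he.mem_dom hi
    · rwa [ent_snoc_last S]
  · rcases (lt_succ.1 hj).lt_or_eq with hj | rfl
    · rw [ent_snoc_of_lt S hj, ent_snoc_of_lt S (hij.trans hj)]; exact he.mono hj hij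
    · rw [ent_snoc_last S, ent_snoc_of_lt S hij]; exact h i hij

theorem exists_empty (X : LinOrd S) : ∃ e, IncSeq X 0 e :=
  ⟨mkSeq (fun _ => 0) 0, incSeq_iff.2 ⟨isSeq_mkSeq (S := S) comp 0,
    fun _ hi => absurd hi not_lt_zero, fun _ hj => absurd hj not_lt_zero⟩⟩

theorem IncSeq.exists_insert {X : LinOrd S} {n e x : M} (he : IncSeq X n e) (hx : x ∈ X.dom) :
    ∃ n' e', IncSeq X n' e' ∧ ∀ y, Rng e' y ↔ Rng e y ∨ y = x := by
  classical
  by_cases hxe : Rng e x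
  · exact ⟨n, e, he, fun y => ⟨Or.inl, fun h => h.elim id fun h => h ▸ hxe⟩⟩
  -- The position p at which x is inserted is the first index whose entry is not below x, or n if
  -- there is none.
  obtain ⟨p, hp, hmin⟩ := exists_least S (P := fun p => ¬ (p < n ∧ X.lt (ent e p) x))
    (by exact sig) ⟨n, fun h => lt_irrefl _ h.1⟩
  have hpn : p ≤ n := by
    by_contra h
    exact lt_irrefl _ (not_not.1 (hmin n (not_le.1 h))).1
  have hlow : ∀ i, i < p → X.lt (ent e i) x := fun i hi => (not_not.1 (hmin i hi)).2
  have hhigh : ∀ i, p ≤ i → i < n → X.lt x (ent e i) := by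
    intro i hi hin
    have h1 : X.lt x (ent e p) := by
      have hpn' := hi.trans_lt hin
      rcases X.total _ hx _ (he.mem_dom hpn') with h | h | h
      · exact h
      · exact (hxe ((he.1.rng_iff S).2 ⟨p, hpn', h.symm⟩)).elim
      · exact (hp ⟨hpn', h⟩).elim
    rcases hi.lt_or_eq with hi | rfl
    · exact X.trans _ _ _ h1 (he.mono hin hi)
    · exact h1
  let F : M → M := fun i => if i < p then ent e i else if i = p then x else ent e (pred i)
  have hF : Comp S F := SOA.comp (f := fun i => if i < p then ent e i else
    if i = p then x else ent e (pred i))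
  have hF1 : ∀ i, i < p → F i = ent e i := fun i hi => if_pos hi
  have hF2 : F p = x := by simp [F]
  have hF3 : ∀ i, p ≤ i → F (i + 1) = ent e i := fun i hi => by
    have h1 : ¬ i + 1 < p := fun h => absurd ((lt_add_one i).trans h) (not_lt.2 hi)
    have h2 : i + 1 ≠ p := fun h => absurd hi (not_le.2 (h ▸ lt_add_one i))
    simp [F, h1, h2]
  have cases : ∀ i, i < n + 1 → (i < p ∨ i = p ∨ ∃ j, i = j + 1 ∧ p ≤ j ∧ j < n) := by
    intro i hi
    rcases lt_trichotomy i p with h | h | h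
    · exact Or.inl h
    · exact Or.inr (Or.inl h)
    · rcases pos_or_zero i with rfl | ⟨j, rfl⟩
      · exact absurd h not_lt_zero
      · exact Or.inr (Or.inr ⟨j, rfl, lt_succ.1 h, by simpa using hi⟩)
  refine ⟨n + 1, mkSeq F (n + 1), incSeq_iff.2 ⟨isSeq_mkSeq hF _, fun i hi => ?_,
    fun j hj i hij => ?_⟩, fun y => ?_⟩
  · rw [ent_mkSeq hF hi]
    rcases cases i hi with h | rfl | ⟨j, rfl, h, h'⟩
    · rw [hF1 i h]; exact he.mem_dom (h.trans_le hpn)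
    · rwa [hF2]
    · rw [hF3 j h]; exact he.mem_dom h'
  · rw [ent_mkSeq hF hj, ent_mkSeq hF (hij.trans hj)]
    rcases cases j hj with h | rfl | ⟨j, rfl, h, h'⟩
    · rw [hF1 j h, hF1 i (hij.trans h)]; exact he.mono (h.trans_le hpn) hij
    · rw [hF2, hF1 i hij]; exact hlow i hij
    · rw [hF3 j h]
      rcases cases i (hij.trans hj) with h1 | rfl | ⟨i, rfl, h1, h1'⟩
      · rw [hF1 i h1]; exact he.mono h' (h1.trans_le h)
      · rw [hF2]; exact hhigh j h h'
      · rw [hF3 i h1]; exact he.mono h' (by simpa using hij)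
  · rw [(isSeq_mkSeq hF _).rng_iff S, he.1.rng_iff S]
    constructor
    · rintro ⟨i, hi, rfl⟩
      rw [ent_mkSeq hF hi]
      rcases cases i hi with h | rfl | ⟨j, rfl, h, h'⟩
      · exact Or.inl ⟨i, h.trans_le hpn, (hF1 i h).symm⟩
      · exact Or.inr hF2
      · exact Or.inl ⟨j, h', (hF3 j h).symm⟩
    · rintro (⟨i, hi, rfl⟩ | rfl)
      · rcases lt_or_ge i p with h | h
        · exact ⟨i, hi.trans (lt_add_one n), by rw [ent_mkSeq hF (hi.trans (lt_add_one n)), hF1 i h]⟩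
        · exact ⟨i + 1, by simpa using hi, by rw [ent_mkSeq hF (by simpa using hi), hF3 i h]⟩
      · exact ⟨p, lt_succ.2 hpn, by rw [ent_mkSeq hF (lt_succ.2 hpn), hF2]⟩

theorem IncSeq.exists_union {X : LinOrd S} {n e m d : M} (he : IncSeq X n e) (hd : IncSeq X m d) :
    ∃ k u, IncSeq X k u ∧ ∀ y, Rng u y ↔ Rng e y ∨ Rng d y := by
  -- The entries of d are inserted one at a time. The ranges are compared by bounded quantifiers
  -- over indices, which keeps the induction statement Σ⁰₁.
  have key : ∀ j, j ≤ m → ∃ k u, IncSeq X k u ∧ (∀ i, i < n → Rng u (ent e i)) ∧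
      (∀ i, i < j → Rng u (ent d i)) ∧ ∀ i, i < k → Rng e (ent u i) ∨ Rng d (ent u i) := by
    refine sig_induction S (by exact sig) ?_ ?_
    · refine fun _ => ⟨n, e, he, fun i hi => (he.1.rng_iff S).2 ⟨i, hi, rfl⟩,
        fun i hi => absurd hi not_lt_zero, fun i hi => Or.inl ((he.1.rng_iff S).2 ⟨i, hi, rfl⟩)⟩
    · intro j ih hj
      obtain ⟨k, u, hu, h1, h2, h3⟩ := ih (le_self_add.trans hj)
      have hj' := succ_le.1 hj
      obtain ⟨k', u', hu', h⟩ := hu.exists_insert (hd.mem_dom hj')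
      refine ⟨k', u', hu', fun i hi => (h _).2 (Or.inl (h1 i hi)), fun i hi => ?_, fun i hi => ?_⟩
      · rcases (lt_succ.1 hi).lt_or_eq with hi | rfl
        · exact (h _).2 (Or.inl (h2 i hi))
        · exact (h _).2 (Or.inr rfl)
      · rcases (h _).1 ((hu'.1.rng_iff S).2 ⟨i, hi, rfl⟩) with h4 | h4
        · obtain ⟨i', hi', h5⟩ := (hu.1.rng_iff S).1 h4
          rw [← h5]; exact h3 i' hi'
        · rw [h4]; exact Or.inr ((hd.1.rng_iff S).2 ⟨j, hj', rfl⟩)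
  obtain ⟨k, u, hu, h1, h2, h3⟩ := key m le_rfl
  refine ⟨k, u, hu, fun y => ⟨fun h => ?_, ?_⟩⟩
  · obtain ⟨i, hi, rfl⟩ := (hu.1.rng_iff S).1 h
    exact h3 i hi
  · rintro (h | h)
    · obtain ⟨i, hi, rfl⟩ := (he.1.rng_iff S).1 h
      exact h1 i hi
    · obtain ⟨i, hi, rfl⟩ := (hd.1.rng_iff S).1 h
      exact h2 i hi

end

section

variable {M : Type u} [CommSemiring M] [LinearOrder M] [NatLike M]
variable {S : Set (Set M)} [hM : Model S]

/-! ### The order of `D(X)` -/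

theorem Predilator.el_of_map (D : Predilator S) {n m f σ τ : M} (hf : Mor n m f)
    (h : D.map m f σ τ) : D.el n σ ∧ D.el m τ := by
  obtain ⟨n', hf', h1, h2⟩ := D.map_el _ _ _ _ h
  rw [hf.1.len_unique hf'.1]
  exact ⟨h1, h2⟩

theorem Predilator.map_unique (D : Predilator S) {n m f σ τ τ' : M} (hf : Mor n m f)
    (h : D.map m f σ τ) (h' : D.map m f σ τ') : τ = τ' :=
  (D.map_exists_unique n m f σ hf (D.el_of_map hf h).1).unique h h'

theorem Predilator.map_lt_iff (D : Predilator S) {n m f σ τ σ' τ' : M} (hf : Mor n m f)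
    (h : D.map m f σ τ) (h' : D.map m f σ' τ') : D.lt m τ τ' ↔ D.lt n σ σ' := by
  refine ⟨fun hlt => ?_, fun hlt => D.map_lt _ _ _ _ _ _ _ hf hlt h h'⟩
  rcases D.lt_total n σ σ' (D.el_of_map hf h).1 (D.el_of_map hf h').1 with h1 | rfl | h1
  · exact h1
  · rw [D.map_unique hf h h'] at hlt
    exact (D.lt_irrefl _ _ hlt).elim
  · exact (D.lt_irrefl _ _
      (D.lt_trans _ _ _ _ hlt (D.map_lt _ _ _ _ _ _ _ hf h1 h' h))).elim

theorem dMem_pair {D : Predilator S} {X : LinOrd S} {n e σ : M} (he : IsSeq n e) :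
    DMem D X (pair e σ) ↔ IncSeq X n e ∧ D.el n σ ∧ ∀ i, i < n → D.supp n σ i := by
  constructor
  · rintro ⟨n', e', σ', h, h1, h2⟩
    obtain ⟨rfl, rfl⟩ := pair_inj.1 h
    rw [he.len_unique h1.1]
    exact ⟨h1, h2⟩
  · exact fun h => ⟨n, e, σ, rfl, h⟩

theorem dSupp_pair {e σ x : M} : DSupp (pair e σ) x ↔ Rng e x := by
  constructor
  · rintro ⟨e', σ', i, h, h1⟩
    obtain ⟨rfl, rfl⟩ := pair_inj.1 h
    exact ⟨i, h1⟩
  · exact fun ⟨i, h⟩ => ⟨e, σ, i, rfl, h⟩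

theorem IncSeq.mor_ext {X : LinOrd S} {k d n f f' : M} (hd : IncSeq X k d) (hf : Mor n k f)
    (hf' : Mor n k f') (h : ∀ i, i < n → ent d (ent f i) = ent d (ent f' i)) : f = f' :=
  hf.1.ext S hf'.1 fun i hi => hd.inj (hf.lt S hi) (hf'.lt S hi) (h i hi)

/-- Elements of `D(X)` may be compared in any finite suborder that contains their supports. -/
theorem dLt_iff {D : Predilator S} {X : LinOrd S} {k d n f n' f' σ σ' ρ ρ' : M}
    (hd : IncSeq X k d) (hf : Mor n k f) (hf' : Mor n' k f')
    (hσ : DMem D X (pair (compSeq d f n) σ)) (hσ' : DMem D X (pair (compSeq d f' n') σ'))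
    (hρ : D.map k f σ ρ) (hρ' : D.map k f' σ' ρ') :
    DLt D X (pair (compSeq d f n) σ) (pair (compSeq d f' n') σ') ↔ D.lt k ρ ρ' := by
  constructor
  · rintro ⟨-, -, e₂, σ₂, e₂', σ₂', k₂, d₂, n₂, f₂, n₂', f₂', ρ₂, ρ₂', h1, h1', hd₂, hf₂, he₂, hf₂',
      he₂', hρ₂, hρ₂', hlt⟩
    obtain ⟨rfl, rfl⟩ := pair_inj.1 h1
    obtain ⟨rfl, rfl⟩ := pair_inj.1 h1'
    obtain ⟨rfl, h2⟩ := he₂.eq_compSeq S hf₂ hd₂.1 (isSeq_compSeq S _ _ _)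
    obtain ⟨rfl, h2'⟩ := he₂'.eq_compSeq S hf₂' hd₂.1 (isSeq_compSeq S _ _ _)
    -- The suborder d₂ on which the given comparison is based need not be d, so both are embedded
    -- into their union.
    obtain ⟨K, u, hu, hrng⟩ := hd.exists_union hd₂
    obtain ⟨g, hg, hgd⟩ := hu.factor hd fun y h => (hrng y).2 (Or.inl h)
    obtain ⟨g₂, hg₂, hgd₂⟩ := hu.factor hd₂ fun y h => (hrng y).2 (Or.inr h)
    -- By functoriality the versions of an element over d and over d₂ have the same image r over the
    -- union, since the two composite embeddings coincide. As embeddings preserve and reflect the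
    -- order, the comparisons agree.
    have key : ∀ {n f f₂ σ ρ ρ₂}, Mor n k f → Mor n k₂ f₂ →
        compSeq d f n = compSeq d₂ f₂ n → D.map k f σ ρ → D.map k₂ f₂ σ ρ₂ →
        ∃ r, D.map K g ρ r ∧ D.map K g₂ ρ₂ r := by
      intro n f f₂ σ ρ ρ₂ hf hf₂ heq hρ hρ₂
      obtain ⟨r, hr, -⟩ := D.map_exists_unique k K g ρ hg (D.el_of_map hf hρ).2
      obtain ⟨r₂, hr₂, -⟩ := D.map_exists_unique k₂ K g₂ ρ₂ hg₂ (D.el_of_map hf₂ hρ₂).2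
      have e1 : compSeq g f n = compSeq g₂ f₂ n := by
        refine hu.mor_ext (hg.comp S hf) (hg₂.comp S hf₂) fun i hi => ?_
        rw [ent_compSeq S hi, ent_compSeq S hi, hgd _ (hf.lt S hi), hgd₂ _ (hf₂.lt S hi),
          ← ent_compSeq S hi, ← ent_compSeq S hi, heq]
      have m1 := D.map_comp _ _ _ _ _ _ _ _ _ hf hg (hg.comp S hf) (isComp_compSeq S hf hg.1) hρ hr
      have m2 := D.map_comp _ _ _ _ _ _ _ _ _ hf₂ hg₂ (hg₂.comp S hf₂)
        (isComp_compSeq S hf₂ hg₂.1) hρ₂ hr₂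
      rw [← e1] at m2
      rw [← D.map_unique (hg.comp S hf) m1 m2] at hr₂
      exact ⟨r, hr, hr₂⟩
    obtain ⟨r, hr, hr₂⟩ := key hf hf₂ h2 hρ hρ₂
    obtain ⟨r', hr', hr₂'⟩ := key hf' hf₂' h2' hρ' hρ₂'
    rw [← D.map_lt_iff hg hr hr', D.map_lt_iff hg₂ hr₂ hr₂']
    exact hlt
  · exact fun h => ⟨hσ, hσ', _, _, _, _, k, d, n, f, n', f', ρ, ρ', rfl, rfl, hd, hf,
      isComp_compSeq S hf hd.1, hf', isComp_compSeq S hf' hd.1, hρ, hρ', h⟩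

theorem DMem.factor {D : Predilator S} {X : LinOrd S} {k d τ : M} (hτ : DMem D X τ)
    (hd : IncSeq X k d) (h : ∀ y, DSupp τ y → Rng d y) : ∃ n f σ, Mor n k f ∧ D.el n σ ∧
      (∀ i, i < n → D.supp n σ i) ∧ τ = pair (compSeq d f n) σ := by
  obtain ⟨n, e, σ, rfl, he, h1, h2⟩ := hτ
  obtain ⟨f, hf, hfe⟩ := hd.factor he fun y hy => h y (dSupp_pair.2 hy)
  refine ⟨n, f, σ, hf, h1, h2, ?_⟩
  rw [he.1.ext S (isSeq_compSeq S d f n) fun i hi => by rw [ent_compSeq S hi, hfe i hi]]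

/-- Two elements of `D(X)` have their supports in a common finite suborder. -/
theorem DMem.factor₂ {D : Predilator S} {X : LinOrd S} {τ τ' : M} (hτ : DMem D X τ)
    (hτ' : DMem D X τ') : ∃ k d n f σ n' f' σ' ρ ρ', IncSeq X k d ∧ Mor n k f ∧ Mor n' k f' ∧
      τ = pair (compSeq d f n) σ ∧ τ' = pair (compSeq d f' n') σ' ∧
      D.map k f σ ρ ∧ D.map k f' σ' ρ' := by
  obtain ⟨n, e, σ, rfl, he, h1, h2⟩ := id hτ
  obtain ⟨n', e', σ', rfl, he', h1', h2'⟩ := id hτ'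
  obtain ⟨k, d, hd, hrng⟩ := he.exists_union he'
  obtain ⟨n, f, σ, hf, hel, -, h⟩ :=
    hτ.factor hd fun y hy => (hrng y).2 (Or.inl (dSupp_pair.1 hy))
  obtain ⟨n', f', σ', hf', hel', -, h'⟩ :=
    hτ'.factor hd fun y hy => (hrng y).2 (Or.inr (dSupp_pair.1 hy))
  obtain ⟨ρ, hρ, -⟩ := D.map_exists_unique _ _ _ _ hf hel
  obtain ⟨ρ', hρ', -⟩ := D.map_exists_unique _ _ _ _ hf' hel'
  exact ⟨k, d, n, f, σ, n', f', σ', ρ, ρ', hd, hf, hf', h, h', hρ, hρ'⟩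

theorem DLt.asymm {D : Predilator S} {X : LinOrd S} {τ τ' : M} (h : DLt D X τ τ') :
    ¬ DLt D X τ' τ := by
  intro h'
  have hτ := h.1
  have hτ' := h.2.1
  obtain ⟨k, d, n, f, σ, n', f', σ', ρ, ρ', hd, hf, hf', rfl, rfl, hρ, hρ'⟩ := hτ.factor₂ hτ'
  rw [dLt_iff hd hf hf' hτ hτ' hρ hρ'] at h
  rw [dLt_iff hd hf' hf hτ' hτ hρ' hρ] at h'
  exact D.lt_irrefl _ _ (D.lt_trans _ _ _ _ h h')

theorem DLt.irrefl {D : Predilator S} {X : LinOrd S} {τ : M} : ¬ DLt D X τ τ :=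
  fun h => h.asymm h

theorem dMem_compSeq {D : Predilator S} {X : LinOrd S} {k d n f σ : M}
    (hd : IncSeq X k d) (hf : Mor n k f) (hσ : D.el n σ) (hs : ∀ i, i < n → D.supp n σ i) :
    DMem D X (pair (compSeq d f n) σ) :=
  ⟨n, _, σ, rfl, hd.comp hf, hσ, hs⟩

/-- The comparison in `D(X)` only depends on the relative position of the supports. -/
theorem dLt_congr {D : Predilator S} {X Y : LinOrd S} {k d d' n f n' f' σ σ' : M}
    (hd : IncSeq X k d) (hd' : IncSeq Y k d') (hf : Mor n k f) (hf' : Mor n' k f')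
    (hσ : DMem D X (pair (compSeq d f n) σ)) (hσ' : DMem D X (pair (compSeq d f' n') σ')) :
    DLt D X (pair (compSeq d f n) σ) (pair (compSeq d f' n') σ') ↔
      DLt D Y (pair (compSeq d' f n) σ) (pair (compSeq d' f' n') σ') := by
  have h1 := ((dMem_pair (isSeq_compSeq S d f n)).1 hσ).2
  have h2 := ((dMem_pair (isSeq_compSeq S d f' n')).1 hσ').2
  obtain ⟨ρ, hρ, -⟩ := D.map_exists_unique _ _ _ _ hf h1.1
  obtain ⟨ρ', hρ', -⟩ := D.map_exists_unique _ _ _ _ hf' h2.1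
  rw [dLt_iff hd hf hf' hσ hσ' hρ hρ',
    dLt_iff hd' hf hf' (dMem_compSeq hd' hf h1.1 h1.2) (dMem_compSeq hd' hf' h2.1 h2.2) hρ hρ']

end

/-! ### Fixed points, closed sets and descending chains -/

section

variable {M : Type u} [CommSemiring M] [LinearOrder M] [NatLike M]
variable {S : Set (Set M)} [hM : Model S] {α : Type u} [Code M α]

/-- A relation that is functional on a decidable domain gives rise to a computable function. -/
theorem exists_fun_of_graph {A : α → Prop} (hA : Dec S A) {R : α → M → Prop}
    (hR : Sig S fun q : α × M => R q.1 q.2) (hex : ∀ x, A x → ∃ y, R x y)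
    (huniq : ∀ x, A x → ∀ y y', R x y → R x y' → y = y') :
    ∃ f : α → M, Comp S f ∧ ∀ x, A x → R x (f x) := by
  classical
  choose! f hf using hex
  refine ⟨fun x => if A x then f x else 0, Comp.of_sig (Sig.congr
    (P := fun q : α × M => (A q.1 ∧ R q.1 q.2) ∨ (¬ A q.1 ∧ q.2 = 0)) ?_ ?_), fun x hx => ?_⟩
  · have h1 : Dec S fun q : α × M => A q.1 := hA.comp_of .fst'
    exact (h1.sig.and hR).or (h1.not.sig.and (Dec.eq .snd' (.const 0)).sig)
  · rintro ⟨x, y⟩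
    by_cases hx : A x
    · simp only [hx, true_and, not_true, false_and, or_false]
      exact ⟨fun h => h ▸ hf x hx, fun h => huniq x hx _ _ (hf x hx) h⟩
    · simp only [hx, false_and, not_false_eq_true, true_and, false_or]
      exact eq_comm
  · simp only [if_pos hx]
    exact hf x hx

/-- Finite unions of finite sets. -/
theorem exists_biUnion {X : LinOrd S} {L H : M → M} (hL : Comp S L) (hH : Comp S H) (n : M)
    (h : ∀ i, i < n → IncSeq X (L i) (H i)) :
    ∃ k u, IncSeq X k u ∧ ∀ y, Rng u y ↔ ∃ i, i < n ∧ Rng (H i) y := by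
  have i1 := IComp.fun₁ hL
  have i2 := IComp.fun₁ hH
  have : IComp S L := ⟨hL⟩
  have : IComp S H := ⟨hH⟩
  have key : ∀ j, j ≤ n → ∃ k u, IncSeq X k u ∧ (∀ i, i < j → ∀ l, l < L i → Rng u (ent (H i) l)) ∧
      ∀ l, l < k → ∃ i, i < j ∧ Rng (H i) (ent u l) := by
    refine sig_induction S (by exact sig) (fun _ => ?_) fun j ih hj => ?_
    · obtain ⟨e, he⟩ := exists_empty X
      exact ⟨0, e, he, fun i hi => absurd hi not_lt_zero, fun l hl => absurd hl not_lt_zero⟩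
    · obtain ⟨k, u, hu, h1, h2⟩ := ih (le_self_add.trans hj)
      have hHj := h j (succ_le.1 hj)
      obtain ⟨k', u', hu', hr⟩ := hu.exists_union hHj
      refine ⟨k', u', hu', fun i hi l hl => (hr _).2 ?_, fun l hl => ?_⟩
      · rcases (lt_succ.1 hi).lt_or_eq with hi | rfl
        · exact Or.inl (h1 i hi l hl)
        · exact Or.inr ((hHj.1.rng_iff S).2 ⟨l, hl, rfl⟩)
      · rcases (hr _).1 ((hu'.1.rng_iff S).2 ⟨l, hl, rfl⟩) with h3 | h3
        · obtain ⟨l', hl', h4⟩ := (hu.1.rng_iff S).1 h3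
          obtain ⟨i, hi, h5⟩ := h2 l' hl'
          exact ⟨i, hi.trans (lt_add_one j), h4 ▸ h5⟩
        · exact ⟨j, lt_add_one j, h3⟩
  obtain ⟨k, u, hu, h1, h2⟩ := key n le_rfl
  refine ⟨k, u, hu, fun y => ⟨fun hy => ?_, fun ⟨i, hi, hy⟩ => ?_⟩⟩
  · obtain ⟨l, hl, rfl⟩ := (hu.1.rng_iff S).1 hy
    exact h2 l hl
  · obtain ⟨l, hl, rfl⟩ := ((h i hi).1.rng_iff S).1 hy
    exact h1 i hi l hl

/-! ### Fixed points -/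

namespace WfOneFixedPoint

variable {D : Predilator S} (P : WfOneFixedPoint D)

theorem dec_π : Dec S fun q : M × M => P.π q.1 q.2 := inS2_iff.1 P.π_fun.1

instance {f g : α → M} [IComp S f] [IComp S g] : IDec S fun x => P.π (f x) (g x) :=
  ⟨P.dec_π.rel₂ comp comp⟩

theorem π_dMem {x τ : M} (h : P.π x τ) : DMem D P.X τ := (P.π_fun.2.1 _ _ h).2

theorem π_dom {x τ : M} (h : P.π x τ) : x ∈ P.X.dom := (P.π_fun.2.1 _ _ h).1

theorem π_unique {x τ τ' : M} (h : P.π x τ) (h' : P.π x τ') : τ = τ' :=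
  (P.π_fun.2.2 x (P.π_dom h)).unique h h'

theorem exists_fun : ∃ L E C : M → M, Comp S L ∧ Comp S E ∧ Comp S C ∧ ∀ x, x ∈ P.X.dom →
    P.π x (pair (E x) (C x)) ∧ IsSeq (L x) (E x) := by
  have hA : Dec S fun x : M => x ∈ P.X.dom := .mem P.X.dom_mem .id
  have hex : ∀ x, x ∈ P.X.dom → ∃ n e σ, P.π x (pair e σ) ∧ IsSeq n e := fun x hx => by
    obtain ⟨τ, hτ, -⟩ := P.π_fun.2.2 x hx
    obtain ⟨n, e, σ, rfl, he, -⟩ := P.π_dMem hτ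
    exact ⟨n, e, σ, hτ, he.1⟩
  obtain ⟨E, hE, hE'⟩ := exists_fun_of_graph hA
    (R := fun x e => ∃ n σ, P.π x (pair e σ) ∧ IsSeq n e) sig
    (fun x hx => let ⟨n, e, σ, h⟩ := hex x hx; ⟨e, n, σ, h⟩)
    fun x _ y y' ⟨_, _, h, _⟩ ⟨_, _, h', _⟩ => (pair_inj.1 (P.π_unique h h')).1
  have i1 := IComp.fun₁ hE
  have : IComp S E := ⟨hE⟩
  obtain ⟨C, hC, hC'⟩ := exists_fun_of_graph hA
    (R := fun x σ => P.π x (pair (E x) σ)) (by exact sig)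
    (fun x hx => let ⟨_, σ, h, _⟩ := hE' x hx; ⟨σ, h⟩)
    fun x _ y y' h h' => (pair_inj.1 (P.π_unique h h')).2
  obtain ⟨L, hL, hL'⟩ := exists_fun_of_graph hA
    (R := fun x n => IsSeq n (E x)) (by exact sig)
    (fun x hx => let ⟨n, _, _, h⟩ := hE' x hx; ⟨n, h⟩) fun x _ y y' h h' => h.len_unique h'
  exact ⟨L, E, C, hL, hE, hC, fun x hx => ⟨hC' x hx, hL' x hx⟩⟩

/-- The cardinality of the support of `π x`. -/
noncomputable def len : M → M := P.exists_fun.choose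

/-- The enumeration of the support of `π x`. -/
noncomputable def enum : M → M := P.exists_fun.choose_spec.choose

/-- The second component of `π x`. -/
noncomputable def trace : M → M := P.exists_fun.choose_spec.choose_spec.choose

theorem comp_len : Comp S P.len := P.exists_fun.choose_spec.choose_spec.choose_spec.1
theorem comp_enum : Comp S P.enum := P.exists_fun.choose_spec.choose_spec.choose_spec.2.1
theorem comp_trace : Comp S P.trace := P.exists_fun.choose_spec.choose_spec.choose_spec.2.2.1

instance {f : α → M} [hf : IComp S f] : IComp S fun x => P.len (f x) :=
  ⟨P.comp_len.comp_of hf.out⟩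
instance {f : α → M} [hf : IComp S f] : IComp S fun x => P.enum (f x) :=
  ⟨P.comp_enum.comp_of hf.out⟩
instance {f : α → M} [hf : IComp S f] : IComp S fun x => P.trace (f x) :=
  ⟨P.comp_trace.comp_of hf.out⟩

theorem π_pair {x : M} (hx : x ∈ P.X.dom) : P.π x (pair (P.enum x) (P.trace x)) :=
  (P.exists_fun.choose_spec.choose_spec.choose_spec.2.2.2 x hx).1

theorem isSeq_enum {x : M} (hx : x ∈ P.X.dom) : IsSeq (P.len x) (P.enum x) :=
  (P.exists_fun.choose_spec.choose_spec.choose_spec.2.2.2 x hx).2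

theorem π_iff {x τ : M} (hx : x ∈ P.X.dom) : P.π x τ ↔ τ = pair (P.enum x) (P.trace x) :=
  ⟨fun h => P.π_unique h (P.π_pair hx), fun h => h ▸ P.π_pair hx⟩

theorem enum_spec {x : M} (hx : x ∈ P.X.dom) : IncSeq P.X (P.len x) (P.enum x) ∧
    D.el (P.len x) (P.trace x) ∧ ∀ i, i < P.len x → D.supp (P.len x) (P.trace x) i :=
  (dMem_pair (P.isSeq_enum hx)).1 (P.π_dMem (P.π_pair hx))

theorem ent_enum_mem {x i : M} (hx : x ∈ P.X.dom) (hi : i < P.len x) :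
    ent (P.enum x) i ∈ P.X.dom := (P.enum_spec hx).1.mem_dom hi

theorem rng_enum {x s : M} (hx : x ∈ P.X.dom) :
    Rng (P.enum x) s ↔ ∃ i, i < P.len x ∧ ent (P.enum x) i = s := (P.isSeq_enum hx).rng_iff S

theorem rng_enum_mem {x s : M} (hx : x ∈ P.X.dom) (h : Rng (P.enum x) s) : s ∈ P.X.dom := by
  obtain ⟨i, hi, rfl⟩ := (P.rng_enum hx).1 h
  exact P.ent_enum_mem hx hi

/-- The range condition gives π s < π x for s in the support of π x, and π reflects the order. In
increasing enumerations supports therefore come before the elements that they support, which is what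
allows recursion along closed sets. -/
theorem lt_of_rng {x s : M} (hx : x ∈ P.X.dom) (h : Rng (P.enum x) s) : P.X.lt s x := by
  have hs := P.rng_enum_mem hx h
  have h1 := (P.range _ (P.π_dMem (P.π_pair hx))).1 ⟨x, P.π_pair hx⟩ s (dSupp_pair.2 h) _ (P.π_pair hs)
  rcases P.X.total _ hs _ hx with h2 | rfl | h2
  · exact h2
  · exact (h1.irrefl).elim
  · exact (h1.asymm (P.π_lt _ _ _ _ h2 (P.π_pair hx) (P.π_pair hs))).elim

theorem lt_of_π_lt {x y σ τ : M} (hx : P.π x σ) (hy : P.π y τ) (h : DLt D P.X σ τ) : P.X.lt x y := by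
  rcases P.X.total _ (P.π_dom hx) _ (P.π_dom hy) with h2 | rfl | h2
  · exact h2
  · rw [P.π_unique hx hy] at h; exact h.irrefl.elim
  · exact (h.asymm (P.π_lt _ _ _ _ h2 hy hx)).elim

theorem π_inj {x y τ : M} (hx : P.π x τ) (hy : P.π y τ) : x = y := by
  rcases P.X.total _ (P.π_dom hx) _ (P.π_dom hy) with h2 | h2 | h2
  · exact (P.π_lt _ _ _ _ h2 hx hy).irrefl.elim
  · exact h2
  · exact (P.π_lt _ _ _ _ h2 hy hx).irrefl.elim

/-- Finite sets that contain the supports of their elements. -/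
def Closed (n e : M) : Prop := IncSeq P.X n e ∧ ∀ i, i < n → ∀ j, j < P.len (ent e i) →
  Rng e (ent (P.enum (ent e i)) j)

theorem closed_iff {n e : M} : P.Closed n e ↔ IncSeq P.X n e ∧
    ∀ x, Rng e x → ∀ s, Rng (P.enum x) s → Rng e s := by
  refine and_congr_right fun he => ⟨fun h x hx s hs => ?_, fun h i hi j hj => ?_⟩
  · obtain ⟨i, hi, rfl⟩ := (he.1.rng_iff S).1 hx
    obtain ⟨j, hj, rfl⟩ := (P.rng_enum (he.mem_dom hi)).1 hs
    exact h i hi j hj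
  · exact h _ ((he.1.rng_iff S).2 ⟨i, hi, rfl⟩) _
      ((P.rng_enum (he.mem_dom hi)).2 ⟨j, hj, rfl⟩)

/-- `c` describes a sequence of `h` steps from `x` to `z` that descends with respect to `◁`. -/
def Chain (x h c z : M) : Prop := ent c 0 = x ∧ ent c h = z ∧
  ∀ i, i < h → Rng (P.enum (ent c i)) (ent c (i + 1))

instance {f g h k : α → M} [IComp S f] [IComp S g] [IComp S h] [IComp S k] :
    IDec S fun x => P.Chain (f x) (g x) (h x) (k x) := by
  have h1 : Dec S fun p : M × M × M × M => P.Chain p.1 p.2.1 p.2.2.1 p.2.2.2 :=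
    dec (P := fun p : M × M × M × M => ent p.2.2.1 0 = p.1 ∧ ent p.2.2.1 p.2.1 = p.2.2.2 ∧
      ∀ i, i < p.2.1 → Rng (P.enum (ent p.2.2.1 i)) (ent p.2.2.1 (i + 1)))
  exact ⟨h1.rel₄ comp comp comp comp⟩

variable {P}

theorem Chain.snoc {x h c z w : M} (hc : P.Chain x h c z) (hw : Rng (P.enum z) w) :
    P.Chain x (h + 1) (SOA.snoc c (h + 1) w) w := by
  have h1 : ∀ i, i ≤ h → SOA.ent (SOA.snoc c (h + 1) w) i = SOA.ent c i := fun i hi =>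
    ent_snoc_of_lt S (lt_succ.2 hi)
  refine ⟨(h1 0 zero_le).trans hc.1, ent_snoc_last S _ _ _, fun i hi => ?_⟩
  rw [h1 i (lt_succ.1 hi)]
  rcases (lt_succ.1 hi).lt_or_eq with hi | rfl
  · rw [h1 _ (succ_le.2 hi)]; exact hc.2.2 i hi
  · rw [ent_snoc_last S, hc.2.1]; exact hw

theorem Chain.mem_dom {x h c z : M} (hc : P.Chain x h c z) (hx : x ∈ P.X.dom) :
    ∀ i, i ≤ h → ent c i ∈ P.X.dom := by
  refine dec_induction S (by exact dec) (fun _ => by rwa [hc.1]) fun i ih hi => ?_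
  exact P.rng_enum_mem (ih (le_self_add.trans hi)) (hc.2.2 i (succ_le.1 hi))

variable (P)

/-- Starting from x, supports are adjoined h times. An element of the resulting finite set whose
support is not yet contained in it can only have appeared at the last stage, and is then the end of
a chain of h steps. In the induction step, old elements have their supports adjoined. A new element
must come from an element at the end of a chain, which it prolongs. -/
theorem closed_or_chain {x : M} (hx : x ∈ P.X.dom) (h : M) : ∃ n e, IncSeq P.X n e ∧ Rng e x ∧
    ∀ i, i < n → (∀ j, j < P.len (ent e i) → Rng e (ent (P.enum (ent e i)) j)) ∨
      ∃ c, P.Chain x h c (ent e i) := by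
  refine sig_induction S (P := fun h => ∃ n e, IncSeq P.X n e ∧ Rng e x ∧ ∀ i, i < n →
    (∀ j, j < P.len (ent e i) → Rng e (ent (P.enum (ent e i)) j)) ∨ ∃ c, P.Chain x h c (ent e i))
    (by exact sig) ?_ ?_ h
  · obtain ⟨e₀, he₀⟩ := exists_empty P.X
    obtain ⟨n, e, he, hr⟩ := he₀.exists_insert hx
    refine ⟨n, e, he, (hr x).2 (Or.inr rfl), fun i hi => Or.inr ?_⟩
    have h1 : ent e i = x := by
      refine ((hr _).1 ((he.1.rng_iff S).2 ⟨i, hi, rfl⟩)).resolve_left fun h2 => ?_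
      obtain ⟨j, hj, -⟩ := (he₀.1.rng_iff S).1 h2
      exact not_lt_zero hj
    exact ⟨mkSeq (fun _ => x) 1, ent_mkSeq (S := S) comp zero_lt_one,
      (ent_mkSeq (S := S) comp zero_lt_one).trans h1.symm, fun i hi => absurd hi not_lt_zero⟩
  · rintro h ⟨n, e, he, hxe, hc⟩
    obtain ⟨m, d, hd, hr⟩ := exists_biUnion (X := P.X) (L := fun i => P.len (ent e i))
      (H := fun i => P.enum (ent e i)) comp comp n fun i hi => (P.enum_spec (he.mem_dom hi)).1
    obtain ⟨k, u, hu, hr'⟩ := he.exists_union hd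
    refine ⟨k, u, hu, (hr' x).2 (Or.inl hxe), fun i hi => ?_⟩
    have old : ∀ z, Rng e z → ∀ j, j < P.len z → Rng u (ent (P.enum z) j) := fun z hz j hj => by
      obtain ⟨i, hi, rfl⟩ := (he.1.rng_iff S).1 hz
      exact (hr' _).2 (Or.inr ((hr _).2
        ⟨i, hi, (P.rng_enum (he.mem_dom hi)).2 ⟨j, hj, rfl⟩⟩))
    rcases (hr' _).1 ((hu.1.rng_iff S).2 ⟨i, hi, rfl⟩) with h1 | h1
    · exact Or.inl (old _ h1)
    · obtain ⟨i', hi', h2⟩ := (hr _).1 h1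
      rcases hc i' hi' with h3 | ⟨c, h3⟩
      · obtain ⟨j, hj, h4⟩ := (P.rng_enum (he.mem_dom hi')).1 h2
        exact Or.inl (old _ (h4 ▸ h3 j hj))
      · exact Or.inr ⟨_, h3.snoc h2⟩

end WfOneFixedPoint

end

/-! ### Finite closed sets from weak König's lemma -/

section

variable {M : Type u} [CommSemiring M] [LinearOrder M] [NatLike M]
variable {S : Set (Set M)} [hM : Model S] {α : Type u} [Code M α]

namespace WfOneFixedPoint

variable {D : Predilator S} (P : WfOneFixedPoint D)

/-- The restriction of `g` to arguments below `k` looks like the characteristic function of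
the graph of a sequence that starts at `x` and descends with respect to `◁`. -/
def Descent (x k : M) (g : M → M) : Prop :=
  (∀ p, p < k → g p = 0 ∨ g p = 1) ∧
  (∀ p, p < k → g p = 1 → ∃ i, i ≤ p ∧ ∃ z, z ≤ p ∧ p = pair i z ∧ z ∈ P.X.dom) ∧
  (pair 0 x < k → g (pair 0 x) = 1) ∧
  (∀ p, p < k → g p = 1 → ∀ q, q < k → g q = 1 → ∀ i, i ≤ p → ∀ z, z ≤ p → ∀ z', z' ≤ q →
    p = pair i z → q = pair i z' → z = z') ∧
  ∀ p, p < k → g p = 1 → ∀ i, i ≤ p → ∀ z, z ≤ p → p = pair i z →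
    (∀ j, j < P.len z → pair (i + 1) (ent (P.enum z) j) < k) →
    ∃ j, j < P.len z ∧ g (pair (i + 1) (ent (P.enum z) j)) = 1

variable {P}

/-- Every clause of `Descent` speaks only about numbers below k. In particular a successor is
demanded only when all candidates for it are below k; without this proviso restrictions could fail
the condition and there would be no tree. -/
theorem Descent.mono {x k j : M} {g g' : M → M} (h : P.Descent x k g) (hj : j ≤ k)
    (hg : ∀ p, p < j → g' p = g p) : P.Descent x j g' := by
  obtain ⟨h1, h2, h3, h4, h5⟩ := h
  refine ⟨fun p hp => ?_, fun p hp => ?_, fun hp => ?_, fun p hp hp1 q hq hq1 => ?_,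
    fun p hp hp1 i hi z hz hpz hb => ?_⟩
  · rw [hg p hp]; exact h1 p (hp.trans_le hj)
  · rw [hg p hp]; exact h2 p (hp.trans_le hj)
  · rw [hg _ hp]; exact h3 (hp.trans_le hj)
  · rw [hg p hp] at hp1
    rw [hg q hq] at hq1
    exact h4 p (hp.trans_le hj) hp1 q (hq.trans_le hj) hq1
  · rw [hg p hp] at hp1
    obtain ⟨l, hl, h6⟩ := h5 p (hp.trans_le hj) hp1 i hi z hz hpz fun l hl => (hb l hl).trans_le hj
    exact ⟨l, hl, (hg _ (hb l hl)).trans h6⟩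

variable (P)

/-- The tree of attempts to build a sequence that starts at `x` and descends with respect to `◁`. -/
def descentTree (x : M) : Set M := {s | ∃ k, k ≤ s ∧ IsSeq k s ∧ P.Descent x k (ent s)}

theorem descentTree_mem (x : M) : P.descentTree x ∈ S := by
  refine dec_set_iff.1 ?_
  unfold Descent
  exact dec

theorem mem_descentTree {x k s : M} (hs : IsSeq k s) :
    s ∈ P.descentTree x ↔ P.Descent x k (ent s) := by
  constructor
  · rintro ⟨k', -, h, h'⟩
    rwa [hs.len_unique h]
  · exact fun h => ⟨k, hs.len_le, hs, h⟩

theorem isBinaryTree_descentTree (x : M) : IsBinaryTree (P.descentTree x) := by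
  constructor
  · rintro s ⟨k, -, hs, h, -⟩
    refine ⟨⟨k, hs⟩, fun i y hy => ?_⟩
    obtain ⟨hi, rfl⟩ := (hs.entry_iff S).1 hy
    exact h i hi
  · intro s hsT k hs j hj s' hs' hsub
    refine (P.mem_descentTree hs').2 (((P.mem_descentTree hs).1 hsT).mono hj.le fun p hp => ?_)
    exact ((hsub p _ ((hs'.entry_iff S).2 ⟨hp, rfl⟩)).ent_eq).symm

/-- The characteristic function of the graph of the chain works. A pair (i, z) with code below k has
i < k, so the chain does provide a successor at i. -/
theorem descent_of_chain {x k c z : M} (hx : x ∈ P.X.dom) (hc : P.Chain x k c z) :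
    ∃ g : M → M, Comp S g ∧ P.Descent x k g := by
  classical
  let A : M → Prop := fun p => ∃ i, i ≤ p ∧ ∃ z, z ≤ p ∧ p = pair i z ∧ i ≤ k ∧ z = ent c i
  have hA : ∀ i z, A (pair i z) ↔ i ≤ k ∧ z = ent c i := fun i z => by
    constructor
    · rintro ⟨i', -, z', -, h, h'⟩
      obtain ⟨rfl, rfl⟩ := pair_inj.1 h
      exact h'
    · exact fun h => ⟨i, le_pair_left _ _, z, le_pair_right _ _, rfl, h⟩
  have hdA : Dec S A := dec
  let g : M → M := fun p => if A p then 1 else 0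
  have hg : Comp S g := by
    have : IDec S A := ⟨hdA⟩
    exact SOA.comp (f := fun p => if A p then 1 else 0)
  have hg1 : ∀ p, g p = 1 ↔ A p := fun p => by
    simp only [g]
    split_ifs with h <;> simp [h]
  refine ⟨g, hg, fun p _ => ?_, fun p _ h => ?_, fun _ => ?_, ?_, ?_⟩
  · simp only [g]
    split_ifs <;> simp
  · obtain ⟨i, hi, z, hz, rfl, hik, rfl⟩ := (hg1 p).1 h
    exact ⟨i, hi, _, hz, rfl, hc.mem_dom hx i hik⟩
  · exact (hg1 _).2 ((hA _ _).2 ⟨zero_le, hc.1.symm⟩)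
  · rintro p - hp q - hq i - z - z' - rfl rfl
    rw [((hA _ _).1 ((hg1 _).1 hp)).2, ((hA _ _).1 ((hg1 _).1 hq)).2]
  · rintro p hp hp1 i - z - rfl -
    have h1 := ((hA _ _).1 ((hg1 _).1 hp1)).2
    have hi : i < k := (le_pair_left i z).trans_lt hp
    have h2 := hc.2.2 i hi
    rw [← h1] at h2
    obtain ⟨j, hj, h3⟩ := (P.rng_enum (h1 ▸ hc.mem_dom hx i hi.le)).1 h2
    exact ⟨j, hj, (hg1 _).2 ((hA _ _).2 ⟨succ_le.2 hi, h3⟩)⟩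

/-- The function g is the characteristic function of a graph. With sufficiently large k the clauses
of `Descent` show that this is the graph of an infinite sequence in the model which descends with
respect to ◁. -/
theorem not_forall_descent {x : M} {g : M → M} (hg : Comp S g) : ¬ ∀ k, P.Descent x k g := by
  intro h
  have i1 := IComp.fun₁ hg
  have hdom : ∀ i z, g (pair i z) = 1 → z ∈ P.X.dom := fun i z hz => by
    obtain ⟨i', -, z', -, h1, h2⟩ := (h (pair i z + 1)).2.1 _ (lt_add_one _) hz
    rwa [(pair_inj.1 h1).2]
  have huniq : ∀ i z z', g (pair i z) = 1 → g (pair i z') = 1 → z = z' := fun i z z' hz hz' =>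
    (h (pair i z + pair i z' + 1)).2.2.2.1 _ (lt_succ.2 le_self_add) hz _ (lt_succ.2 le_add_self)
      hz' i (le_pair_left _ _) z (le_pair_right _ _) z' (le_pair_right _ _) rfl rfl
  have hsucc : ∀ i z, g (pair i z) = 1 → ∃ w, Rng (P.enum z) w ∧ g (pair (i + 1) w) = 1 := by
    intro i z hz
    have hzd := hdom i z hz
    -- Entries do not exceed the code of their sequence. With this value of k every candidate for
    -- the successor of z is therefore below k, and the last clause becomes effective.
    obtain ⟨j, hj, h1⟩ := (h (pair i z + pair (i + 1) (P.enum z) + 1)).2.2.2.2 _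
      (lt_succ.2 le_self_add) hz i (le_pair_left _ _) z (le_pair_right _ _) rfl fun j hj =>
        lt_succ.2 ((pair_mono le_rfl
          (((P.isSeq_enum hzd).entry_iff S).2 ⟨hj, rfl⟩).le).trans le_add_self)
    exact ⟨_, (P.rng_enum hzd).2 ⟨j, hj, rfl⟩, h1⟩
  have hex : ∀ i, ∃ z, g (pair i z) = 1 := by
    refine sig_induction S (by exact sig) ⟨x, (h (pair 0 x + 1)).2.2.1 (lt_add_one _)⟩ ?_
    rintro i ⟨z, hz⟩
    obtain ⟨w, -, hw⟩ := hsucc i z hz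
    exact ⟨w, hw⟩
  refine P.wf ⟨fun i z => g (pair i z) = 1, ⟨inS2_iff.2 dec, fun i z hz => ⟨trivial, hdom i z hz⟩,
    fun i _ => ?_⟩, fun i s t τ hs ht hτ => ?_⟩
  · obtain ⟨z, hz⟩ := hex i
    exact ⟨z, hz, fun z' hz' => huniq i z' z hz' hz⟩
  · obtain ⟨w, hw, hw'⟩ := hsucc i t ht
    rw [P.π_unique hτ (P.π_pair (hdom i t ht)), huniq _ _ _ hs hw']
    exact dSupp_pair.2 hw

/-- By weak König's lemma, every element of a fixed point lies in a finite closed set. -/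
theorem exists_closed (hW : WKL S) {x : M} (hx : x ∈ P.X.dom) :
    ∃ n e, P.Closed n e ∧ Rng e x := by
  by_contra hno
  -- If no chain had h steps, the second alternative in `closed_or_chain` would be void and the set
  -- found there would be closed.
  have hchain : ∀ h, ∃ c z, P.Chain x h c z := by
    intro h
    obtain ⟨n, e, he, hxe, hc⟩ := P.closed_or_chain hx h
    by_contra hh
    push Not at hh
    exact hno ⟨n, e, ⟨he, fun i hi => (hc i hi).resolve_right fun ⟨c, h1⟩ => hh _ _ h1⟩, hxe⟩
  -- The tree is infinite because chains of n + 1 steps yield members of length n + 1, whose codes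
  -- exceed n.
  obtain ⟨G, hG, hT⟩ := hW _ (P.descentTree_mem x) (P.isBinaryTree_descentTree x) fun n => by
    obtain ⟨c, z, hc⟩ := hchain (n + 1)
    obtain ⟨g, hg, hD⟩ := P.descent_of_chain hx hc
    have hs := isSeq_mkSeq hg (n + 1)
    exact ⟨_, (P.mem_descentTree hs).2 (hD.mono le_rfl fun p hp => ent_mkSeq hg hp),
      (lt_add_one n).trans_le hs.len_le⟩
  obtain ⟨g, hg, hgG⟩ := exists_fun_of_graph (A := fun _ : M => True) (.const True)
    (R := G) (inS2_iff.1 hG.1).sig (fun x _ => (hG.2.2 x trivial).exists)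
    fun x _ y y' h h' => (hG.2.2 x trivial).unique h h'
  refine P.not_forall_descent (x := x) hg fun k => ?_
  obtain ⟨c, hcT, hc, h⟩ := hT k
  exact ((P.mem_descentTree hc).1 hcT).mono le_rfl fun p hp =>
    ((h p _ hp (hgG p trivial)).ent_eq).symm

end WfOneFixedPoint

end

/-! ### Partial isomorphisms and their union -/

section

variable {M : Type u} [CommSemiring M] [LinearOrder M] [NatLike M]
variable {S : Set (Set M)} [hM : Model S] {α : Type u} [Code M α]

namespace WfOneFixedPoint

variable {D : Predilator S} (P Q : WfOneFixedPoint D)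

/-- The finite partial isomorphisms between fixed points. -/
def PartialIso (n e e' : M) : Prop := IncSeq P.X n e ∧ IncSeq Q.X n e' ∧ ∀ i, i < n →
  P.len (ent e i) = Q.len (ent e' i) ∧ P.trace (ent e i) = Q.trace (ent e' i) ∧
  ∀ j, j < P.len (ent e i) → ∃ l, l < n ∧ ent (P.enum (ent e i)) j = ent e l ∧
    ent (Q.enum (ent e' i)) j = ent e' l

instance {f g h : α → M} [IComp S f] [IComp S g] [IComp S h] :
    IDec S fun x => PartialIso P Q (f x) (g x) (h x) := by
  have h1 : Dec S fun p : M × M × M => PartialIso P Q p.1 p.2.1 p.2.2 :=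
    dec (P := fun p : M × M × M => IncSeq P.X p.1 p.2.1 ∧ IncSeq Q.X p.1 p.2.2 ∧ ∀ i, i < p.1 →
      P.len (ent p.2.1 i) = Q.len (ent p.2.2 i) ∧ P.trace (ent p.2.1 i) = Q.trace (ent p.2.2 i) ∧
      ∀ j, j < P.len (ent p.2.1 i) → ∃ l, l < p.1 ∧ ent (P.enum (ent p.2.1 i)) j = ent p.2.1 l ∧
        ent (Q.enum (ent p.2.2 i)) j = ent p.2.2 l)
  exact ⟨h1.rel₃ comp comp comp⟩

variable {P Q}

theorem PartialIso.symm {n e e' : M} (h : PartialIso P Q n e e') : PartialIso Q P n e' e := by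
  refine ⟨h.2.1, h.1, fun i hi => ?_⟩
  obtain ⟨h1, h2, h3⟩ := h.2.2 i hi
  refine ⟨h1.symm, h2.symm, fun j hj => ?_⟩
  obtain ⟨l, hl, h4, h5⟩ := h3 j (h1 ▸ hj)
  exact ⟨l, hl, h5, h4⟩

theorem PartialIso.exists_mor {n e e' i : M} (h : PartialIso P Q n e e') (hi : i < n) :
    ∃ m f, Mor m n f ∧ P.enum (ent e i) = compSeq e f m ∧ Q.enum (ent e' i) = compSeq e' f m := by
  obtain ⟨h1, -, h3⟩ := h.2.2 i hi
  have hx := h.1.mem_dom hi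
  have hy := h.2.1.mem_dom hi
  obtain ⟨f, hf, hfe⟩ := h.1.factor (P.enum_spec hx).1 fun y hy => by
    obtain ⟨j, hj, rfl⟩ := (P.rng_enum hx).1 hy
    obtain ⟨l, hl, h4, -⟩ := h3 j hj
    exact (h.1.1.rng_iff S).2 ⟨l, hl, h4.symm⟩
  refine ⟨_, f, hf, (P.isSeq_enum hx).ext S (isSeq_compSeq S _ _ _) fun j hj => ?_,
    (h1 ▸ Q.isSeq_enum hy).ext S (isSeq_compSeq S _ _ _) fun j hj => ?_⟩
  · rw [ent_compSeq S hj, hfe j hj]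
  · obtain ⟨l, hl, h4, h5⟩ := h3 j hj
    rw [ent_compSeq S hj, h5, h.1.inj (hf.lt S hj) hl ((hfe j hj).trans h4)]

/-- Transport π x along d ↦ d' to an element τ of D(Y). Since every entry of d is below x, its
π-value is below π x. Comparisons depend only on relative positions (`dLt_congr`), so the values of
the entries of d' are below τ. In particular τ satisfies the range condition and has a preimage y,
which lies above all entries of d'. -/
theorem PartialIso.extend {n d d' x : M} (h : PartialIso P Q n d d') (hx : x ∈ P.X.dom)
    (hlt : ∀ i, i < n → P.X.lt (ent d i) x) (hsub : ∀ s, Rng (P.enum x) s → Rng d s) :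
    ∃ y, PartialIso P Q (n + 1) (snoc d n x) (snoc d' n y) := by
  obtain ⟨hxi, hel, hfull⟩ := P.enum_spec hx
  obtain ⟨f, hf, hfd⟩ := h.1.factor hxi hsub
  set m := P.len x with hm
  have hxe : P.enum x = compSeq d f m :=
    hxi.1.ext S (isSeq_compSeq S _ _ _) fun j hj => by rw [ent_compSeq S hj, hfd j hj]
  have hτ := dMem_compSeq h.2.1 hf hel hfull
  have key : ∀ i, i < n → ∀ ρ, Q.π (ent d' i) ρ →
      DLt D Q.X ρ (pair (compSeq d' f m) (P.trace x)) := by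
    intro i hi ρ hρ
    have hdi := h.1.mem_dom hi
    obtain ⟨m', f', hf', he, he'⟩ := h.exists_mor hi
    have h1 := P.π_lt _ _ _ _ (hlt i hi) (P.π_pair hdi) (P.π_pair hx)
    rw [Q.π_unique hρ (Q.π_pair (h.2.1.mem_dom hi)), he', ← (h.2.2 i hi).2.1]
    rw [he, hxe] at h1
    exact (dLt_congr h.1 h.2.1 hf' hf h1.1 h1.2.1).1 h1
  obtain ⟨y, hy⟩ := (Q.range _ hτ).2 fun s hs ρ hρ => by
    obtain ⟨j, hj, rfl⟩ := ((isSeq_compSeq S d' f m).rng_iff S).1 (dSupp_pair.1 hs)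
    rw [ent_compSeq S hj] at hρ
    exact key _ (hf.lt S hj) ρ hρ
  have hyd := Q.π_dom hy
  obtain ⟨hye, hyt⟩ := pair_inj.1 ((Q.π_iff hyd).1 hy)
  have hylen : m = Q.len y := (isSeq_compSeq S d' f m).len_unique (hye ▸ Q.isSeq_enum hyd)
  refine ⟨y, h.1.snoc hx hlt, h.2.1.snoc hyd fun i hi => ?_, fun i hi => ?_⟩
  · have hdi := h.2.1.mem_dom hi
    exact Q.lt_of_π_lt (Q.π_pair hdi) hy (key i hi _ (Q.π_pair hdi))
  · rcases (lt_succ.1 hi).lt_or_eq with hi | rfl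
    · rw [ent_snoc_of_lt S hi, ent_snoc_of_lt S hi]
      obtain ⟨h1, h2, h3⟩ := h.2.2 i hi
      refine ⟨h1, h2, fun j hj => ?_⟩
      obtain ⟨l, hl, h4, h5⟩ := h3 j hj
      refine ⟨l, hl.trans (lt_add_one n), ?_⟩
      rw [ent_snoc_of_lt S hl, ent_snoc_of_lt S hl]
      exact ⟨h4, h5⟩
    · rw [ent_snoc_last S, ent_snoc_last S]
      refine ⟨hylen, hyt, fun j hj => ⟨ent f j, (hf.lt S hj).trans (lt_add_one _), ?_⟩⟩
      rw [ent_snoc_of_lt S (hf.lt S hj), ent_snoc_of_lt S (hf.lt S hj), hfd j hj, ← hye,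
        ent_compSeq S hj]
      exact ⟨rfl, rfl⟩

-- The elements of e are mapped in increasing order. When the j-th one is reached, its support is
-- contained in e by closedness and lies below it, so the images of the support have already been
-- determined.
variable (Q) in
theorem Closed.exists_partialIso {n e : M} (he : P.Closed n e) : ∃ e', PartialIso P Q n e e' := by
  have hcl := (P.closed_iff.1 he).2
  have key : ∀ j, j ≤ n → ∃ d d', PartialIso P Q j d d' ∧ ∀ i, i < j → ent d i = ent e i := by
    refine sig_induction S (by exact sig) (fun _ => ?_) fun j ih hj => ?_
    · obtain ⟨d, hd⟩ := exists_empty P.X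
      obtain ⟨d', hd'⟩ := exists_empty Q.X
      exact ⟨d, d', ⟨hd, hd', fun i hi => absurd hi not_lt_zero⟩, fun i hi => absurd hi not_lt_zero⟩
    · obtain ⟨d, d', h, hde⟩ := ih (le_self_add.trans hj)
      have hj' := succ_le.1 hj
      have hx := he.1.mem_dom hj'
      obtain ⟨y, hy⟩ := h.extend hx (fun i hi => by rw [hde i hi]; exact he.1.mono hj' hi)
        fun s hs => by
          obtain ⟨i, hi, rfl⟩ := (he.1.1.rng_iff S).1
            (hcl _ ((he.1.1.rng_iff S).2 ⟨j, hj', rfl⟩) s hs)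
          have hij := (he.1.lt_iff hi hj').1 (P.lt_of_rng hx hs)
          exact (h.1.1.rng_iff S).2 ⟨i, hij, hde i hij⟩
      refine ⟨_, _, hy, fun i hi => ?_⟩
      rcases (lt_succ.1 hi).lt_or_eq with hi | rfl
      · rw [ent_snoc_of_lt S hi, hde i hi]
      · rw [ent_snoc_last S]
  obtain ⟨d, d', h, hde⟩ := key n le_rfl
  rw [h.1.1.ext S he.1.1 hde] at h
  exact ⟨d', h⟩

theorem PartialIso.closed {n e e' : M} (h : PartialIso P Q n e e') : P.Closed n e := by
  refine ⟨h.1, fun i hi j hj => ?_⟩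
  obtain ⟨l, hl, h4, -⟩ := (h.2.2 i hi).2.2 j hj
  exact (h.1.1.rng_iff S).2 ⟨l, hl, h4.symm⟩

theorem Closed.union {n e m d : M} (he : P.Closed n e) (hd : P.Closed m d) :
    ∃ k u, P.Closed k u ∧ ∀ y, Rng u y ↔ Rng e y ∨ Rng d y := by
  obtain ⟨k, u, hu, h⟩ := he.1.exists_union hd.1
  refine ⟨k, u, P.closed_iff.2 ⟨hu, fun x hx s hs => (h s).2 ?_⟩, h⟩
  exact ((h x).1 hx).imp (fun h1 => (P.closed_iff.1 he).2 x h1 s hs)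
    fun h1 => (P.closed_iff.1 hd).2 x h1 s hs

/-- Induction on the position i: the support of an element precedes it, so the images of the support
agree. The two candidates for the image then have the same value in D(Y), and the embedding is
injective. -/
theorem PartialIso.unique {n e e' m d d' : M} (h : PartialIso P Q n e e')
    (h' : PartialIso P Q m d d') : ∀ i, i < n → ∀ j, j < m → ent e i = ent d j →
      ent e' i = ent d' j := by
  refine dec_strong_induction S (by exact dec) fun i ih hi j hj hij => ?_
  obtain ⟨h1, h2, h3⟩ := h.2.2 i hi
  obtain ⟨h1', h2', h3'⟩ := h'.2.2 j hj
  rw [← hij] at h1' h2' h3'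
  have hx := h.1.mem_dom hi
  have hy := h.2.1.mem_dom hi
  have hy' := h'.2.1.mem_dom hj
  have henum : Q.enum (ent e' i) = Q.enum (ent d' j) := by
    refine (h1 ▸ Q.isSeq_enum hy).ext S (h1' ▸ Q.isSeq_enum hy') fun l hl => ?_
    obtain ⟨a, ha, h4, h5⟩ := h3 l hl
    obtain ⟨b, hb, h4', h5'⟩ := h3' l hl
    rw [h5, h5']
    refine ih a ?_ ha b hb (h4 ▸ h4')
    exact (h.1.lt_iff ha hi).1 (P.lt_of_rng hx (h4 ▸ (P.rng_enum hx).2 ⟨l, hl, rfl⟩))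
  have h4 := Q.π_pair hy
  rw [henum, ← h2, h2'] at h4
  exact Q.π_inj h4 (Q.π_pair hy')

variable (P Q)

/-- The union of the finite partial isomorphisms. -/
def isoGraph (x y : M) : Prop := ∃ n e e' i, PartialIso P Q n e e' ∧ i < n ∧ ent e i = x ∧ ent e' i = y

variable {P Q}

theorem isoGraph.symm {x y : M} (h : isoGraph P Q x y) : isoGraph Q P y x := by
  obtain ⟨n, e, e', i, h, hi, h1, h2⟩ := h
  exact ⟨n, e', e, i, h.symm, hi, h2, h1⟩

theorem isoGraph.dom {x y : M} (h : isoGraph P Q x y) : x ∈ P.X.dom := by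
  obtain ⟨n, e, e', i, h, hi, rfl, -⟩ := h
  exact h.1.mem_dom hi

theorem isoGraph.unique {x y y' : M} (h : isoGraph P Q x y) (h' : isoGraph P Q x y') : y = y' := by
  obtain ⟨n, e, e', i, h, hi, h1, rfl⟩ := h
  obtain ⟨m, d, d', j, h', hj, h1', rfl⟩ := h'
  exact h.unique h' i hi j hj (h1.trans h1'.symm)

theorem exists_isoGraph (hW : WKL S) {x : M} (hx : x ∈ P.X.dom) : ∃ y, isoGraph P Q x y := by
  obtain ⟨n, e, he, hxe⟩ := P.exists_closed hW hx
  obtain ⟨e', h⟩ := he.exists_partialIso Q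
  obtain ⟨i, hi, rfl⟩ := (he.1.1.rng_iff S).1 hxe
  exact ⟨_, n, e, e', i, h, hi, rfl, rfl⟩

/-- The two elements lie in a common closed set. Its partial isomorphism is increasing, and agrees
with the given ones by uniqueness. -/
theorem isoGraph.lt {x y x' y' : M} (h : isoGraph P Q x y) (h' : isoGraph P Q x' y')
    (hlt : P.X.lt x x') : Q.X.lt y y' := by
  obtain ⟨n, e, e', i, h1, hi, rfl, -⟩ := id h
  obtain ⟨m, d, d', j, h1', hj, rfl, -⟩ := id h'
  obtain ⟨k, u, hu, hr⟩ := h1.closed.union h1'.closed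
  obtain ⟨u', hu'⟩ := hu.exists_partialIso Q
  obtain ⟨a, ha, h2⟩ := (hu.1.1.rng_iff S).1 ((hr _).2 (Or.inl ((h1.1.1.rng_iff S).2 ⟨i, hi, rfl⟩)))
  obtain ⟨b, hb, h2'⟩ :=
    (hu.1.1.rng_iff S).1 ((hr _).2 (Or.inr ((h1'.1.1.rng_iff S).2 ⟨j, hj, rfl⟩)))
  have hg : ∀ c, c < k → isoGraph P Q (ent u c) (ent u' c) := fun c hc =>
    ⟨k, u, u', c, hu', hc, rfl, rfl⟩
  rw [← h2] at h hlt
  rw [← h2'] at h' hlt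
  rw [h.unique (hg a ha), h'.unique (hg b hb)]
  exact hu'.2.1.mono hb ((hu.1.lt_iff ha hb).1 hlt)

/-- Weak König's lemma implies that fixed points are unique. -/
theorem exists_iso (hW : WKL S) : ∃ F, IsFixedPointIso P Q F := by
  refine ⟨isoGraph P Q, ⟨inS2_iff.2 ?_, fun x y h => ⟨h.dom, h.symm.dom⟩, fun x hx => ?_⟩,
    fun y hy => ?_, fun x x' y y' h h' => ⟨h.lt h', h.symm.lt h'.symm⟩, fun x y τ τ' h hτ hτ' => ?_⟩
  · have hs : Sig S fun q : M × M => isoGraph P Q q.1 q.2 := by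
      unfold isoGraph; exact sig
    have i1 := ISig.rel₂ hs
    -- The union of the partial isomorphisms is Σ⁰₁. By totality, which rests on the finite closed
    -- sets, and uniqueness, a pair fails to belong to it exactly if its first component is outside
    -- the domain or has a different image. So the union is in the model.
    refine Dec.of_sig hs (Sig.congr (P := fun q : M × M => ¬ q.1 ∈ P.X.dom ∨
      ∃ y, isoGraph P Q q.1 y ∧ y ≠ q.2) (by exact sig) ?_)
    rintro ⟨x, y⟩
    constructor
    · intro h
      by_cases hx : x ∈ P.X.dom
      · obtain ⟨y', hy'⟩ := exists_isoGraph (Q := Q) hW hx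
        exact Or.inr ⟨y', hy', fun h' => h (h' ▸ hy')⟩
      · exact Or.inl hx
    · rintro (h | ⟨y', h, h'⟩) h1
      · exact h h1.dom
      · exact h' (h.unique h1)
  · obtain ⟨y, hy⟩ := exists_isoGraph (Q := Q) hW hx
    exact ⟨y, hy, fun y' hy' => hy'.unique hy⟩
  · obtain ⟨x, hx⟩ := exists_isoGraph (Q := P) hW hy
    exact ⟨x, hx.symm⟩
  · rw [(P.π_iff h.dom).1 hτ, (Q.π_iff h.symm.dom).1 hτ']
    obtain ⟨n, e, e', i, h, hi, rfl, rfl⟩ := h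
    have hx := h.1.mem_dom hi
    have hy := h.2.1.mem_dom hi
    obtain ⟨h1, h2, h3⟩ := h.2.2 i hi
    refine ⟨_, _, _, rfl, by rw [h2], fun j z => ?_⟩
    have hs := Q.isSeq_enum hy
    rw [← h1] at hs
    rw [hs.entry_iff S]
    simp only [(P.isSeq_enum hx).entry_iff S]
    constructor
    · rintro ⟨hj, rfl⟩
      obtain ⟨l, hl, h4, h5⟩ := h3 j hj
      exact ⟨_, ⟨hj, h4⟩, n, e, e', l, h, hl, rfl, h5.symm⟩
    · rintro ⟨w, ⟨hj, rfl⟩, hz⟩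
      obtain ⟨l, hl, h4, h5⟩ := h3 j hj
      refine ⟨hj, h5.trans ?_⟩
      rw [h4] at hz
      exact isoGraph.unique ⟨n, e, e', l, h, hl, rfl, rfl⟩ hz

end WfOneFixedPoint

end

/-! ### Unpairing, the orders 1 + X and lexicographic comparison -/

section

variable {M : Type u} [CommSemiring M] [LinearOrder M] [NatLike M]
variable {S : Set (Set M)} [hM : Model S] {α : Type u} [Code M α]

open Classical in
/-- The first component of a coded pair. -/
noncomputable def lf (z : M) : M := if h : ∃ a b, z = pair a b then h.choose else 0

open Classical in
/-- The second component of a coded pair. -/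
noncomputable def rt (z : M) : M := if h : ∃ b a, z = pair a b then h.choose else 0

@[simp] theorem lf_pair (a b : M) : lf (pair a b) = a := by
  have h : ∃ a' b', pair a b = pair a' b' := ⟨a, b, rfl⟩
  rw [lf, dif_pos h]
  exact (pair_inj.1 h.choose_spec.choose_spec).1.symm

@[simp] theorem rt_pair (a b : M) : rt (pair a b) = b := by
  have h : ∃ b' a', pair a b = pair a' b' := ⟨b, a, rfl⟩
  rw [rt, dif_pos h]
  exact (pair_inj.1 h.choose_spec.choose_spec).2.symm

theorem comp_lf_rt : Comp S (lf : M → M) ∧ Comp S (rt : M → M) := by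
  have hA : Dec S fun z : M => ∃ a, a ≤ z ∧ ∃ b, b ≤ z ∧ z = pair a b := dec
  have hA' : ∀ z : M, (∃ a, a ≤ z ∧ ∃ b, b ≤ z ∧ z = pair a b) ↔ ∃ a b, z = pair a b := fun z =>
    ⟨fun ⟨a, _, b, _, h⟩ => ⟨a, b, h⟩, fun ⟨a, b, h⟩ =>
      ⟨a, h ▸ le_pair_left _ _, b, h ▸ le_pair_right _ _, h⟩⟩
  constructor
  · refine Comp.of_sig (Sig.congr (P := fun q : M × M => (∃ b, q.1 = pair q.2 b) ∨
      (¬ ∃ a, a ≤ q.1 ∧ ∃ b, b ≤ q.1 ∧ q.1 = pair a b) ∧ q.2 = 0) (by exact sig) ?_)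
    rintro ⟨z, a⟩
    simp only [hA']
    by_cases h : ∃ a b, z = pair a b
    · obtain ⟨a', b', rfl⟩ := h
      simp [pair_inj]
    · have h0 : lf z = 0 := by rw [lf, dif_neg h]
      rw [h0]
      exact ⟨fun h1 => Or.inr ⟨h, h1.symm⟩, fun h1 => h1.elim (fun h2 => (h ⟨a, h2⟩).elim)
        fun h2 => h2.2.symm⟩
  · refine Comp.of_sig (Sig.congr (P := fun q : M × M => (∃ a, q.1 = pair a q.2) ∨
      (¬ ∃ a, a ≤ q.1 ∧ ∃ b, b ≤ q.1 ∧ q.1 = pair a b) ∧ q.2 = 0) (by exact sig) ?_)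
    rintro ⟨z, b⟩
    simp only [hA']
    by_cases h : ∃ a b, z = pair a b
    · obtain ⟨a', b', rfl⟩ := h
      simp [pair_inj]
    · have h0 : rt z = 0 := by rw [rt, dif_neg fun ⟨b, a, h'⟩ => h ⟨a, b, h'⟩]
      rw [h0]
      exact ⟨fun h1 => Or.inr ⟨h, h1.symm⟩, fun h1 => h1.elim (fun ⟨a, h2⟩ => (h ⟨a, b, h2⟩).elim)
        fun h2 => h2.2.symm⟩

instance IComp.lf {f : α → M} [hf : IComp S f] : IComp S fun x => lf (f x) :=
  ⟨comp_lf_rt.1.comp_of hf.out⟩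
instance IComp.rt {f : α → M} [hf : IComp S f] : IComp S fun x => rt (f x) :=
  ⟨comp_lf_rt.2.comp_of hf.out⟩
instance IComp.lf_self : IComp S (SOA.lf : M → M) := ⟨comp_lf_rt.1⟩
instance IComp.rt_self : IComp S (SOA.rt : M → M) := ⟨comp_lf_rt.2⟩

/-- A function on numbers as a function on `1 + M`, where `0` is the extra element. -/
noncomputable def up (e i : M) : M := if i = 0 then 0 else ent e (pred i) + 1

@[simp] theorem up_zero (e : M) : up e 0 = 0 := if_pos rfl

@[simp] theorem up_succ (e i : M) : up e (i + 1) = ent e i + 1 := by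
  have h : i + 1 ≠ 0 := (lt_of_le_of_lt zero_le (lt_add_one i)).ne'
  rw [up, if_neg h, pred_succ]

instance IComp.up {f g : α → M} [IComp S f] [IComp S g] : IComp S fun x => up (f x) (g x) := by
  unfold SOA.up
  infer_instance

theorem succ_ne (i : M) : i + 1 ≠ 0 := (lt_of_le_of_lt zero_le (lt_add_one i)).ne'

/-! ### The lexicographic order on triples -/

/-- The lexicographic order on `L × A × A`. -/
def Lex (l r : M → M → Prop) (t a b t' a' b' : M) : Prop :=
  l t t' ∨ t = t' ∧ (r a a' ∨ a = a' ∧ r b b')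

theorem Lex.irrefl {l r : M → M → Prop} {t a b : M} (hl : ¬ l t t) (ha : ¬ r a a) (hb : ¬ r b b) :
    ¬ Lex l r t a b t a b := by
  rintro (h | ⟨-, h | ⟨-, h⟩⟩)
  exacts [hl h, ha h, hb h]

theorem Lex.trans {l r : M → M → Prop} {t a b t' a' b' t'' a'' b'' : M}
    (h : Lex l r t a b t' a' b') (h' : Lex l r t' a' b' t'' a'' b'')
    (hl : l t t' → l t' t'' → l t t'')
    (ha : t = t' → t' = t'' → r a a' → r a' a'' → r a a'')
    (hb : t = t' → t' = t'' → r b b' → r b' b'' → r b b'') : Lex l r t a b t'' a'' b'' := by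
  rcases h with h | ⟨rfl, h⟩
  · rcases h' with h' | ⟨rfl, -⟩
    · exact Or.inl (hl h h')
    · exact Or.inl h
  · rcases h' with h' | ⟨rfl, h'⟩
    · exact Or.inl h'
    · refine Or.inr ⟨rfl, ?_⟩
      rcases h with h | ⟨rfl, h⟩
      · rcases h' with h' | ⟨rfl, -⟩
        · exact Or.inl (ha rfl rfl h h')
        · exact Or.inl h
      · rcases h' with h' | ⟨rfl, h'⟩
        · exact Or.inl h'
        · exact Or.inr ⟨rfl, hb rfl rfl h h'⟩

theorem Lex.total {l r : M → M → Prop} {t a b t' a' b' : M} (ht : l t t' ∨ t = t' ∨ l t' t)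
    (ha : t = t' → r a a' ∨ a = a' ∨ r a' a) (hb : t = t' → r b b' ∨ b = b' ∨ r b' b) :
    Lex l r t a b t' a' b' ∨ (t = t' ∧ a = a' ∧ b = b') ∨ Lex l r t' a' b' t a b := by
  unfold Lex
  rcases ht with h | rfl | h
  · exact Or.inl (Or.inl h)
  · rcases ha rfl with h | rfl | h
    · exact Or.inl (Or.inr ⟨rfl, Or.inl h⟩)
    · rcases hb rfl with h | rfl | h
      · exact Or.inl (Or.inr ⟨rfl, Or.inr ⟨rfl, h⟩⟩)
      · exact Or.inr (Or.inl ⟨rfl, rfl, rfl⟩)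
      · exact Or.inr (Or.inr (Or.inr ⟨rfl, Or.inr ⟨rfl, h⟩⟩))
    · exact Or.inr (Or.inr (Or.inr ⟨rfl, Or.inl h⟩))
  · exact Or.inr (Or.inr (Or.inl h))

theorem Lex.imp {l r r' : M → M → Prop} {t a b t' a' b' c d c' d' : M}
    (h : Lex l r t a b t' a' b') (h1 : r a a' → r' c c') (h2 : a = a' → c = c')
    (h3 : r b b' → r' d d') : Lex l r' t c d t' c' d' :=
  h.imp_right fun ⟨ht, h⟩ => ⟨ht, h.imp h1 fun ⟨ha, hb⟩ => ⟨h2 ha, h3 hb⟩⟩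

/-- The order on `1 + X`, where `0` is the additional smallest element. -/
def LinOrd.olt (X : LinOrd S) (p q : M) : Prop := q ≠ 0 ∧ (p ≠ 0 → X.lt (pred p) (pred q))

/-- The elements of `1 + X`. -/
def LinOrd.Opt (X : LinOrd S) (p : M) : Prop := p ≠ 0 → pred p ∈ X.dom

theorem LinOrd.opt_succ {X : LinOrd S} {x : M} : X.Opt (x + 1) ↔ x ∈ X.dom := by
  simp [LinOrd.Opt]

theorem LinOrd.opt_zero (X : LinOrd S) : X.Opt 0 := fun h => (h rfl).elim

theorem LinOrd.olt_irrefl (X : LinOrd S) (p : M) : ¬ X.olt p p := fun h => X.irrefl _ (h.2 h.1)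

theorem up_opt {X : LinOrd S} {n e i : M} (he : IncSeq X n e) (hi : i ≤ n) : X.Opt (up e i) := by
  rcases pos_or_zero i with rfl | ⟨i, rfl⟩
  · rw [up_zero]; exact X.opt_zero
  · rw [up_succ, LinOrd.opt_succ]; exact he.mem_dom (succ_le.1 hi)

theorem up_olt {X : LinOrd S} {n e i j : M} (he : IncSeq X n e) (hj : j ≤ n) (hij : i < j) :
    X.olt (up e i) (up e j) := by
  rcases pos_or_zero j with rfl | ⟨j, rfl⟩
  · exact absurd hij not_lt_zero
  · rw [up_succ]
    refine ⟨succ_ne _, fun h => ?_⟩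
    rcases pos_or_zero i with rfl | ⟨i, rfl⟩
    · rw [up_zero] at h; exact (h rfl).elim
    · rw [up_succ, pred_succ, pred_succ]
      exact he.mono (succ_le.1 hj) (by simpa using hij)

theorem up_inj {X : LinOrd S} {n e i j : M} (he : IncSeq X n e) (hi : i ≤ n) (hj : j ≤ n)
    (h : up e i = up e j) : i = j := by
  rcases lt_trichotomy i j with h1 | h1 | h1
  · have := up_olt he hj h1; rw [h] at this; exact (X.olt_irrefl _ this).elim
  · exact h1
  · have := up_olt he hi h1; rw [h] at this; exact (X.olt_irrefl _ this).elim

theorem up_olt_iff {X : LinOrd S} {n e i j : M} (he : IncSeq X n e) (hi : i ≤ n) (hj : j ≤ n) :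
    X.olt (up e i) (up e j) ↔ i < j := by
  refine ⟨fun h => ?_, up_olt he hj⟩
  rcases lt_trichotomy i j with h1 | rfl | h1
  · exact h1
  · exact (X.olt_irrefl _ h).elim
  · have h2 := up_olt he hi h1
    refine (X.irrefl (pred (up e i)) ?_).elim
    exact X.trans _ _ _ (h.2 h2.1) (h2.2 h.1)

theorem up_compSeq {d f n i : M} (S : Set (Set M)) [Model S] (hi : i ≤ n) :
    up (compSeq d f n) i = up d (up f i) := by
  rcases pos_or_zero i with rfl | ⟨i, rfl⟩
  · simp
  · rw [up_succ, up_succ, up_succ, ent_compSeq S (succ_le.1 hi)]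

theorem Mor.up_le (S : Set (Set M)) [Model S] {n m f i : M} (hf : Mor n m f) (hi : i ≤ n) :
    up f i ≤ m := by
  rcases pos_or_zero i with rfl | ⟨i, rfl⟩
  · simp
  · rw [up_succ, succ_le]; exact hf.lt S (succ_le.1 hi)

theorem Mor.up_lt (S : Set (Set M)) [Model S] {n m f i j : M} (hf : Mor n m f) (hj : j ≤ n)
    (hij : i < j) : up f i < up f j := by
  rcases pos_or_zero j with rfl | ⟨j, rfl⟩
  · exact absurd hij not_lt_zero
  · rw [up_succ]
    rcases pos_or_zero i with rfl | ⟨i, rfl⟩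
    · rw [up_zero]; exact zero_le.trans_lt (lt_add_one _)
    · rw [up_succ, add_lt_add_iff_right]
      exact hf.mono S (succ_le.1 hj) (by simpa using hij)

/-- The set enumerated consists of those among a and b that differ from the extra element, shifted
down by one. It is the support of an element with arguments a and b; the indices use the same
convention, with 0 for the extra element and l + 1 for entry l. -/
theorem exists_opt_enum {X : LinOrd S} {a b : M} (ha : X.Opt a) (hb : X.Opt b) :
    ∃ n e i j, IncSeq X n e ∧ i ≤ n ∧ j ≤ n ∧ up e i = a ∧ up e j = b ∧
      ∀ y, Rng e y ↔ y + 1 = a ∨ y + 1 = b := by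
  have step : ∀ {n e c}, IncSeq X n e → X.Opt c →
      ∃ n' e', IncSeq X n' e' ∧ ∀ y, Rng e' y ↔ Rng e y ∨ y + 1 = c := by
    intro n e c he hc
    rcases pos_or_zero c with rfl | ⟨c, rfl⟩
    · exact ⟨n, e, he, fun y => by simp⟩
    · obtain ⟨n', e', he', h⟩ := he.exists_insert (LinOrd.opt_succ.1 hc)
      exact ⟨n', e', he', fun y => by rw [h, add_left_inj]⟩
  have ind : ∀ {n e c}, IncSeq X n e → (∀ y, y + 1 = c → Rng e y) → ∃ i, i ≤ n ∧ up e i = c := by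
    intro n e c he hc
    rcases pos_or_zero c with rfl | ⟨c, rfl⟩
    · exact ⟨0, zero_le, up_zero _⟩
    · obtain ⟨i, hi, rfl⟩ := (he.1.rng_iff S).1 (hc c rfl)
      exact ⟨i + 1, succ_le.2 hi, up_succ _ _⟩
  obtain ⟨e₀, he₀⟩ := exists_empty X
  obtain ⟨n₁, e₁, he₁, h₁⟩ := step he₀ ha
  obtain ⟨n, e, he, h⟩ := step he₁ hb
  have hr : ∀ y, Rng e y ↔ y + 1 = a ∨ y + 1 = b := fun y => by
    rw [h, h₁]
    have : ¬ Rng e₀ y := fun h2 => by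
      obtain ⟨j, hj, -⟩ := (he₀.1.rng_iff S).1 h2
      exact not_lt_zero hj
    simp [this]
  obtain ⟨i, hi, hia⟩ := ind he fun y hy => (hr y).2 (Or.inl hy)
  obtain ⟨j, hj, hjb⟩ := ind he fun y hy => (hr y).2 (Or.inr hy)
  exact ⟨n, e, i, j, he, hi, hj, hia, hjb, hr⟩

end

/-! ### The predilator L × (1 + X) × (1 + X) -/

section

variable {M : Type u} [CommSemiring M] [LinearOrder M] [NatLike M]
variable {S : Set (Set M)} [hM : Model S] {α : Type u} [Code M α]

/-- Coded triples. -/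
def tri (t a b : M) : M := pair t (pair a b)

/-- The second component of a coded triple. -/
noncomputable def mid (z : M) : M := lf (rt z)

/-- The third component of a coded triple. -/
noncomputable def last (z : M) : M := rt (rt z)

@[simp] theorem lf_tri (t a b : M) : lf (tri t a b) = t := lf_pair _ _
@[simp] theorem mid_tri (t a b : M) : mid (tri t a b) = a := by simp [mid, tri]
@[simp] theorem last_tri (t a b : M) : last (tri t a b) = b := by simp [last, tri]

instance IComp.tri {f g h : α → M} [IComp S f] [IComp S g] [IComp S h] :
    IComp S fun x => tri (f x) (g x) (h x) := by
  unfold SOA.tri; infer_instance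
instance IComp.mid {f : α → M} [IComp S f] : IComp S fun x => mid (f x) := by
  unfold SOA.mid; infer_instance
instance IComp.last {f : α → M} [IComp S f] : IComp S fun x => last (f x) := by
  unfold SOA.last; infer_instance

/-- The elements of the predilator `n ↦ L × (1 + n) × (1 + n)`. -/
def TriEl (L : LinOrd S) (n σ : M) : Prop :=
  σ = tri (lf σ) (mid σ) (last σ) ∧ lf σ ∈ L.dom ∧ mid σ ≤ n ∧ last σ ≤ n

instance IDec.triEl (L : LinOrd S) {f g : α → M} [IComp S f] [IComp S g] :
    IDec S fun x => TriEl L (f x) (g x) := by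
  unfold TriEl; infer_instance

theorem triEl_tri {L : LinOrd S} {n t a b : M} :
    TriEl L n (tri t a b) ↔ t ∈ L.dom ∧ a ≤ n ∧ b ≤ n := by
  simp [TriEl]

theorem TriEl.exists {L : LinOrd S} {n σ : M} (h : TriEl L n σ) :
    ∃ t a b, σ = tri t a b ∧ t ∈ L.dom ∧ a ≤ n ∧ b ≤ n := ⟨_, _, _, h⟩

/-- The order of `L × (1 + n) × (1 + n)`. -/
def TriLt (L : LinOrd S) (σ τ : M) : Prop :=
  Lex L.lt (· < ·) (lf σ) (mid σ) (last σ) (lf τ) (mid τ) (last τ)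

instance IDec.triLt (L : LinOrd S) {f g : α → M} [IComp S f] [IComp S g] :
    IDec S fun x => TriLt L (f x) (g x) := by
  unfold TriLt Lex; infer_instance

/-- The action of morphisms on the predilator `n ↦ L × (1 + n) × (1 + n)`. -/
noncomputable def triMap (f σ : M) : M := tri (lf σ) (up f (mid σ)) (up f (last σ))

@[simp] theorem triMap_tri (f t a b : M) : triMap f (tri t a b) = tri t (up f a) (up f b) := by
  simp [triMap]

instance IComp.triMap {f g : α → M} [IComp S f] [IComp S g] :
    IComp S fun x => triMap (f x) (g x) := by
  unfold SOA.triMap; infer_instance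

theorem TriEl.map {L : LinOrd S} {n m f σ : M} (hf : Mor n m f) (h : TriEl L n σ) :
    TriEl L m (triMap f σ) := by
  obtain ⟨t, a, b, rfl, ht, ha, hb⟩ := h.exists
  rw [triMap_tri, triEl_tri]
  exact ⟨ht, hf.up_le S ha, hf.up_le S hb⟩

theorem up_eq_self (S : Set (Set M)) [Model S] {n f i : M} (hf : ∀ i, i < n → Entry f i i)
    (hi : i ≤ n) : up f i = i := by
  rcases pos_or_zero i with rfl | ⟨i, rfl⟩
  · simp
  · rw [up_succ, (hf i (succ_le.1 hi)).ent_eq]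

theorem succ_eq_up_iff (S : Set (Set M)) [Model S] {n f a j : M} (hf : IsSeq n f) (ha : a ≤ n) :
    j + 1 = up f a ↔ ∃ i, i + 1 = a ∧ Entry f i j := by
  rcases pos_or_zero a with rfl | ⟨a, rfl⟩
  · simp
  · rw [up_succ]
    simp only [add_left_inj, hf.entry_iff S]
    exact ⟨fun h => ⟨a, rfl, succ_le.1 ha, h.symm⟩, fun ⟨i, h, _, h'⟩ => by rw [← h, h']⟩

/-- The predilator `X ↦ L × (1 + X) × (1 + X)`, with lexicographic order. -/
def lexPredilator (L : LinOrd S) : Predilator S where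
  el := TriEl L
  lt n σ τ := TriEl L n σ ∧ TriEl L n τ ∧ TriLt L σ τ
  -- Lengths do not exceed codes, so the bound on n loses nothing while making the relation
  -- decidable.
  map m f σ τ := ∃ n, n ≤ f ∧ Mor n m f ∧ TriEl L n σ ∧ τ = triMap f σ
  supp n σ i := TriEl L n σ ∧ (i + 1 = mid σ ∨ i + 1 = last σ)
  el_mem := inS2_iff.2 dec
  lt_mem := inS3_iff.2 dec
  map_mem := inS4_iff.2 dec
  supp_mem := inS3_iff.2 dec
  lt_el _ _ _ h := ⟨h.1, h.2.1⟩
  lt_irrefl _ _ h := Lex.irrefl (L.irrefl _) (lt_irrefl _) (lt_irrefl _) h.2.2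
  lt_trans n σ τ ρ h h' := ⟨h.1, h'.2.1, h.2.2.trans h'.2.2 (L.trans _ _ _)
    (fun _ _ => lt_trans) fun _ _ => lt_trans⟩
  lt_total n σ τ hσ hτ := by
    rcases Lex.total (l := L.lt) (r := (· < ·)) (L.total _ hσ.2.1 _ hτ.2.1)
      (fun _ => lt_trichotomy (mid σ) (mid τ)) (fun _ => lt_trichotomy (last σ) (last τ))
      with h | ⟨h1, h2, h3⟩ | h
    · exact Or.inl ⟨hσ, hτ, h⟩
    · rw [hσ.1, hτ.1, h1, h2, h3]
      exact Or.inr (Or.inl rfl)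
    · exact Or.inr (Or.inr ⟨hτ, hσ, h⟩)
  map_el := by
    rintro m f σ τ ⟨n, -, hf, hσ, rfl⟩
    exact ⟨n, hf, hσ, hσ.map hf⟩
  map_exists_unique n m f σ hf hσ :=
    ⟨_, ⟨n, hf.1.len_le, hf, hσ, rfl⟩, fun τ ⟨_, _, _, _, h⟩ => h⟩
  map_lt := by
    rintro n m f σ σ' τ τ' hf ⟨hσ, hσ', hlt⟩ ⟨-, -, -, -, rfl⟩ ⟨-, -, -, -, rfl⟩
    refine ⟨hσ.map hf, hσ'.map hf, ?_⟩
    obtain ⟨t, a, b, rfl, ht, ha, hb⟩ := hσ.exists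
    obtain ⟨t', a', b', rfl, ht', ha', hb'⟩ := hσ'.exists
    simp only [TriLt, triMap_tri, lf_tri, mid_tri, last_tri] at hlt ⊢
    exact hlt.imp (hf.up_lt S ha') (fun h => h ▸ rfl) (hf.up_lt S hb')
  map_id := by
    intro n f σ hf hid hσ
    refine ⟨n, hf.1.len_le, hf, hσ, ?_⟩
    obtain ⟨t, a, b, rfl, ht, ha, hb⟩ := hσ.exists
    rw [triMap_tri, up_eq_self S hid ha, up_eq_self S hid hb]
  map_comp := by
    rintro n m k f g h σ τ ρ hf hg hh hc ⟨n', -, hf', hσ, rfl⟩ ⟨-, -, -, -, rfl⟩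
    rw [hf'.1.len_unique hf.1] at hσ
    obtain ⟨-, rfl⟩ := hc.eq_compSeq S hf hg.1 hh.1
    refine ⟨n, hh.1.len_le, hh, hσ, ?_⟩
    obtain ⟨t, a, b, rfl, ht, ha, hb⟩ := hσ.exists
    rw [triMap_tri, triMap_tri, triMap_tri, up_compSeq S ha, up_compSeq S hb]
  supp_el := by
    rintro n σ i ⟨hσ, h⟩
    refine ⟨hσ, h.elim (fun h => ?_) fun h => ?_⟩
    · exact succ_le.1 (h.trans_le hσ.2.2.1)
    · exact succ_le.1 (h.trans_le hσ.2.2.2)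
  supp_natural := by
    rintro n m f σ τ hf ⟨n', -, hf', hσ, rfl⟩ j
    rw [hf'.1.len_unique hf.1] at hσ
    have hσ' := hσ.map hf
    obtain ⟨t, a, b, rfl, ht, ha, hb⟩ := hσ.exists
    simp only [hσ', hσ, true_and]
    rw [triMap_tri, mid_tri, last_tri, mid_tri, last_tri, succ_eq_up_iff S hf.1 ha,
      succ_eq_up_iff S hf.1 hb]
    simp only [or_and_right, exists_or]
  supp_condition := by
    intro m τ hτ
    have hτ' := hτ
    obtain ⟨t, a, b, rfl, ht, ha, hb⟩ := hτ.exists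
    have hopt : ∀ {c}, c ≤ m → (natOrd S m).Opt c := fun {c} hc h =>
      succ_le.1 ((succ_pred h).trans_le hc)
    obtain ⟨n, e, i, j, he, hi, hj, rfl, rfl, hr⟩ := exists_opt_enum (hopt ha) (hopt hb)
    have he' := (mor_iff_incSeq S).2 he
    refine ⟨n, e, tri t i j, he', fun y => ?_, n, he'.1.len_le, he',
      triEl_tri.2 ⟨ht, hi, hj⟩, (triMap_tri _ _ _ _).symm⟩
    simp only [hτ', true_and, mid_tri, last_tri]
    exact hr y

/-! ### The elements of `L × (1 + X) × (1 + X)` -/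

variable {L X : LinOrd S} {τ τ' : M}

/-- The first component of an element of `L × (1 + X) × (1 + X)`. -/
noncomputable def triLabel (τ : M) : M := lf (rt τ)

/-- The second component of an element of `L × (1 + X) × (1 + X)`. -/
noncomputable def triMid (τ : M) : M := up (lf τ) (mid (rt τ))

/-- The third component of an element of `L × (1 + X) × (1 + X)`. -/
noncomputable def triLast (τ : M) : M := up (lf τ) (last (rt τ))

instance IComp.triLabel {f : α → M} [IComp S f] : IComp S fun x => triLabel (f x) := by
  unfold SOA.triLabel; infer_instance
instance IComp.triMid {f : α → M} [IComp S f] : IComp S fun x => triMid (f x) := by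
  unfold SOA.triMid; infer_instance
instance IComp.triLast {f : α → M} [IComp S f] : IComp S fun x => triLast (f x) := by
  unfold SOA.triLast; infer_instance

@[simp] theorem triLabel_pair (e t i j : M) : triLabel (pair e (tri t i j)) = t := by simp [triLabel]
@[simp] theorem triMid_pair (e t i j : M) : triMid (pair e (tri t i j)) = up e i := by simp [triMid]
@[simp] theorem triLast_pair (e t i j : M) : triLast (pair e (tri t i j)) = up e j := by
  simp [triLast]

instance IDec.dMem_lexPredilator {f : α → M} [IComp S f] :
    IDec S fun x => DMem (lexPredilator L) X (f x) := by
  have h : Dec S fun τ : M => DMem (lexPredilator L) X τ := by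
    refine Dec.congr (P := fun τ : M => ∃ n, n ≤ lf τ ∧ τ = pair (lf τ) (rt τ) ∧
      IncSeq X n (lf τ) ∧ TriEl L n (rt τ) ∧ ∀ i, i < n →
        (TriEl L n (rt τ) ∧ (i + 1 = mid (rt τ) ∨ i + 1 = last (rt τ)))) (by exact dec) fun τ => ?_
    constructor
    · rintro ⟨n, e, σ, rfl, he, h⟩
      refine ⟨n, ?_⟩
      rw [lf_pair, rt_pair]
      exact ⟨he.1.len_le, rfl, he, h⟩
    · rintro ⟨n, -, h, h'⟩
      exact ⟨n, _, _, h, h'⟩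
  exact ⟨h.comp_of comp⟩

theorem DMem.tri (h : DMem (lexPredilator L) X τ) : ∃ n e t i j, τ = pair e (tri t i j) ∧
    IncSeq X n e ∧ t ∈ L.dom ∧ i ≤ n ∧ j ≤ n ∧ ∀ l, l < n → l + 1 = i ∨ l + 1 = j := by
  obtain ⟨n, e, σ, rfl, he, hσ, hs⟩ := h
  have hσ' : TriEl L n σ := hσ
  obtain ⟨t, i, j, rfl, ht, hi, hj⟩ := hσ'.exists
  refine ⟨n, e, t, i, j, rfl, he, ht, hi, hj, fun l hl => ?_⟩
  have := (hs l hl).2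
  rwa [mid_tri, last_tri] at this

theorem DMem.triLabel_mem (h : DMem (lexPredilator L) X τ) : triLabel τ ∈ L.dom := by
  obtain ⟨n, e, t, i, j, rfl, he, ht, hi, hj, -⟩ := h.tri
  rwa [triLabel_pair]

theorem DMem.triMid_opt (h : DMem (lexPredilator L) X τ) : X.Opt (triMid τ) := by
  obtain ⟨n, e, t, i, j, rfl, he, ht, hi, hj, -⟩ := h.tri
  rw [triMid_pair]
  exact up_opt he hi

theorem DMem.triLast_opt (h : DMem (lexPredilator L) X τ) : X.Opt (triLast τ) := by
  obtain ⟨n, e, t, i, j, rfl, he, ht, hi, hj, -⟩ := h.tri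
  rw [triLast_pair]
  exact up_opt he hj

/-- Enumerating only the arguments that actually occur ensures full support. Together with
`DMem.tri_ext` and `DMem.dLt_iff_lex`, this identifies coded elements of D(X) with triples in L × (1
+ X) × (1 + X). -/
theorem dMem_tri {t a b : M} (ht : t ∈ L.dom) (ha : X.Opt a) (hb : X.Opt b) :
    ∃ τ, DMem (lexPredilator L) X τ ∧ triLabel τ = t ∧ triMid τ = a ∧ triLast τ = b := by
  obtain ⟨n, e, i, j, he, hi, hj, rfl, rfl, hr⟩ := exists_opt_enum ha hb
  have hel : TriEl L n (tri t i j) := triEl_tri.2 ⟨ht, hi, hj⟩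
  refine ⟨pair e (tri t i j), ⟨n, e, _, rfl, he, hel, fun l hl => ⟨hel, ?_⟩⟩, by simp⟩
  rw [mid_tri, last_tri]
  refine ((hr _).1 ((he.1.rng_iff S).2 ⟨l, hl, rfl⟩)).imp (fun h => ?_) fun h => ?_
  · exact up_inj he (succ_le.2 hl) hi (by rw [up_succ, h])
  · exact up_inj he (succ_le.2 hl) hj (by rw [up_succ, h])

theorem DMem.dSupp_iff (h : DMem (lexPredilator L) X τ) {x : M} :
    DSupp τ x ↔ x + 1 = triMid τ ∨ x + 1 = triLast τ := by
  obtain ⟨n, e, t, i, j, rfl, he, ht, hi, hj, hs⟩ := h.tri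
  rw [dSupp_pair, triMid_pair, triLast_pair, he.1.rng_iff S, succ_eq_up_iff S he.1 hi,
    succ_eq_up_iff S he.1 hj]
  simp only [he.1.entry_iff S]
  constructor
  · rintro ⟨l, hl, rfl⟩
    exact (hs l hl).imp (fun h => ⟨l, h, hl, rfl⟩) fun h => ⟨l, h, hl, rfl⟩
  · rintro (⟨l, -, h⟩ | ⟨l, -, h⟩) <;> exact ⟨l, h⟩

theorem DMem.tri_ext (h : DMem (lexPredilator L) X τ) (h' : DMem (lexPredilator L) X τ')
    (h1 : triLabel τ = triLabel τ') (h2 : triMid τ = triMid τ') (h3 : triLast τ = triLast τ') :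
    τ = τ' := by
  have hr : ∀ y, DSupp τ y ↔ DSupp τ' y := fun y => by rw [h.dSupp_iff, h'.dSupp_iff, h2, h3]
  obtain ⟨n, e, t, i, j, rfl, he, ht, hi, hj, hs⟩ := h.tri
  obtain ⟨n', e', t', i', j', rfl, he', ht', hi', hj', hs'⟩ := h'.tri
  simp only [dSupp_pair] at hr
  obtain ⟨rfl, rfl⟩ := he.ext_rng he' hr
  simp only [triLabel_pair, triMid_pair, triLast_pair] at h1 h2 h3
  rw [h1, up_inj he hi hi' h2, up_inj he hj hj' h3]

/-- Both elements are moved to a finite suborder enumerated by d. There the predilator compares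
indices lexicographically, and `up d` preserves and reflects the order. -/
theorem DMem.dLt_iff_lex (h : DMem (lexPredilator L) X τ) (h' : DMem (lexPredilator L) X τ') :
    DLt (lexPredilator L) X τ τ' ↔
      Lex L.lt X.olt (triLabel τ) (triMid τ) (triLast τ) (triLabel τ') (triMid τ') (triLast τ') := by
  obtain ⟨k, d, n, f, σ, n', f', σ', ρ, ρ', hd, hf, hf', rfl, rfl, hρ, hρ'⟩ := h.factor₂ h'
  rw [dLt_iff hd hf hf' h h' hρ hρ']
  have hσ : TriEl L n σ := ((lexPredilator L).el_of_map hf hρ).1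
  have hσ' : TriEl L n' σ' := ((lexPredilator L).el_of_map hf' hρ').1
  obtain ⟨-, -, -, -, rfl⟩ := hρ
  obtain ⟨-, -, -, -, rfl⟩ := hρ'
  have h1 := hσ.map hf
  have h1' := hσ'.map hf'
  obtain ⟨t, a, b, rfl, ht, ha, hb⟩ := hσ.exists
  obtain ⟨t', a', b', rfl, ht', ha', hb'⟩ := hσ'.exists
  have h2 : (lexPredilator L).lt k (triMap f (SOA.tri t a b)) (triMap f' (SOA.tri t' a' b')) ↔
      TriLt L (triMap f (SOA.tri t a b)) (triMap f' (SOA.tri t' a' b')) :=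
    ⟨fun h => h.2.2, fun h => ⟨h1, h1', h⟩⟩
  rw [h2]
  simp only [TriLt, triMap_tri, lf_tri, mid_tri, last_tri, triLabel_pair, triMid_pair,
    triLast_pair, up_compSeq S ha, up_compSeq S hb, up_compSeq S ha', up_compSeq S hb', Lex]
  rw [up_olt_iff hd (hf.up_le S ha) (hf'.up_le S ha'), up_olt_iff hd (hf.up_le S hb) (hf'.up_le S hb')]
  refine or_congr Iff.rfl (and_congr Iff.rfl (or_congr Iff.rfl (and_congr ⟨fun h => by rw [h],
    up_inj hd (hf.up_le S ha) (hf'.up_le S ha')⟩ Iff.rfl)))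

end

/-! ### Branching systems and the comparison of terms -/

section

variable {M : Type u} [CommSemiring M] [LinearOrder M] [NatLike M]
variable {S : Set (Set M)} [hM : Model S] {α : Type u} [Code M α]

instance IComp.add_left (a : M) : IComp S (HAdd.hAdd a : M → M) := ⟨.add (.const a) .id⟩

/-- Iteration of computable functions. -/
theorem exists_iterate {F : M → M} (hF : Comp S F) : ∃ f : M → M → M,
    (Comp S fun q : M × M => f q.1 q.2) ∧ (∀ x, f x 0 = x) ∧ ∀ x n, f x (n + 1) = F (f x n) := by
  classical
  have i1 := IComp.fun₁ hF
  obtain ⟨f, hf, h⟩ := exists_recursion (S := S)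
    (fun x v s : M => if v = 0 then x else F (ent s (pred v))) (by exact comp)
  refine ⟨f, hf, fun x => ?_, fun x n => ?_⟩
  · rw [h]; exact if_pos rfl
  · rw [h, if_neg (succ_ne n), pred_succ, ent_mkSeq (S := S) (hf.fun₂ (.const x) .id) (lt_add_one n)]

theorem lf_le (S : Set (Set M)) [Model S] (z : M) : lf z ≤ z := by
  by_cases h : ∃ a b, z = pair a b
  · obtain ⟨a, b, rfl⟩ := h
    rw [lf_pair]; exact le_pair_left _ _
  · rw [lf, dif_neg h]; exact zero_le

theorem rt_le (S : Set (Set M)) [Model S] (z : M) : rt z ≤ z := by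
  by_cases h : ∃ b a, z = pair a b
  · obtain ⟨b, a, rfl⟩ := h
    rw [rt_pair]; exact le_pair_right _ _
  · rw [rt, dif_neg h]; exact zero_le

/-- A labelled binary branching system without infinite branches: the nodes `t ∈ B` have
children `c₀ t` and `c₁ t`, where `0` indicates that there is no child, and nodes are larger than
their children. -/
structure Branching (S : Set (Set M)) where
  L : LinOrd S
  B : Set M
  c₀ : M → M
  c₁ : M → M
  B_mem : B ∈ S
  comp₀ : Comp S c₀
  comp₁ : Comp S c₁
  sub : ∀ t, t ∈ B → t ∈ L.dom
  child₀ : ∀ t s, t ∈ B → c₀ t = s + 1 → s ∈ B ∧ L.lt s t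
  child₁ : ∀ t s, t ∈ B → c₁ t = s + 1 → s ∈ B ∧ L.lt s t
  wf : ¬ ∃ g : M → M, Comp S g ∧ ∀ n, g n ∈ B ∧ (c₀ (g n) = g (n + 1) + 1 ∨ c₁ (g n) = g (n + 1) + 1)

/-- The code of the term for the node `t`. -/
def node (t : M) : M := pair 0 t

/-- The code of the compound term with label `t` and arguments `a` and `b`. -/
def compound (t a b : M) : M := pair 1 (tri t a b)

/-- The term for a child of a node. -/
noncomputable def childTerm (c : M) : M := if c = 0 then 0 else node (pred c) + 1

instance IComp.node {f : α → M} [IComp S f] : IComp S fun x => node (f x) := by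
  unfold SOA.node; infer_instance
instance IComp.compound {f g h : α → M} [IComp S f] [IComp S g] [IComp S h] :
    IComp S fun x => compound (f x) (g x) (h x) := by
  unfold SOA.compound; infer_instance
instance IComp.childTerm {f : α → M} [IComp S f] : IComp S fun x => childTerm (f x) := by
  unfold SOA.childTerm; infer_instance

@[simp] theorem childTerm_zero : childTerm (0 : M) = 0 := if_pos rfl
@[simp] theorem childTerm_succ (s : M) : childTerm (s + 1) = node s + 1 := by
  rw [childTerm, if_neg (succ_ne s), pred_succ]

/-- The measure of a term (or of the extra element `0`). -/
noncomputable def size (p : M) : M := if p ≠ 0 ∧ lf (pred p) ≠ 0 then p else 0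

instance IComp.size {f : α → M} [IComp S f] : IComp S fun x => size (f x) := by
  unfold SOA.size; infer_instance

theorem size_succ (v : M) : size (v + 1) = if lf v ≠ 0 then v + 1 else 0 := by
  simp [size]

theorem size_le (p : M) : size p ≤ p := by
  unfold size
  split_ifs
  · exact le_rfl
  · exact zero_le

theorem size_childTerm (c : M) : size (childTerm c) = 0 := by
  rcases pos_or_zero c with rfl | ⟨c, rfl⟩ <;> simp [size, node]

namespace Branching

variable (A : Branching S)

instance {f : α → M} [hf : IComp S f] : IComp S fun x => A.c₀ (f x) := ⟨A.comp₀.comp_of hf.out⟩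
instance {f : α → M} [hf : IComp S f] : IComp S fun x => A.c₁ (f x) := ⟨A.comp₁.comp_of hf.out⟩
instance {f : α → M} [hf : IComp S f] : IDec S fun x => f x ∈ A.B := ⟨.mem A.B_mem hf.out⟩

/-- The label at the root of a term. -/
noncomputable def label (_ : Branching S) (v : M) : M := if lf v = 0 then rt v else lf (rt v)

/-- The left argument of a term. -/
noncomputable def left (v : M) : M := if lf v = 0 then childTerm (A.c₀ (rt v)) else mid (rt v)

/-- The right argument of a term. -/
noncomputable def right (v : M) : M := if lf v = 0 then childTerm (A.c₁ (rt v)) else last (rt v)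

instance {f : α → M} [IComp S f] : IComp S fun x => A.label (f x) := by
  unfold label; infer_instance
instance {f : α → M} [IComp S f] : IComp S fun x => A.left (f x) := by
  unfold left; infer_instance
instance {f : α → M} [IComp S f] : IComp S fun x => A.right (f x) := by
  unfold right; infer_instance

@[simp] theorem label_node (t : M) : A.label (node t) = t := by simp [label, node]
@[simp] theorem left_node (t : M) : A.left (node t) = childTerm (A.c₀ t) := by simp [left, node]
@[simp] theorem right_node (t : M) : A.right (node t) = childTerm (A.c₁ t) := by simp [right, node]
@[simp] theorem label_compound (t a b : M) : A.label (compound t a b) = t := by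
  simp [label, compound]
@[simp] theorem left_compound (t a b : M) : A.left (compound t a b) = a := by
  simp [left, compound]
@[simp] theorem right_compound (t a b : M) : A.right (compound t a b) = b := by
  simp [right, compound]

theorem left_lt_of_compound {v : M} (h : lf v ≠ 0) : A.left v < v + 1 := by
  rw [left, if_neg h, lt_succ]
  exact (lf_le S _).trans ((rt_le S _).trans (rt_le S _))

theorem right_lt_of_compound {v : M} (h : lf v ≠ 0) : A.right v < v + 1 := by
  rw [right, if_neg h, lt_succ]
  exact (rt_le S _).trans ((rt_le S _).trans (rt_le S _))

theorem size_left_lt {v : M} (h : lf v ≠ 0) : size (A.left v) < size (v + 1) := by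
  rw [size_succ, if_pos h]
  exact (size_le _).trans_lt (A.left_lt_of_compound h)

theorem size_right_lt {v : M} (h : lf v ≠ 0) : size (A.right v) < size (v + 1) := by
  rw [size_succ, if_pos h]
  exact (size_le _).trans_lt (A.right_lt_of_compound h)

theorem size_left_le (v : M) : size (A.left v) ≤ size (v + 1) := by
  by_cases h : lf v = 0
  · rw [left, if_pos h, size_childTerm]; exact zero_le
  · exact (A.size_left_lt h).le

theorem size_right_le (v : M) : size (A.right v) ≤ size (v + 1) := by
  by_cases h : lf v = 0
  · rw [right, if_pos h, size_childTerm]; exact zero_le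
  · exact (A.size_right_lt h).le

/-! ### The comparison of terms -/

/-- The comparison of `p` and `q` can be decided at once. -/
def Final (p q : M) : Prop := p = q ∨ p = 0 ∨ q = 0 ∨ A.label (pred p) ≠ A.label (pred q) ∨
  (lf (pred p) = 0 ∧ lf (pred q) = 0)

/-- It can be decided at once that `p` is smaller than `q`. -/
def Smaller (p q : M) : Prop :=
  p ≠ q ∧ q ≠ 0 ∧ (p ≠ 0 → A.L.lt (A.label (pred p)) (A.label (pred q)))

instance {f g : α → M} [IComp S f] [IComp S g] : IDec S fun x => A.Final (f x) (g x) := by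
  unfold Final; infer_instance
instance {f g : α → M} [IComp S f] [IComp S g] : IDec S fun x => A.Smaller (f x) (g x) := by
  unfold Smaller; infer_instance

theorem Smaller.final {A : Branching S} {p q : M} (h : A.Smaller p q) : A.Final p q := by
  by_cases hp : p = 0
  · exact Or.inr (Or.inl hp)
  · refine Or.inr (Or.inr (Or.inr (Or.inl fun heq => ?_)))
    have h1 := h.2.2 hp
    rw [heq] at h1
    exact A.L.irrefl _ h1

open Classical in
/-- One step in the comparison of two terms, the pair of which is coded by `z`. -/
noncomputable def next (z : M) : M := if A.Final (lf z) (rt z) then z else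
  if A.left (pred (lf z)) = A.left (pred (rt z)) then
    pair (A.right (pred (lf z))) (A.right (pred (rt z)))
  else pair (A.left (pred (lf z))) (A.left (pred (rt z)))

theorem comp_next : Comp S A.next := by
  unfold next; exact comp

/-- The stages of the comparison of two terms. -/
noncomputable def stage : M → M → M := (exists_iterate A.comp_next).choose

instance {f g : α → M} [hf : IComp S f] [hg : IComp S g] : IComp S fun x => A.stage (f x) (g x) :=
  ⟨(exists_iterate A.comp_next).choose_spec.1.fun₂ hf.out hg.out⟩

instance (z : M) : IComp S (A.stage z) :=
  ⟨(exists_iterate A.comp_next).choose_spec.1.fun₂ (.const z) .id⟩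

@[simp] theorem stage_zero (z : M) : A.stage z 0 = z :=
  (exists_iterate A.comp_next).choose_spec.2.1 z

theorem stage_succ (z n : M) : A.stage z (n + 1) = A.next (A.stage z n) :=
  (exists_iterate A.comp_next).choose_spec.2.2 z n

theorem stage_next (z n : M) : A.stage (A.next z) n = A.stage z (n + 1) := by
  refine dec_induction S (P := fun n => A.stage (A.next z) n = A.stage z (n + 1)) (by exact dec)
    ?_ (fun n ih => ?_) n
  · rw [stage_zero, stage_succ, stage_zero]
  · rw [stage_succ, ih, ← stage_succ]

theorem next_of_final {z : M} (h : A.Final (lf z) (rt z)) : A.next z = z := if_pos h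

theorem stage_of_final {z : M} (h : A.Final (lf z) (rt z)) (n : M) : A.stage z n = z := by
  refine dec_induction S (P := fun n => A.stage z n = z) (by exact dec) (A.stage_zero z)
    (fun n ih => ?_) n
  rw [stage_succ, ih, A.next_of_final h]

theorem exists_of_not_final {p q : M} (h : ¬ A.Final p q) : ∃ v w, p = v + 1 ∧ q = w + 1 ∧ v ≠ w ∧
    A.label v = A.label w ∧ (lf v ≠ 0 ∨ lf w ≠ 0) := by
  simp only [Final, not_or] at h
  obtain ⟨h1, h2, h3, h4, h5⟩ := h
  obtain ⟨v, rfl⟩ := (pos_or_zero p).resolve_left h2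
  obtain ⟨w, rfl⟩ := (pos_or_zero q).resolve_left h3
  simp only [pred_succ] at h4 h5
  refine ⟨v, w, rfl, rfl, fun h => h1 (by rw [h]), not_not.1 h4, ?_⟩
  by_contra h
  push Not at h
  exact h5 h

/-- Only compounds have positive size, namely their code plus one, and their arguments are smaller.
The arguments of a node are nodes or 0, hence of size 0. A comparison that is not final involves at
least one compound, so the total size drops. -/
theorem size_next_lt {z : M} (h : ¬ A.Final (lf z) (rt z)) :
    size (lf (A.next z)) + size (rt (A.next z)) < size (lf z) + size (rt z) := by
  obtain ⟨v, w, hv, hw, -, -, hc⟩ := A.exists_of_not_final h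
  rw [next, if_neg h, hv, hw, pred_succ, pred_succ]
  split_ifs <;> rw [lf_pair, rt_pair]
  · rcases hc with hc | hc
    · exact add_lt_add_of_lt_of_le (A.size_right_lt hc) (A.size_right_le w)
    · exact add_lt_add_of_le_of_lt (A.size_right_le v) (A.size_right_lt hc)
  · rcases hc with hc | hc
    · exact add_lt_add_of_lt_of_le (A.size_left_lt hc) (A.size_left_le w)
    · exact add_lt_add_of_le_of_lt (A.size_left_le v) (A.size_left_lt hc)

theorem exists_final (z : M) : ∃ n, A.Final (lf (A.stage z n)) (rt (A.stage z n)) := by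
  have key : ∀ n, A.Final (lf (A.stage z n)) (rt (A.stage z n)) ∨
      size (lf (A.stage z n)) + size (rt (A.stage z n)) + n ≤ size (lf z) + size (rt z) := by
    refine dec_induction S (by exact dec) (Or.inr (by rw [stage_zero, add_zero])) fun n ih => ?_
    by_cases h : A.Final (lf (A.stage z n)) (rt (A.stage z n))
    · rw [stage_succ, A.next_of_final h]; exact Or.inl h
    · rw [stage_succ]
      refine Or.inr (le_trans ?_ (ih.resolve_left h))
      rw [add_comm n 1, ← add_assoc]
      exact add_le_add_left (succ_le.2 (A.size_next_lt h)) n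
  refine ⟨size (lf z) + size (rt z) + 1, (key _).resolve_right fun h => ?_⟩
  exact absurd (le_add_self.trans h) (not_le.2 (lt_add_one _))

/-- The order of terms, extended by a smallest element `0`. -/
def R (p q : M) : Prop :=
  ∃ n, A.Smaller (lf (A.stage (pair p q) n)) (rt (A.stage (pair p q) n))

/-- Every comparison reaches a final stage and stays there. Failure of the relation is thus
witnessed by a stage as well, which makes the relation decidable. -/
theorem not_r_iff {p q : M} : ¬ A.R p q ↔ ∃ n,
    A.Final (lf (A.stage (pair p q) n)) (rt (A.stage (pair p q) n)) ∧
    ¬ A.Smaller (lf (A.stage (pair p q) n)) (rt (A.stage (pair p q) n)) := by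
  constructor
  · intro h
    obtain ⟨n, hn⟩ := A.exists_final (pair p q)
    exact ⟨n, hn, fun h' => h ⟨n, h'⟩⟩
  · rintro ⟨n, hn, hn'⟩ ⟨m, hm⟩
    have persist : ∀ n, A.Final (lf (A.stage (pair p q) n)) (rt (A.stage (pair p q) n)) →
        ∀ k, A.stage (pair p q) (n + k) = A.stage (pair p q) n := by
      intro n hn
      refine dec_induction S (by exact dec) (by rw [add_zero]) fun k ih => ?_
      rw [← add_assoc, stage_succ, ih, A.next_of_final hn]
    have h1 := persist n hn m
    rw [add_comm, persist m hm.final n] at h1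
    rw [h1] at hm
    exact hn' hm

instance {f g : α → M} [IComp S f] [IComp S g] : IDec S fun x => A.R (f x) (g x) := by
  have : Dec S fun q : M × M => A.R q.1 q.2 := by
    refine Dec.of_sig (by unfold R; exact sig) ?_
    simp only [not_r_iff]
    exact sig
  exact ⟨this.rel₂ comp comp⟩

theorem r_iff_of_final {p q : M} (h : A.Final p q) : A.R p q ↔ A.Smaller p q := by
  have h1 : ∀ n, A.stage (pair p q) n = pair p q := A.stage_of_final (by rwa [lf_pair, rt_pair])
  simp only [R, h1, lf_pair, rt_pair, exists_const]

theorem r_irrefl (p : M) : ¬ A.R p p := by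
  rw [A.r_iff_of_final (Or.inl rfl)]
  exact fun h => h.1 rfl

theorem r_zero_left {q : M} : A.R 0 q ↔ q ≠ 0 := by
  rw [A.r_iff_of_final (Or.inr (Or.inl rfl))]
  exact ⟨fun h => h.2.1, fun h => ⟨h.symm, h, fun h => (h rfl).elim⟩⟩

theorem not_r_zero {p : M} : ¬ A.R p 0 := by
  rw [A.r_iff_of_final (Or.inr (Or.inr (Or.inl rfl)))]
  exact fun h => h.2.1 rfl

theorem r_iff_next {p q : M} :
    A.R p q ↔ A.R (lf (A.next (pair p q))) (rt (A.next (pair p q))) := by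
  by_cases h : A.Final p q
  · rw [A.next_of_final (by rwa [lf_pair, rt_pair]), lf_pair, rt_pair]
  · obtain ⟨a, b, hab⟩ : ∃ a b, A.next (pair p q) = pair a b := by
      rw [next, if_neg (by rwa [lf_pair, rt_pair])]
      split_ifs <;> exact ⟨_, _, rfl⟩
    have h1 : ∀ n, A.stage (pair a b) n = A.stage (pair p q) (n + 1) := fun n => by
      rw [← hab, stage_next]
    rw [hab, lf_pair, rt_pair, R, R]
    constructor
    · rintro ⟨n, hn⟩
      refine ⟨n, ?_⟩
      rw [h1, stage_succ, A.next_of_final hn.final]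
      exact hn
    · rintro ⟨n, hn⟩
      rw [h1] at hn
      exact ⟨_, hn⟩

/-- Terms are compared lexicographically. -/
theorem r_succ_iff {v w : M} (h : lf v ≠ 0 ∨ lf w ≠ 0 ∨ A.label v ≠ A.label w ∨ v = w) :
    A.R (v + 1) (w + 1) ↔ Lex A.L.lt A.R (A.label v) (A.left v) (A.right v)
      (A.label w) (A.left w) (A.right w) := by
  by_cases hvw : v = w
  · subst hvw
    exact iff_of_false (A.r_irrefl _) (Lex.irrefl (A.L.irrefl _) (A.r_irrefl _) (A.r_irrefl _))
  by_cases hl : A.label v = A.label w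
  · have hf : ¬ A.Final (v + 1) (w + 1) := by
      simp only [Final, pred_succ, add_left_inj, hvw, succ_ne, hl, not_or]
      refine ⟨not_false, not_false, not_false, by simp, fun h' => ?_⟩
      rcases h with h | h | h | h
      exacts [h h'.1, h h'.2, h hl, hvw h]
    rw [r_iff_next, next, lf_pair, rt_pair, if_neg hf, pred_succ, pred_succ, Lex, hl]
    simp only [A.L.irrefl, true_and, false_or]
    split_ifs with h1
    · rw [lf_pair, rt_pair, h1]
      simp only [A.r_irrefl, true_and, false_or]
    · rw [lf_pair, rt_pair]
      simp only [h1, false_and, or_false]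
  · rw [A.r_iff_of_final (by simp only [Final, pred_succ]; tauto), Smaller, Lex]
    simp [hl, hvw]

end Branching

end

/-! ### The fixed point of terms over a branching system -/

section

variable {M : Type u} [CommSemiring M] [LinearOrder M] [NatLike M]
variable {S : Set (Set M)} [hM : Model S] {α : Type u} [Code M α]

@[simp] theorem lf_node (t : M) : lf (node t) = 0 := lf_pair _ _
@[simp] theorem rt_node (t : M) : rt (node t) = t := rt_pair _ _
@[simp] theorem lf_compound (t a b : M) : lf (compound t a b) = 1 := lf_pair _ _

namespace Branching

variable (A : Branching S)

/-- The compound term that would have the same label and arguments as a node. -/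
def NodeLike (t a b : M) : Prop := t ∈ A.B ∧ a = childTerm (A.c₀ t) ∧ b = childTerm (A.c₁ t)

instance {f g h : α → M} [IComp S f] [IComp S g] [IComp S h] :
    IDec S fun x => A.NodeLike (f x) (g x) (h x) := by
  unfold NodeLike; infer_instance

/-- The recursive clause for the notion of a term; the sequence `s` describes which smaller
numbers are terms. -/
def TermStep (v s : M) : Prop := (v = node (rt v) ∧ rt v ∈ A.B) ∨
  (v = compound (A.label v) (A.left v) (A.right v) ∧ A.label v ∈ A.L.dom ∧
    (A.left v ≠ 0 → ent s (pred (A.left v)) = 1) ∧ (A.right v ≠ 0 → ent s (pred (A.right v)) = 1) ∧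
    A.R (A.left v) (v + 1) ∧ A.R (A.right v) (v + 1) ∧
    ¬ A.NodeLike (A.label v) (A.left v) (A.right v))

instance {f g : α → M} [IComp S f] [IComp S g] : IDec S fun x => A.TermStep (f x) (g x) := by
  unfold TermStep; infer_instance

open Classical in
theorem exists_termFun : ∃ f : M → M, Comp S f ∧
    ∀ v, f v = if A.TermStep v (mkSeq f v) then 1 else 0 := by
  obtain ⟨f, hf, h⟩ := exists_recursion (S := S)
    (fun _ v s : M => if A.TermStep v s then 1 else 0) (by exact comp)
  exact ⟨f 0, hf.fun₂ (.const 0) .id, h 0⟩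

/-- The terms that make up the fixed point. -/
def Term (v : M) : Prop := A.exists_termFun.choose v = 1

instance {f : α → M} [hf : IComp S f] : IDec S fun x => A.Term (f x) :=
  ⟨.eq (A.exists_termFun.choose_spec.1.comp_of hf.out) (.const 1)⟩

/-- The terms together with a smallest element `0`. -/
def Opt (p : M) : Prop := p ≠ 0 → A.Term (pred p)

instance {f : α → M} [IComp S f] : IDec S fun x => A.Opt (f x) := by
  unfold Opt; infer_instance

theorem opt_zero : A.Opt 0 := fun h => (h rfl).elim

@[simp] theorem opt_succ {v : M} : A.Opt (v + 1) ↔ A.Term v := by simp [Opt]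

/-- The arguments of a compound have smaller codes, so the recursion has access to their status. The
relation `R` is defined on all numbers and can be used before it is known which of them are terms.
Requiring the arguments to be smaller mirrors the range condition; excluding `NodeLike` prevents an
element of D(X) from having two names. -/
theorem term_iff {v : M} : A.Term v ↔ (∃ t, t ∈ A.B ∧ v = node t) ∨
    ∃ t a b, v = compound t a b ∧ t ∈ A.L.dom ∧ A.Opt a ∧ A.Opt b ∧ A.R a (v + 1) ∧ A.R b (v + 1) ∧
      ¬ A.NodeLike t a b := by
  have hstep : A.Term v ↔ A.TermStep v (mkSeq A.exists_termFun.choose v) := by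
    rw [Term, A.exists_termFun.choose_spec.2]
    split_ifs with h <;> simp [h]
  have hent : ∀ a, a < v + 1 → ((a ≠ 0 →
      ent (mkSeq A.exists_termFun.choose v) (pred a) = 1) ↔ A.Opt a) := by
    intro a ha
    refine imp_congr_right fun h => ?_
    rw [ent_mkSeq A.exists_termFun.choose_spec.1, Term]
    rw [← succ_pred h] at ha
    simpa using ha
  rw [hstep, TermStep]
  refine or_congr ⟨fun h => ⟨_, h.2, h.1⟩, ?_⟩ ⟨?_, ?_⟩
  · rintro ⟨t, ht, rfl⟩
    rw [rt_node]
    exact ⟨rfl, ht⟩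
  · rintro ⟨h1, h2, h3, h4, h5⟩
    have hl : lf v ≠ 0 := by rw [h1, lf_compound]; exact one_ne_zero
    rw [hent _ (A.left_lt_of_compound hl)] at h3
    rw [hent _ (A.right_lt_of_compound hl)] at h4
    exact ⟨_, _, _, h1, h2, h3, h4, h5⟩
  · rintro ⟨t, a, b, h1, h2, h3, h4, h5⟩
    have hl : lf v ≠ 0 := by rw [h1, lf_compound]; exact one_ne_zero
    rw [hent _ (A.left_lt_of_compound hl), hent _ (A.right_lt_of_compound hl)]
    have e1 : A.label v = t := by rw [h1, label_compound]
    have e2 : A.left v = a := by rw [h1, left_compound]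
    have e3 : A.right v = b := by rw [h1, right_compound]
    rw [e1, e2, e3]
    exact ⟨h1, h2, h3, h4, h5⟩

theorem term_node {t : M} (ht : t ∈ A.B) : A.Term (node t) := A.term_iff.2 (Or.inl ⟨t, ht, rfl⟩)

variable {A}

theorem Term.label_mem {v : M} (h : A.Term v) : A.label v ∈ A.L.dom := by
  rcases A.term_iff.1 h with ⟨t, ht, rfl⟩ | ⟨t, a, b, rfl, ht, -⟩
  · rw [label_node]; exact A.sub t ht
  · rwa [label_compound]

/-- The label of a child is below that of its parent in L, so the label alone decides the
comparison. -/
theorem r_childTerm {t c : M} (hc : ∀ s, c = s + 1 → s ∈ A.B ∧ A.L.lt s t) :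
    A.Opt (childTerm c) ∧ A.R (childTerm c) (node t + 1) := by
  rcases pos_or_zero c with rfl | ⟨s, rfl⟩
  · rw [childTerm_zero, r_zero_left]
    exact ⟨A.opt_zero, succ_ne _⟩
  · obtain ⟨hs, hlt⟩ := hc s rfl
    rw [childTerm_succ, opt_succ, r_succ_iff]
    · refine ⟨A.term_node hs, Or.inl ?_⟩
      rwa [label_node, label_node]
    · rw [label_node, label_node]
      exact Or.inr (Or.inr (Or.inl fun h => A.L.irrefl _ (h ▸ hlt)))

theorem Term.left_spec {v : M} (h : A.Term v) : A.Opt (A.left v) ∧ A.R (A.left v) (v + 1) := by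
  rcases A.term_iff.1 h with ⟨t, ht, rfl⟩ | ⟨t, a, b, rfl, -, h1, -, h2, -, -⟩
  · rw [left_node]; exact r_childTerm fun s => A.child₀ t s ht
  · rw [left_compound]; exact ⟨h1, h2⟩

theorem Term.right_spec {v : M} (h : A.Term v) : A.Opt (A.right v) ∧ A.R (A.right v) (v + 1) := by
  rcases A.term_iff.1 h with ⟨t, ht, rfl⟩ | ⟨t, a, b, rfl, -, -, h1, -, h2, -⟩
  · rw [right_node]; exact r_childTerm fun s => A.child₁ t s ht
  · rw [right_compound]; exact ⟨h1, h2⟩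

theorem Term.eq_node {v : M} (h : A.Term v) (hl : lf v = 0) : A.label v ∈ A.B ∧ v = node (A.label v) := by
  rcases A.term_iff.1 h with ⟨t, ht, rfl⟩ | ⟨t, a, b, rfl, -⟩
  · rw [label_node]; exact ⟨ht, rfl⟩
  · rw [lf_compound] at hl; exact (one_ne_zero hl).elim

theorem Term.eq_compound {v : M} (h : A.Term v) (hl : lf v ≠ 0) :
    v = compound (A.label v) (A.left v) (A.right v) ∧
      ¬ A.NodeLike (A.label v) (A.left v) (A.right v) := by
  rcases A.term_iff.1 h with ⟨t, ht, rfl⟩ | ⟨t, a, b, rfl, -, -, -, -, -, h1⟩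
  · exact (hl (lf_node t)).elim
  · rw [label_compound, left_compound, right_compound]; exact ⟨rfl, h1⟩

theorem Term.ne_zero_or {v w : M} (hv : A.Term v) (hw : A.Term w) (h : A.label v = A.label w) :
    v = w ∨ lf v ≠ 0 ∨ lf w ≠ 0 := by
  by_contra h'
  push Not at h'
  exact h'.1 (by rw [(hv.eq_node h'.2.1).2, h, ← (hw.eq_node h'.2.2).2])

/-- A node and a compound cannot share label and arguments, since node-like compounds are not terms;
within each kind these data determine the code. -/
theorem Term.ext {v w : M} (hv : A.Term v) (hw : A.Term w) (h1 : A.label v = A.label w)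
    (h2 : A.left v = A.left w) (h3 : A.right v = A.right w) : v = w := by
  have key : ∀ {v w}, A.Term v → A.Term w → A.label v = A.label w → A.left v = A.left w →
      A.right v = A.right w → lf v = 0 → lf w = 0 := by
    intro v w hv hw h1 h2 h3 hl
    by_contra hl'
    refine (hw.eq_compound hl').2 ?_
    rw [← h1, ← h2, ← h3]
    obtain ⟨ht, h⟩ := hv.eq_node hl
    refine ⟨ht, ?_, ?_⟩
    · conv_lhs => rw [h]
      exact A.left_node _
    · conv_lhs => rw [h]
      exact A.right_node _
  by_cases hl : lf v = 0
  · rw [(hv.eq_node hl).2, (hw.eq_node (key hv hw h1 h2 h3 hl)).2, h1]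
  · have hl' : lf w ≠ 0 := fun h => hl (key hw hv h1.symm h2.symm h3.symm h)
    rw [(hv.eq_compound hl).1, (hw.eq_compound hl').1, h1, h2, h3]

theorem Term.r_iff {v w : M} (hv : A.Term v) (hw : A.Term w) : A.R (v + 1) (w + 1) ↔
    Lex A.L.lt A.R (A.label v) (A.left v) (A.right v) (A.label w) (A.left w) (A.right w) := by
  refine A.r_succ_iff ?_
  have := hv.ne_zero_or hw
  tauto

/-- Induction on the total size, with all terms quantified inside; the failure of this statement is
Σ⁰₁. Passing to arguments is needed only when v and w are distinct terms with equal labels. One of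
them is then a compound, so the total size decreases even if the third term is a node. -/
theorem r_trans {p q r : M} (hp : A.Opt p) (hq : A.Opt q) (hr : A.Opt r) (h : A.R p q)
    (h' : A.R q r) : A.R p r := by
  have key : ∀ n p q r, A.Opt p → A.Opt q → A.Opt r → size p + size q + size r ≤ n → A.R p q →
      A.R q r → A.R p r := by
    refine pi_induction S (by push Not; exact sig) fun n ih p q r hp hq hr hn h h' => ?_
    rcases pos_or_zero r with rfl | ⟨u, rfl⟩
    · exact (A.not_r_zero h').elim
    rcases pos_or_zero p with rfl | ⟨v, rfl⟩
    · exact A.r_zero_left.2 (succ_ne u)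
    rcases pos_or_zero q with rfl | ⟨w, rfl⟩
    · exact (A.not_r_zero h).elim
    rw [opt_succ] at hp hq hr
    have hvw : v ≠ w := by rintro rfl; exact A.r_irrefl _ h
    have hsize : ∀ f : M → M, (∀ v, size (f v) ≤ size (v + 1)) →
        (∀ v, lf v ≠ 0 → size (f v) < size (v + 1)) → A.label v = A.label w →
        size (f v) + size (f w) + size (f u) < n := by
      intro f h1 h2 hl
      refine lt_of_lt_of_le ?_ hn
      refine add_lt_add_of_lt_of_le ?_ (h1 u)
      rcases (hp.ne_zero_or hq hl).resolve_left hvw with h3 | h3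
      · exact add_lt_add_of_lt_of_le (h2 v h3) (h1 w)
      · exact add_lt_add_of_le_of_lt (h1 v) (h2 w h3)
    rw [hp.r_iff hq] at h
    rw [hq.r_iff hr] at h'
    rw [hp.r_iff hr]
    refine h.trans h' (A.L.trans _ _ _) (fun hl _ => ?_) fun hl _ => ?_
    · exact ih _ (hsize A.left A.size_left_le (fun _ => A.size_left_lt) hl) _ _ _
        hp.left_spec.1 hq.left_spec.1 hr.left_spec.1 le_rfl
    · exact ih _ (hsize A.right A.size_right_le (fun _ => A.size_right_lt) hl) _ _ _
        hp.right_spec.1 hq.right_spec.1 hr.right_spec.1 le_rfl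
  exact key _ p q r hp hq hr le_rfl h h'

theorem r_total {p q : M} (hp : A.Opt p) (hq : A.Opt q) : A.R p q ∨ p = q ∨ A.R q p := by
  have key : ∀ n p q, A.Opt p → A.Opt q → size p + size q ≤ n → A.R p q ∨ p = q ∨ A.R q p := by
    refine pi_induction S (by push Not; exact sig) fun n ih p q hp hq hn => ?_
    rcases pos_or_zero p with rfl | ⟨v, rfl⟩
    · rcases eq_or_ne q 0 with rfl | h
      · exact Or.inr (Or.inl rfl)
      · exact Or.inl (A.r_zero_left.2 h)
    rcases pos_or_zero q with rfl | ⟨w, rfl⟩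
    · exact Or.inr (Or.inr (A.r_zero_left.2 (succ_ne v)))
    by_cases hvw : v = w
    · exact Or.inr (Or.inl (by rw [hvw]))
    rw [opt_succ] at hp hq
    have hsize : ∀ f : M → M, (∀ v, size (f v) ≤ size (v + 1)) →
        (∀ v, lf v ≠ 0 → size (f v) < size (v + 1)) → A.label v = A.label w →
        size (f v) + size (f w) < n := by
      intro f h1 h2 hl
      refine lt_of_lt_of_le ?_ hn
      rcases (hp.ne_zero_or hq hl).resolve_left hvw with h3 | h3
      · exact add_lt_add_of_lt_of_le (h2 v h3) (h1 w)
      · exact add_lt_add_of_le_of_lt (h1 v) (h2 w h3)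
    rw [hp.r_iff hq, hq.r_iff hp]
    rcases Lex.total (l := A.L.lt) (r := A.R) (A.L.total _ hp.label_mem _ hq.label_mem)
      (fun hl => ih _ (hsize A.left A.size_left_le (fun _ => A.size_left_lt) hl) _ _
        hp.left_spec.1 hq.left_spec.1 le_rfl)
      (fun hl => ih _ (hsize A.right A.size_right_le (fun _ => A.size_right_lt) hl) _ _
        hp.right_spec.1 hq.right_spec.1 le_rfl) with h | ⟨h1, h2, h3⟩ | h
    · exact Or.inl h
    · exact (hvw (hp.ext hq h1 h2 h3)).elim
    · exact Or.inr (Or.inr h)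
  exact key _ p q hp hq le_rfl

variable (A)

/-- The linear order of terms. -/
def ord : LinOrd S where
  dom := {v | A.Term v}
  lt v w := A.Term v ∧ A.Term w ∧ A.R (v + 1) (w + 1)
  dom_mem := dec_set_iff.1 (.eq A.exists_termFun.choose_spec.1 (.const 1))
  lt_mem := inS2_iff.2 (by exact dec)
  lt_dom _ _ h := ⟨h.1, h.2.1⟩
  irrefl _ h := A.r_irrefl _ h.2.2
  trans v w u h h' := ⟨h.1, h'.2.1, r_trans (A.opt_succ.2 h.1) (A.opt_succ.2 h.2.1)
    (A.opt_succ.2 h'.2.1) h.2.2 h'.2.2⟩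
  total v hv w hw := by
    rcases r_total (A.opt_succ.2 hv) (A.opt_succ.2 hw) with h | h | h
    · exact Or.inl ⟨hv, hw, h⟩
    · exact Or.inr (Or.inl (by simpa using h))
    · exact Or.inr (Or.inr ⟨hw, hv, h⟩)

theorem ord_olt_iff {p q : M} (hp : A.Opt p) (hq : A.Opt q) : A.ord.olt p q ↔ A.R p q := by
  rcases pos_or_zero q with rfl | ⟨w, rfl⟩
  · exact iff_of_false (fun h => h.1 rfl) A.not_r_zero
  rcases pos_or_zero p with rfl | ⟨v, rfl⟩
  · exact iff_of_true ⟨succ_ne w, fun h => (h rfl).elim⟩ (A.r_zero_left.2 (succ_ne w))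
  · rw [opt_succ] at hp hq
    simp [LinOrd.olt, ord, hp, hq]

theorem lex_olt_iff {t a b t' a' b' : M} (ha : A.Opt a) (hb : A.Opt b) (ha' : A.Opt a')
    (hb' : A.Opt b') : Lex A.L.lt A.ord.olt t a b t' a' b' ↔ Lex A.L.lt A.R t a b t' a' b' := by
  rw [Lex, Lex, A.ord_olt_iff ha ha', A.ord_olt_iff hb hb']

/-- The embedding of terms. -/
def proj (v τ : M) : Prop := A.Term v ∧ DMem (lexPredilator A.L) A.ord τ ∧
  triLabel τ = A.label v ∧ triMid τ = A.left v ∧ triLast τ = A.right v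

variable {A}

theorem Term.exists_proj {v : M} (h : A.Term v) : ∃ τ, A.proj v τ := by
  obtain ⟨τ, hτ, h'⟩ := dMem_tri (X := A.ord) h.label_mem h.left_spec.1 h.right_spec.1
  exact ⟨τ, h, hτ, h'⟩

theorem proj_unique {v τ τ' : M} (h : A.proj v τ) (h' : A.proj v τ') : τ = τ' :=
  h.2.1.tri_ext h'.2.1 (h.2.2.1.trans h'.2.2.1.symm) (h.2.2.2.1.trans h'.2.2.2.1.symm)
    (h.2.2.2.2.trans h'.2.2.2.2.symm)

theorem proj_lt_iff {v τ σ : M} (h : A.proj v σ) (hτ : DMem (lexPredilator A.L) A.ord τ) :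
    DLt (lexPredilator A.L) A.ord σ τ ↔ Lex A.L.lt A.R (A.label v) (A.left v) (A.right v)
      (triLabel τ) (triMid τ) (triLast τ) := by
  rw [h.2.1.dLt_iff_lex hτ, A.lex_olt_iff h.2.1.triMid_opt h.2.1.triLast_opt hτ.triMid_opt
    hτ.triLast_opt, h.2.2.1, h.2.2.2.1, h.2.2.2.2]

theorem proj_dSupp_iff {v τ s : M} (h : A.proj v τ) :
    DSupp τ s ↔ s + 1 = A.left v ∨ s + 1 = A.right v := by
  rw [h.2.1.dSupp_iff, h.2.2.2.1, h.2.2.2.2]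

/-- A triple that looks like a node has that node as preimage. Otherwise the compound with these
data is the preimage, and the range condition is precisely what makes it a term. -/
theorem proj_range {τ : M} (hτ : DMem (lexPredilator A.L) A.ord τ) :
    (∃ x, A.proj x τ) ↔ ∀ s, DSupp τ s → ∀ ρ, A.proj s ρ → DLt (lexPredilator A.L) A.ord ρ τ := by
  constructor
  · rintro ⟨v, hv⟩ s hs ρ hρ
    rw [proj_lt_iff hρ hτ, hv.2.2.1, hv.2.2.2.1, hv.2.2.2.2, ← hρ.1.r_iff hv.1]
    rcases (proj_dSupp_iff hv).1 hs with h | h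
    · rw [h]; exact hv.1.left_spec.2
    · rw [h]; exact hv.1.right_spec.2
  · intro h
    by_cases hn : A.NodeLike (triLabel τ) (triMid τ) (triLast τ)
    · refine ⟨node (triLabel τ), A.term_node hn.1, hτ, ?_⟩
      rw [label_node, left_node, right_node]
      exact ⟨rfl, hn.2⟩
    -- The compound is not yet known to be a term. `r_succ_iff` still applies, because one of the
    -- two sides is a compound.
    · have hlt : ∀ c, A.Opt c → (∀ s, s + 1 = c → DSupp τ s) →
          A.R c (compound (triLabel τ) (triMid τ) (triLast τ) + 1) := by
        intro c hc hs
        rcases pos_or_zero c with rfl | ⟨s, rfl⟩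
        · exact A.r_zero_left.2 (succ_ne _)
        · obtain ⟨ρ, hρ⟩ := (A.opt_succ.1 hc).exists_proj
          have h1 := h s (hs s rfl) ρ hρ
          rw [proj_lt_iff hρ hτ] at h1
          rw [r_succ_iff, label_compound, left_compound, right_compound]
          · exact h1
          · rw [lf_compound]; exact Or.inr (Or.inl one_ne_zero)
      refine ⟨compound (triLabel τ) (triMid τ) (triLast τ), A.term_iff.2 (Or.inr ⟨_, _, _, rfl,
        hτ.triLabel_mem, hτ.triMid_opt, hτ.triLast_opt, hlt _ hτ.triMid_opt fun s hs => ?_,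
        hlt _ hτ.triLast_opt fun s hs => ?_, hn⟩), hτ, ?_⟩
      · exact hτ.dSupp_iff.2 (Or.inl hs)
      · exact hτ.dSupp_iff.2 (Or.inr hs)
      · rw [label_compound, left_compound, right_compound]
        exact ⟨rfl, rfl, rfl⟩

/-- Sequences that descend with respect to the subterm relation contain a node. -/
theorem exists_node {g : M → M} (hg : Comp S g)
    (h : ∀ n, g (n + 1) + 1 = A.left (g n) ∨ g (n + 1) + 1 = A.right (g n)) : ∃ n, lf (g n) = 0 := by
  by_contra hno
  push Not at hno
  have i1 := IComp.fun₁ hg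
  have : IComp S g := ⟨hg⟩
  -- As long as no node occurs, passing to an argument lowers the code by at least one. This can
  -- happen at most g 0 times.
  have hdec : ∀ n, g (n + 1) + 1 ≤ g n := fun n => by
    rw [← lt_succ]
    rcases h n with h | h
    · rw [h]; exact A.left_lt_of_compound (hno n)
    · rw [h]; exact A.right_lt_of_compound (hno n)
  have key : ∀ n, g n + n ≤ g 0 := by
    refine dec_induction S (by exact dec) (by rw [add_zero]) fun n ih => le_trans ?_ ih
    rw [add_comm n 1, ← add_assoc, add_comm 1 n]
    exact add_le_add_left (hdec n) n
  exact absurd (le_add_self.trans (key (g 0 + 1))) (not_le.2 (lt_add_one _))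

/-- The sequence reaches a node by `exists_node`. Arguments of nodes are nodes for children, so from
there on it consists of nodes and follows an infinite branch of the branching system. -/
theorem not_exists_descending {g : M → M} (hg : Comp S g) (hT : ∀ n, A.Term (g n)) :
    ¬ ∀ n, g (n + 1) + 1 = A.left (g n) ∨ g (n + 1) + 1 = A.right (g n) := by
  intro h
  obtain ⟨n₀, hn₀⟩ := exists_node hg h
  have i1 := IComp.fun₁ hg
  have : IComp S g := ⟨hg⟩
  have hchild : ∀ {w c : M}, w + 1 = childTerm c → w = node (rt w) ∧ c = rt w + 1 := by
    intro w c hw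
    rcases pos_or_zero c with rfl | ⟨s, rfl⟩
    · rw [childTerm_zero] at hw; exact (succ_ne w hw).elim
    · rw [childTerm_succ, add_left_inj] at hw
      rw [hw, rt_node]
      exact ⟨rfl, rfl⟩
  have hstep : ∀ n, lf (g n) = 0 → g (n + 1) = node (rt (g (n + 1))) ∧
      (A.c₀ (rt (g n)) = rt (g (n + 1)) + 1 ∨ A.c₁ (rt (g n)) = rt (g (n + 1)) + 1) := by
    intro n hn
    rcases h n with h1 | h1
    · rw [left, if_pos hn] at h1
      exact ⟨(hchild h1).1, Or.inl (hchild h1).2⟩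
    · rw [right, if_pos hn] at h1
      exact ⟨(hchild h1).1, Or.inr (hchild h1).2⟩
  have hall : ∀ n, lf (g (n₀ + n)) = 0 := by
    refine dec_induction S (by exact dec) (by rwa [add_zero]) fun n ih => ?_
    rw [← add_assoc, (hstep _ ih).1, lf_node]
  refine A.wf ⟨fun n => rt (g (n₀ + n)), by exact comp, fun n => ⟨?_, ?_⟩⟩
  · have h1 := (hT (n₀ + n)).eq_node (hall n)
    dsimp only
    rw [h1.2, rt_node]
    exact h1.1
  · have := (hstep _ (hall n)).2
    rwa [add_assoc] at this

variable (A)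

/-- The fixed point that is generated by a branching system. -/
def fixedPoint : WfOneFixedPoint (lexPredilator A.L) where
  X := A.ord
  π := A.proj
  π_fun := by
    refine ⟨inS2_iff.2 ?_, fun v τ h => ⟨h.1, h.2.1⟩, fun v hv => ?_⟩
    · unfold proj; exact dec
    · obtain ⟨τ, hτ⟩ := Term.exists_proj hv
      exact ⟨τ, hτ, fun τ' hτ' => proj_unique hτ' hτ⟩
  π_lt v w σ τ h hσ hτ := by
    rw [proj_lt_iff hσ hτ.2.1, hτ.2.2.1, hτ.2.2.2.1, hτ.2.2.2.2, ← hσ.1.r_iff hτ.1]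
    exact h.2.2
  wf := by
    rintro ⟨G, hG, h⟩
    obtain ⟨g, hg, hgG⟩ := exists_fun_of_graph (A := fun _ : M => True) (.const True)
      (R := G) (inS2_iff.1 hG.1).sig (fun x _ => (hG.2.2 x trivial).exists)
      fun x _ y y' h h' => (hG.2.2 x trivial).unique h h'
    have hT : ∀ n, A.Term (g n) := fun n => (hG.2.1 _ _ (hgG n trivial)).2
    refine not_exists_descending hg hT fun n => ?_
    obtain ⟨τ, hτ⟩ := (hT n).exists_proj
    exact (proj_dSupp_iff hτ).1 (h n _ _ τ (hgG _ trivial) (hgG _ trivial) hτ)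
  range τ hτ := proj_range hτ

end Branching

end

/-! ### From a tree without path to non-isomorphic fixed points -/

section

variable {M : Type u} [CommSemiring M] [LinearOrder M] [NatLike M]
variable {S : Set (Set M)} [hM : Model S]

instance IComp.mkSeq_left {G : M → M} [hG : IComp S G] : IComp S (SOA.mkSeq G) :=
  ⟨(IComp.mkSeq (G := fun _ : M => G) (f := fun k : M => k)
    (hG := ⟨hG.out.comp_of .snd'⟩)).out⟩

/-- D(F) keeps the indices and changes only the enumeration, so it acts on each argument by F. -/
theorem DMap.left {L X Y : LinOrd S} {F : M → M → Prop} {τ τ' x : M}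
    (h : DMem (lexPredilator L) X τ) (h' : DMem (lexPredilator L) Y τ') (hF : DMap F τ τ') :
    (x + 1 = triMid τ → ∃ z, F x z ∧ z + 1 = triMid τ') ∧
      (x + 1 = triLast τ → ∃ z, F x z ∧ z + 1 = triLast τ') := by
  obtain ⟨n, e, t, i, j, rfl, he, ht, hi, hj, -⟩ := h.tri
  obtain ⟨n', e', t', i', j', rfl, he', ht', hi', hj', -⟩ := h'.tri
  obtain ⟨e₁, σ, e₁', h1, h2, hE⟩ := hF
  obtain ⟨rfl, rfl⟩ := pair_inj.1 h1
  obtain ⟨rfl, h3⟩ := pair_inj.1 h2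
  obtain ⟨rfl, h4⟩ := pair_inj.1 h3
  obtain ⟨rfl, rfl⟩ := pair_inj.1 h4
  have key : ∀ {i}, i ≤ n → i ≤ n' → x + 1 = up e i → ∃ z, F x z ∧ z + 1 = up e' i := by
    intro i hi hi' hx
    obtain ⟨l, rfl, hl⟩ := (succ_eq_up_iff S he.1 hi).1 hx
    obtain ⟨x', hx', hF⟩ := (hE l (ent e' l)).1 ((he'.1.entry_iff S).2 ⟨succ_le.1 hi', rfl⟩)
    exact ⟨_, hx'.unique hl ▸ hF, (up_succ _ _).symm⟩
  rw [triMid_pair, triMid_pair, triLast_pair, triLast_pair]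
  exact ⟨key hi hi', key hj hj'⟩

/-- The branching system without nodes. -/
def emptyBranching (L : LinOrd S) : Branching S where
  L := L
  B := ∅
  c₀ _ := 0
  c₁ _ := 0
  B_mem := dec_set_iff.1 (.const False)
  comp₀ := .const 0
  comp₁ := .const 0
  sub _ h := h.elim
  child₀ _ _ h := h.elim
  child₁ _ _ h := h.elim
  wf := fun ⟨_, _, h⟩ => (h 0).1.elim

/-- Isomorphisms into the fixed point without nodes turn children into smaller numbers. -/
theorem Branching.iso_child_lt (A : Branching S) {F : M → M → Prop} {t s y z : M}
    (hF : IsFixedPointIso (D := lexPredilator A.L) A.fixedPoint (emptyBranching A.L).fixedPoint F)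
    (ht : t ∈ A.B) (hs : A.c₀ t = s + 1 ∨ A.c₁ t = s + 1) (hy : F (node t) y) (hz : F (node s) z) :
    z < y := by
  have hyT : (emptyBranching A.L).Term y := (hF.1.2.1 _ _ hy).2
  obtain ⟨τ, hτ⟩ := (A.term_node ht).exists_proj
  obtain ⟨τ', hτ'⟩ := hyT.exists_proj
  have hmap := hF.2.2.2 _ _ _ _ hy hτ hτ'
  -- Without nodes every term is a compound, so its arguments have smaller codes. Compatibility with
  -- D(F) identifies z with one of these arguments.
  have hl : lf y ≠ 0 := fun h => (hyT.eq_node h).1.elim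
  have hleft := DMap.left (x := node s) hτ.2.1 hτ'.2.1 hmap
  rw [hτ.2.2.2.1, hτ'.2.2.2.1, hτ.2.2.2.2, hτ'.2.2.2.2, left_node, right_node] at hleft
  have huniq : ∀ z', F (node s) z' → z' = z := fun z' hz' =>
    (hF.1.2.2 _ (hF.1.2.1 _ _ hz).1).unique hz' hz
  rcases hs with hs | hs
  · rw [hs] at hleft
    obtain ⟨z', hz', h⟩ := hleft.1 (childTerm_succ s).symm
    rw [huniq z' hz'] at h
    have := (emptyBranching A.L).left_lt_of_compound hl
    rwa [← h, add_lt_add_iff_right] at this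
  · rw [hs] at hleft
    obtain ⟨z', hz', h⟩ := hleft.2 (childTerm_succ s).symm
    rw [huniq z' hz'] at h
    have := (emptyBranching A.L).right_lt_of_compound hl
    rwa [← h, add_lt_add_iff_right] at this

/-! ### Binary trees -/

variable {T : Set M} {len : M → M}

theorem IsBinaryTree.restrict_mem (S : Set (Set M)) [Model S] (hT : IsBinaryTree T) {t k j : M}
    (ht : t ∈ T) (hk : IsSeq k t) (hj : j ≤ k) : mkSeq (ent t) j ∈ T := by
  rcases hj.lt_or_eq with hj | rfl
  · have hs := isSeq_mkSeq (S := S) (F := ent t) comp j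
    refine hT.2 t ht k hk j hj _ hs fun i x hx => ?_
    obtain ⟨hi, rfl⟩ := (hs.entry_iff S).1 hx
    rw [ent_mkSeq (S := S) comp hi]
    exact (hk.entry_iff S).2 ⟨hi.trans hj, rfl⟩
  · rwa [hk.mkSeq_ent S]

/-- The order of a tree in which longer sequences are smaller. -/
def treeOrd (hT : T ∈ S) (hlen : Comp S len) : LinOrd S where
  dom := T
  lt s t := s ∈ T ∧ t ∈ T ∧ (len t < len s ∨ len t = len s ∧ s < t)
  dom_mem := hT
  lt_mem := by
    have i1 := IComp.fun₁ hlen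
    have i2 := IDec.mem hT
    exact inS2_iff.2 (by exact dec)
  lt_dom _ _ h := ⟨h.1, h.2.1⟩
  irrefl _ h := h.2.2.elim (lt_irrefl _) fun h => lt_irrefl _ h.2
  trans s t u h h' := by
    refine ⟨h.1, h'.2.1, ?_⟩
    rcases h.2.2 with h1 | ⟨h1, h2⟩ <;> rcases h'.2.2 with h3 | ⟨h3, h4⟩
    · exact Or.inl (h3.trans h1)
    · exact Or.inl (h3.trans_lt h1)
    · exact Or.inl (h3.trans_eq h1)
    · exact Or.inr ⟨h3.trans h1, h2.trans h4⟩
  total s hs t ht := by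
    rcases lt_trichotomy (len s) (len t) with h | h | h
    · exact Or.inr (Or.inr ⟨ht, hs, Or.inl h⟩)
    · rcases lt_trichotomy s t with h' | h' | h'
      · exact Or.inl ⟨hs, ht, Or.inr ⟨h.symm, h'⟩⟩
      · exact Or.inr (Or.inl h')
      · exact Or.inr (Or.inr ⟨ht, hs, Or.inr ⟨h, h'⟩⟩)
    · exact Or.inl ⟨hs, ht, Or.inl h⟩

open Classical in
/-- The extension of the node `t` by the entry `j`, if it belongs to the tree. -/
noncomputable def treeChild (T : Set M) (len : M → M) (j t : M) : M :=
  if snoc t (len t) j ∈ T then snoc t (len t) j + 1 else 0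

theorem comp_treeChild (hT : T ∈ S) (hlen : Comp S len) (j : M) : Comp S (treeChild T len j) := by
  have i1 := IComp.fun₁ hlen
  have : IComp S len := ⟨hlen⟩
  have i2 := IDec.mem hT
  classical
  exact comp (f := fun t => if snoc t (len t) j ∈ T then snoc t (len t) j + 1 else 0)

theorem treeChild_eq_iff {j t s : M} :
    treeChild T len j t = s + 1 ↔ s ∈ T ∧ s = snoc t (len t) j := by
  unfold treeChild
  split_ifs with h
  · rw [add_left_inj]
    exact ⟨fun h' => ⟨h' ▸ h, h'.symm⟩, fun h' => h'.2.symm⟩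
  · exact ⟨fun h' => (succ_ne s h'.symm).elim, fun h' => (h (h'.2 ▸ h'.1)).elim⟩

theorem len_snoc (hl : ∀ t, t ∈ T → IsSeq (len t) t) {t n j : M} (h : snoc t n j ∈ T)
    (S : Set (Set M)) [Model S] : len (snoc t n j) = n + 1 :=
  (hl _ h).len_unique (isSeq_snoc S t n j)

theorem treeChild_lt (hT : T ∈ S) (hlen : Comp S len) (hl : ∀ t, t ∈ T → IsSeq (len t) t) {j t s : M}
    (ht : t ∈ T) (h : treeChild T len j t = s + 1) : s ∈ T ∧ (treeOrd hT hlen).lt s t := by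
  obtain ⟨hs, rfl⟩ := treeChild_eq_iff.1 h
  refine ⟨hs, hs, ht, Or.inl ?_⟩
  rw [len_snoc hl hs S]
  exact lt_add_one _

/-- The sequence need not start at the root, but g n has length at least n in any case, and later
members extend earlier ones. The i-th value of the path can thus be read off from g (i + 1), and its
restriction to k is an initial segment of g k. -/
theorem exists_path (hbin : IsBinaryTree T) (hl : ∀ t, t ∈ T → IsSeq (len t) t) (hlen : Comp S len)
    {g : M → M} (hg : Comp S g) (h : ∀ n, g n ∈ T ∧ (treeChild T len 0 (g n) = g (n + 1) + 1 ∨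
      treeChild T len 1 (g n) = g (n + 1) + 1)) :
    ∃ G : M → M → Prop, IsFun S Set.univ {x | x = 0 ∨ x = 1} G ∧
      ∀ k, ∃ c ∈ T, IsSeq k c ∧ ∀ i x, i < k → G i x → Entry c i x := by
  have i1 := IComp.fun₁ hg
  have : IComp S g := ⟨hg⟩
  have i2 := IComp.fun₁ hlen
  have : IComp S len := ⟨hlen⟩
  have hstep : ∀ n, ∃ j, g (n + 1) = snoc (g n) (len (g n)) j := fun n =>
    (h n).2.elim (fun h1 => ⟨_, (treeChild_eq_iff.1 h1).2⟩) fun h1 => ⟨_, (treeChild_eq_iff.1 h1).2⟩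
  have hn : ∀ n, n ≤ len (g n) := by
    refine dec_induction S (by exact dec) zero_le fun n ih => ?_
    obtain ⟨j, hj⟩ := hstep n
    rw [hj, len_snoc hl (hj ▸ (h (n + 1)).1) S]
    exact add_le_add_left ih 1
  have hagree : ∀ i n, i < n → ∀ m, ent (g (n + m)) i = ent (g n) i := by
    intro i n hi
    refine dec_induction S (by exact dec) (by rw [add_zero]) fun m ih => ?_
    obtain ⟨j, hj⟩ := hstep (n + m)
    rw [← add_assoc, hj, ent_snoc_of_lt S, ih]
    exact hi.trans_le (le_self_add.trans (hn (n + m)))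
  refine ⟨fun i x => x = ent (g (i + 1)) i, ⟨inS2_iff.2 (by exact dec), fun i x hx => ⟨trivial, ?_⟩,
    fun i _ => ⟨_, rfl, fun _ h => h⟩⟩, fun k => ?_⟩
  · refine (hbin.1 _ (h (i + 1)).1).2 i x (((hl _ (h (i + 1)).1).entry_iff S).2 ⟨?_, hx.symm⟩)
    exact (lt_add_one i).trans_le (hn _)
  · have hs := isSeq_mkSeq (S := S) (F := ent (g k)) comp k
    refine ⟨_, hbin.restrict_mem S (h k).1 (hl _ (h k).1) (hn k), hs, ?_⟩
    rintro i x hi rfl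
    refine (hs.entry_iff S).2 ⟨hi, ?_⟩
    rw [ent_mkSeq (S := S) comp hi]
    obtain ⟨m, rfl⟩ := exists_add_of_le (succ_le.2 hi)
    exact hagree i _ (lt_add_one i) m

/-- The nodes of a binary tree without path form a branching system. -/
noncomputable def treeBranching (hT : T ∈ S) (hbin : IsBinaryTree T) (hlen : Comp S len)
    (hl : ∀ t, t ∈ T → IsSeq (len t) t)
    (hno : ¬ ∃ G : M → M → Prop, IsFun S Set.univ {x | x = 0 ∨ x = 1} G ∧
      ∀ k, ∃ c ∈ T, IsSeq k c ∧ ∀ i x, i < k → G i x → Entry c i x) : Branching S where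
  L := treeOrd hT hlen
  B := T
  c₀ := treeChild T len 0
  c₁ := treeChild T len 1
  B_mem := hT
  comp₀ := comp_treeChild hT hlen 0
  comp₁ := comp_treeChild hT hlen 1
  sub _ h := h
  child₀ _ _ ht h := treeChild_lt hT hlen hl ht h
  child₁ _ _ ht h := treeChild_lt hT hlen hl ht h
  wf := fun ⟨_, hg, h⟩ => hno (exists_path hbin hl hlen hg h)

/-- The uniqueness of fixed points implies weak König's lemma. -/
theorem wkl_of_oneFixedPointsUnique (h : OneFixedPointsUnique S) : WKL S := by
  intro T hT hbin hinf
  by_contra hno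
  obtain ⟨len, hlen, hl⟩ := exists_fun_of_graph (.mem hT .id) (A := fun t => t ∈ T)
    (R := fun t k => IsSeq k t) sig (fun t ht => (hbin.1 t ht).1)
    fun t _ k k' hk hk' => hk.len_unique hk'
  let A : Branching S := treeBranching hT hbin hlen hl hno
  obtain ⟨F, hF⟩ := h (lexPredilator A.L) A.fixedPoint (emptyBranching A.L).fixedPoint
  have hdom : Dec S fun x : M => x ∈ A.fixedPoint.X.dom := .mem A.fixedPoint.X.dom_mem .id
  obtain ⟨f, hf, hfF⟩ := exists_fun_of_graph hdom (R := F) (inS2_iff.1 hF.1.1).sig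
    (fun x hx => (hF.1.2.2 x hx).exists) fun x hx y y' h h' => (hF.1.2.2 x hx).unique h h'
  have hfT : ∀ t, t ∈ T → F (node t) (f (node t)) := fun t ht => hfF _ (A.term_node ht)
  have i1 := IComp.fun₁ hf
  have i2 := IComp.fun₁ hlen
  -- By `iso_child_lt` the image under f drops by at least one with each further entry of t. For j
  -- equal to the length of t, that length is bounded by the image of the root, uniformly in t.
  have hbound : ∀ t, t ∈ T → ∀ j, j ≤ len t →
      f (node (mkSeq (ent t) j)) + j ≤ f (node (mkSeq (ent t) 0)) := by
    intro t ht
    refine dec_induction S (by exact dec) (fun _ => by rw [add_zero]) fun j ih hj => ?_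
    have hj' := succ_le.1 hj
    refine le_trans ?_ (ih hj'.le)
    have hr := hbin.restrict_mem S ht (hl t ht) hj'.le
    have hr' := hbin.restrict_mem S ht (hl t ht) hj
    have hs := isSeq_mkSeq (S := S) (F := ent t) comp j
    have heq : mkSeq (ent t) (j + 1) = snoc (mkSeq (ent t) j) (len (mkSeq (ent t) j)) (ent t j) := by
      rw [(hl _ hr).len_unique hs]
      refine (isSeq_mkSeq (S := S) (F := ent t) comp _).ext S (isSeq_snoc S _ _ _) fun i hi => ?_
      rw [ent_mkSeq (S := S) comp hi]
      rcases (lt_succ.1 hi).lt_or_eq with hi | rfl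
      · rw [ent_snoc_of_lt S hi, ent_mkSeq (S := S) comp hi]
      · rw [ent_snoc_last S]
    have hc : A.c₀ (mkSeq (ent t) j) = mkSeq (ent t) (j + 1) + 1 ∨
        A.c₁ (mkSeq (ent t) j) = mkSeq (ent t) (j + 1) + 1 := by
      refine ((hbin.1 t ht).2 j (ent t j) (((hl t ht).entry_iff S).2 ⟨hj', rfl⟩)).imp
        (fun h0 => treeChild_eq_iff.2 ⟨hr', ?_⟩) fun h1 => treeChild_eq_iff.2 ⟨hr', ?_⟩
      · rw [heq, h0]
      · rw [heq, h1]
    have hlt := succ_le.2 (A.iso_child_lt hF hr hc (hfT _ hr) (hfT _ hr'))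
    rw [add_comm j 1, ← add_assoc, add_comm 1 j]
    exact add_le_add_left hlt j
  obtain ⟨c, hc, -⟩ := hinf 0
  have hroot : ∀ t, mkSeq (ent t) 0 = mkSeq (ent c) 0 := fun t =>
    (isSeq_mkSeq (S := S) (F := ent t) comp 0).ext S (isSeq_mkSeq (S := S) (F := ent c) comp 0)
      fun i hi => absurd hi not_lt_zero
  -- There is a common bound on the codes of all sequences of at most that length with entries below
  -- 2, against the infinity of T.
  obtain ⟨b, hb⟩ := exists_seq_bound S (f (node (mkSeq (ent c) 0))) (1 + 1)
  obtain ⟨t, ht, hbt⟩ := hinf b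
  refine absurd hbt (not_lt.2 (hb (len t) t ?_ (hl t ht) fun i hi => ?_).le)
  · rw [← hroot t]
    exact le_add_self.trans (hbound t ht (len t) le_rfl)
  · rcases (hbin.1 t ht).2 i _ (((hl t ht).entry_iff S).2 ⟨hi, rfl⟩) with h0 | h1
    · rw [h0]; exact zero_lt_one.trans (lt_add_one 1)
    · rw [h1]; exact lt_add_one 1

end

/-! ### The equivalence and the passage from the bare axioms -/

theorem oneFixedPointsUnique_iff {M : Type u} [CommSemiring M] [LinearOrder M] [NatLike M]
    (S : Set (Set M)) [Model S] : OneFixedPointsUnique S ↔ WKL S :=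
  ⟨wkl_of_oneFixedPointsUnique, fun hW _ _ _ => WfOneFixedPoint.exists_iso hW⟩

theorem IsRCA0.natLike {M : Type u} [Zero M] [One M] [Add M] [Mul M] [LT M] {S : Set (Set M)}
    (hS : IsRCA0 S) : @NatLike M hS.commSemiring hS.linearOrder := by
  let := hS.commSemiring
  let := hS.linearOrder
  have := hS.isStrictOrderedRing
  exact {
    toIsStrictOrderedRing := inferInstance
    exists_add_of_le := by
      intro a b h
      rcases h.lt_or_eq with h | rfl
      · obtain ⟨k, rfl⟩ := (hS.lt_iff_exists a b).1 h
        exact ⟨k + 1, add_assoc a k 1⟩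
      · exact ⟨0, (_root_.add_zero a).symm⟩
    le_add_self := fun a b => by
      rw [add_comm]
      rcases hS.zero_le b with h | h
      · exact (lt_add_of_pos_right a h).le
      · rw [← h, _root_.add_zero]
    le_self_add := fun a b => by
      rcases hS.zero_le b with h | h
      · exact (lt_add_of_pos_right a h).le
      · rw [← h, _root_.add_zero]
    le_of_lt_succ := fun a b h => ((hS.lt_succ_iff a b).1 h).elim le_of_lt le_of_eq }

end SOA

theorem lemma7p1 {M : Type*} [Zero M] [One M] [Add M] [Mul M] [LT M] (S : Set (Set M))
    (hS : SOA.IsRCA0 S) : SOA.OneFixedPointsUnique S ↔ SOA.WKL S := by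
  let := hS.commSemiring
  let := hS.linearOrder
  have := hS.natLike
  have : SOA.Model S := ⟨hS⟩
  exact SOA.oneFixedPointsUnique_iff S
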